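/- Notation. For a C*-algebra $B$, $B_+$ is its positive cone and $\mathrm{Ped}(B)$ its Pedersen ideal (the smallest dense two-sided ideal), $\mathrm{Ped}(B)_+=\mathrm{Ped}(B)\cap B_+$, and for $a\in B_+$, $\mathrm{Her}(a)=\overline{aBa}$ is the hereditary C*-subalgebra generated by $a$. A quasitrace on a *-algebra $P$ over $\mathbb C$ is a map $\tau:P\to\mathbb{C}$ with $0\le\tau(x^*x)=\tau(xx^*)$ for all $x$, linear on commutative *-subalgebras, and with $\tau(a+ib)=\tau(a)+i\tau(b)$ for self-adjoint $a,b$; it is a 2-quasitrace if it extends to a quasitrace on $M_2(P)$ (via $x\mapsto x\otimes e_{1,1}$). For $\varepsilon>0$ let $f_\varepsilon:\mathbb R\to[0,1]$ be $0$ on $(-\infty,\varepsilon]$, $1$ on $[2\varepsilon,\infty)$ and linear on $[\varepsilon,2\varepsilon]$. Let $A$ be a C*-algebra, let $\mathbb{K}$ be the compact operators on a separable infinite-dimensional Hilbert space with matrix units $e_{i,j}$, and identify $A$ with $A\otimes e_{1,1}\subset A\otimes\mathbb K$. Let $\widetilde{\mathrm{QT}}(A)$ be the set of 2-quasitraces $\tau$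 on $\mathrm{Ped}(A\otimes\mathbb{K})$, with the topology of pointwise convergence on $\mathrm{Ped}(A\otimes\mathbb{K})$; for $a\in (A\otimes\mathbb K)_+\setminus\mathrm{Ped}(A\otimes\mathbb K)$ put $\tau(a)=\lim_{\varepsilon\to0^+}\tau((a-\varepsilon)_+)\in[0,\infty]$. Let $$\mathrm{QT}(A)=\Big\{\tau\in\widetilde{\mathrm{QT}}(A):\ \sup\{\tau(a\otimes e_{1,1}):a\in\mathrm{Ped}(A)_+,\ \|a\|\le1\}=1\Big\}$$ and let $\overline{\mathrm{QT}(A)}^w$ be its closure in $\widetilde{\mathrm{QT}}(A)$. For $x\in A\otimes\mathbb K$ put $\|x\|_2=\sup\{\tau(x^*x)^{1/2}:\tau\in\overline{\mathrm{QT}(A)}^w\}\in[0,\infty]$. For $a\in(A\otimes\mathbb{K})_+$ put $d_\tau(a)=\lim_n\tau(f_{1/n}(a))$ and $$\omega(a)=\lim_{n\to\infty}\sup\{d_\tau(a)-\tau(f_{1/n}(a)):\tau\in\overline{\mathrm{QT}(A)}^w\}.$$ An element $a\in\mathrm{Ped}(A\otimes\mathbb{K})_+$ has tracial approximate oscillation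 zero if for every $\varepsilon>0$ there is a positive $c\in\mathrm{Her}(a)$ with $\|a-c\|_2<\varepsilon$, $\|c\|\le\|a\|$ and $\omega(c)<\varepsilon$. Let $l^\infty(A)$ be the C*-algebra of norm-bounded sequences in $A$ and $J_A=\{(x_n)\in l^\infty(A):\lim_n\|x_n\|_2=0\}$, a closed two-sided ideal. A C*-algebra $B$ has real rank zero if the invertible self-adjoint elements of its unitization are dense in the self-adjoint elements of the unitization. Theorem. Let $A$ be a separable simple C*-algebra with $\mathrm{QT}(A)\neq\emptyset$. The following are equivalent: (i) every $a\in\mathrm{Ped}(A\otimes\mathbb{K})_+$ has tracial approximate oscillation zero; (ii) every $a\in\mathrm{Ped}(A)_+$ (regarded as $a\otimes e_{1,1}$) has tracial approximate oscillation zero; (iii) $l^\infty(A)/J_A$ has real rank zero. -/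

import Mathlib

open Filter Topology

universe u

noncomputable section

section CStarQuotient

variable {A : Type u} [NonUnitalCStarAlgebra A]

/-- A linear subspace of an algebra is a two-sided ideal. -/
def IsTwoSided (I : Submodule ℂ A) : Prop :=
  ∀ a x : A, x ∈ I → a * x ∈ I ∧ x * a ∈ I

variable (A) in
/-- Norm-closed, self-adjoint two-sided ideals of a C*-algebra. -/
structure ClosedStarIdeal extends NonUnitalStarSubalgebra ℂ A where
  mul_mem_left : ∀ a x : A, x ∈ carrier → a * x ∈ carrier
  mul_mem_right : ∀ a x : A, x ∈ carrier → x * a ∈ carrier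
  isClosed : IsClosed carrier

namespace ClosedStarIdeal

/-- The closed self-adjoint two-sided ideal generated by a set. -/
def span (s : Set A) : ClosedStarIdeal A where
  carrier := {x | ∀ I : ClosedStarIdeal A, s ⊆ I.carrier → x ∈ I.carrier}
  add_mem' hx hy I hI := I.add_mem' (hx I hI) (hy I hI)
  zero_mem' I _ := I.zero_mem'
  mul_mem' hx hy I hI := I.mul_mem' (hx I hI) (hy I hI)
  smul_mem' c _ hx I hI := I.smul_mem' c (hx I hI)
  star_mem' hx I hI := I.star_mem' (hx I hI)
  mul_mem_left a x hx I hI := I.mul_mem_left a x (hx I hI)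
  mul_mem_right a x hx I hI := I.mul_mem_right a x (hx I hI)
  isClosed := by
    simp only [Set.ofPred_forall]
    exact isClosed_iInter fun I => isClosed_iInter fun _ => I.isClosed

/-- The quotient C*-algebra `A / I`, with the quotient norm. -/
def Quotient (I : ClosedStarIdeal A) : Type u := A ⧸ I.toSubmodule

namespace Quotient

variable (I : ClosedStarIdeal A)

instance isClosedToSubmodule : IsClosed (I.toSubmodule : Set A) := I.isClosed

instance instNACG : NormedAddCommGroup I.Quotient :=
  inferInstanceAs (NormedAddCommGroup (A ⧸ I.toSubmodule))

instance instNormedSpace : NormedSpace ℂ I.Quotient :=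
  inferInstanceAs (NormedSpace ℂ (A ⧸ I.toSubmodule))

instance instComplete : CompleteSpace I.Quotient :=
  inferInstanceAs (CompleteSpace (A ⧸ I.toSubmodule))

/-- The quotient map. -/
def mk : A →ₗ[ℂ] I.Quotient := I.toSubmodule.mkQ

theorem mk_surjective : Function.Surjective (mk I) := I.toSubmodule.mkQ_surjective

theorem mk_eq_zero {x : A} : mk I x = 0 ↔ x ∈ I.carrier :=
  Submodule.Quotient.mk_eq_zero I.toSubmodule

theorem norm_mk_le (x : A) : ‖mk I x‖ ≤ ‖x‖ := Submodule.Quotient.norm_mk_le I.toSubmodule x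

theorem exists_rep (q : I.Quotient) {ε : ℝ} (hε : 0 < ε) :
    ∃ x : A, mk I x = q ∧ ‖x‖ < ‖q‖ + ε :=
  Submodule.Quotient.norm_mk_lt (S := I.toSubmodule) q hε

theorem mk_eq_mk {x y : A} : mk I x = mk I y ↔ x - y ∈ I.carrier := by
  rw [← sub_eq_zero, ← map_sub, mk_eq_zero]

instance instMul : Mul I.Quotient where
  mul := Quotient.map₂ (· * ·) (by
    intro a b h c d h'
    rw [← Quotient.eq_iff_equiv] at *
    have h1 := (mk_eq_mk I).1 h
    have h2 := (mk_eq_mk I).1 h'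
    refine (mk_eq_mk I).2 ?_
    have : a * c - b * d = (a - b) * c + b * (c - d) := by noncomm_ring
    rw [this]
    exact I.add_mem' (I.mul_mem_right _ _ h1) (I.mul_mem_left _ _ h2))

theorem mk_mul (x y : A) : mk I (x * y) = mk I x * mk I y := rfl

instance instStar : Star I.Quotient where
  star := Quotient.map star (by
    intro a b h
    rw [← Quotient.eq_iff_equiv] at *
    refine (mk_eq_mk I).2 ?_
    rw [← star_sub]
    exact I.star_mem' ((mk_eq_mk I).1 h))

theorem mk_star (x : A) : mk I (star x) = star (mk I x) := rfl

/-- The C*-identity for the quotient norm, by means of an approximate unit of the ideal. -/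
theorem norm_sq_le (q : I.Quotient) : ‖q‖ * ‖q‖ ≤ ‖star q * q‖ := by
  obtain ⟨x, rfl⟩ := mk_surjective I q
  rw [← mk_star, ← mk_mul]
  refine le_of_forall_pos_le_add fun ε hε => ?_
  obtain ⟨z, hz, hzn⟩ := exists_rep I (mk I (star x * x)) (half_pos hε)
  have hi : z - star x * x ∈ I.carrier := (mk_eq_mk I).1 hz
  let J : NonUnitalStarSubalgebra ℂ A := I.toNonUnitalStarSubalgebra
  have : IsClosed (J : Set A) := I.isClosed
  let : PartialOrder J := CStarAlgebra.spectralOrder J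
  have : StarOrderedRing J := CStarAlgebra.spectralOrderedRing J
  have hl := CStarAlgebra.increasingApproximateUnit J
  let i : J := ⟨z - star x * x, hi⟩
  have ht : Tendsto (fun e : J => e * i) (CStarAlgebra.approximateUnit J) (𝓝 i) :=
    hl.tendsto_mul_right i
  have hev : ∀ᶠ e : J in CStarAlgebra.approximateUnit J, dist (e * i) i < ε / 2 :=
    Metric.tendsto_nhds.1 ht _ (half_pos hε)
  obtain ⟨e, he1, he2, he3⟩ :=
    (hev.and (hl.eventually_nonneg.and hl.eventually_norm)).exists
  obtain ⟨b, hb⟩ := CStarAlgebra.nonneg_iff_eq_star_mul_self.1 he2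
  let : PartialOrder (Unitization ℂ A) := CStarAlgebra.spectralOrder _
  have : StarOrderedRing (Unitization ℂ A) := CStarAlgebra.spectralOrderedRing _
  let E : Unitization ℂ A := ((e : A) : Unitization ℂ A)
  have hE0 : 0 ≤ E := by
    have : E = star (((b : A) : Unitization ℂ A)) * ((b : A) : Unitization ℂ A) := by
      simp only [E, hb]; simp
    rw [this]; exact star_mul_self_nonneg _
  have hEn : ‖E‖ ≤ 1 := by
    simp only [E, Unitization.norm_inr]; exact he3
  have hE1 : E ≤ 1 := (CStarAlgebra.norm_le_one_iff_of_nonneg E hE0).1 hEn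
  have hF : ‖1 - E‖ ≤ 1 :=
    (CStarAlgebra.norm_le_one_iff_of_nonneg (1 - E) (sub_nonneg.2 hE1)).2
      (sub_le_self _ hE0)
  have hEs : star E = E := (IsSelfAdjoint.of_nonneg hE0).star_eq
  have hxe : mk I x = mk I (x - x * (e : A)) := by
    rw [mk_eq_mk]
    simpa using I.mul_mem_left x _ e.2
  have h1 : ‖mk I x‖ ≤ ‖x - x * (e : A)‖ := hxe ▸ norm_mk_le I _
  set X : Unitization ℂ A := (x : Unitization ℂ A)
  set Z : Unitization ℂ A := (z : Unitization ℂ A)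
  have h2 : ‖x - x * (e : A)‖ = ‖X * (1 - E)‖ := by
    rw [← Unitization.norm_inr (𝕜 := ℂ)]
    congr 1
    simp [X, E, mul_sub]
  have h3 : ‖X * (1 - E)‖ * ‖X * (1 - E)‖ = ‖(1 - E) * (star X * X) * (1 - E)‖ := by
    rw [← CStarRing.norm_star_mul_self, star_mul, star_sub, star_one, hEs]
    simp only [mul_assoc]
  have h4 : (1 - E) * (star X * X) * (1 - E)
      = (1 - E) * Z * (1 - E) - ((1 - E) * (Z - star X * X)) * (1 - E) := by noncomm_ring
  have h5 : ‖(1 - E) * (Z - star X * X)‖ < ε / 2 := by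
    have : (1 - E) * (Z - star X * X) = -(((((e * i - i : J) : A)) : Unitization ℂ A)) := by
      simp [E, Z, X, i, sub_mul]
    rw [this, norm_neg, Unitization.norm_inr]
    rw [dist_eq_norm] at he1
    exact he1
  have h6 : ‖(1 - E) * Z * (1 - E)‖ ≤ ‖z‖ := by
    calc ‖(1 - E) * Z * (1 - E)‖ ≤ ‖1 - E‖ * ‖Z‖ * ‖1 - E‖ :=
          (norm_mul_le _ _).trans (mul_le_mul_of_nonneg_right (norm_mul_le _ _) (norm_nonneg _))
      _ ≤ 1 * ‖Z‖ * 1 := by gcongr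
      _ = ‖z‖ := by simp [Z, Unitization.norm_inr]
  have h7 : ‖((1 - E) * (Z - star X * X)) * (1 - E)‖ ≤ ε / 2 := by
    calc _ ≤ ‖(1 - E) * (Z - star X * X)‖ * ‖1 - E‖ := norm_mul_le _ _
      _ ≤ ε / 2 * 1 := by gcongr
      _ = ε / 2 := mul_one _
  calc ‖mk I x‖ * ‖mk I x‖ ≤ ‖x - x * (e : A)‖ * ‖x - x * (e : A)‖ := by gcongr
    _ = ‖(1 - E) * Z * (1 - E) - ((1 - E) * (Z - star X * X)) * (1 - E)‖ := by
        rw [h2, h3, h4]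
    _ ≤ ‖(1 - E) * Z * (1 - E)‖ + ‖((1 - E) * (Z - star X * X)) * (1 - E)‖ := norm_sub_le _ _
    _ ≤ ‖z‖ + ε / 2 := add_le_add h6 h7
    _ ≤ ‖mk I (star x * x)‖ + ε := by linarith

instance instNonUnitalRing : NonUnitalRing I.Quotient :=
  { (inferInstance : AddCommGroup I.Quotient), instMul I with
    left_distrib := by
      intro a b c
      obtain ⟨a, rfl⟩ := mk_surjective I a
      obtain ⟨b, rfl⟩ := mk_surjective I b
      obtain ⟨c, rfl⟩ := mk_surjective I c
      simp only [← mk_mul, ← map_add, mul_add]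
    right_distrib := by
      intro a b c
      obtain ⟨a, rfl⟩ := mk_surjective I a
      obtain ⟨b, rfl⟩ := mk_surjective I b
      obtain ⟨c, rfl⟩ := mk_surjective I c
      simp only [← mk_mul, ← map_add, add_mul]
    zero_mul := by
      intro a
      obtain ⟨a, rfl⟩ := mk_surjective I a
      rw [← map_zero (mk I), ← mk_mul, zero_mul]
    mul_zero := by
      intro a
      obtain ⟨a, rfl⟩ := mk_surjective I a
      rw [← map_zero (mk I), ← mk_mul, mul_zero]
    mul_assoc := by
      intro a b c
      obtain ⟨a, rfl⟩ := mk_surjective I a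
      obtain ⟨b, rfl⟩ := mk_surjective I b
      obtain ⟨c, rfl⟩ := mk_surjective I c
      simp only [← mk_mul, mul_assoc] }

theorem norm_mul_le' (p q : I.Quotient) : ‖p * q‖ ≤ ‖p‖ * ‖q‖ := by
  have key : ∀ ε : ℝ, 0 < ε → ‖p * q‖ ≤ (‖p‖ + ε) * (‖q‖ + ε) := by
    intro ε hε
    obtain ⟨x, rfl, hx⟩ := exists_rep I p hε
    obtain ⟨y, rfl, hy⟩ := exists_rep I q hε
    rw [← mk_mul]
    calc ‖mk I (x * y)‖ ≤ ‖x * y‖ := norm_mk_le I _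
      _ ≤ ‖x‖ * ‖y‖ := norm_mul_le _ _
      _ ≤ _ := by gcongr
  have hc : Tendsto (fun ε : ℝ => (‖p‖ + ε) * (‖q‖ + ε)) (𝓝[>] 0)
      (𝓝 ((‖p‖ + 0) * (‖q‖ + 0))) :=
    (Continuous.tendsto (by fun_prop) 0).mono_left nhdsWithin_le_nhds
  simp only [add_zero] at hc
  exact ge_of_tendsto hc (by filter_upwards [self_mem_nhdsWithin] with ε hε using key ε hε)

instance instNonUnitalNormedRing : NonUnitalNormedRing I.Quotient :=
  { instNACG I, instNonUnitalRing I with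
    norm_mul_le := norm_mul_le' I }

instance instStarRing : StarRing I.Quotient where
  star_involutive := by
    intro a
    obtain ⟨a, rfl⟩ := mk_surjective I a
    simp only [← mk_star, star_star]
  star_mul := by
    intro a b
    obtain ⟨a, rfl⟩ := mk_surjective I a
    obtain ⟨b, rfl⟩ := mk_surjective I b
    simp only [← mk_star, ← mk_mul, star_mul]
  star_add := by
    intro a b
    obtain ⟨a, rfl⟩ := mk_surjective I a
    obtain ⟨b, rfl⟩ := mk_surjective I b
    simp only [← mk_star, ← map_add, star_add]

instance instNonUnitalCStarAlgebra : NonUnitalCStarAlgebra I.Quotient where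
  norm_mul_self_le := norm_sq_le I
  smul_assoc c a b := by
    obtain ⟨a, rfl⟩ := mk_surjective I a
    obtain ⟨b, rfl⟩ := mk_surjective I b
    simp only [smul_eq_mul, ← mk_mul, ← map_smul, smul_mul_assoc]
  smul_comm c a b := by
    obtain ⟨a, rfl⟩ := mk_surjective I a
    obtain ⟨b, rfl⟩ := mk_surjective I b
    simp only [smul_eq_mul, ← mk_mul, ← map_smul, mul_smul_comm]
  star_smul c a := by
    obtain ⟨a, rfl⟩ := mk_surjective I a
    simp only [← mk_star, ← map_smul, star_smul]

end Quotient
end ClosedStarIdeal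
end CStarQuotient

section StabilizationSection

variable (A : Type u) [NonUnitalCStarAlgebra A]

attribute [local instance] CStarAlgebra.spectralOrder CStarAlgebra.spectralOrderedRing

/-- Infinite matrices over `A` with finitely many nonzero entries: the increasing union of the
matrix algebras `M_n(A)` along the upper left corner embeddings. -/
def FinMat : Type u :=
  {f : ℕ → ℕ → A // ∃ n, ∀ i j, n ≤ i ∨ n ≤ j → f i j = 0}

namespace FinMat

variable {A}

/-- The upper left `n × n` corner. -/
def corner (n : ℕ) (f : FinMat A) : CStarMatrix (Fin n) (Fin n) A :=
  CStarMatrix.ofMatrix fun i j => f.1 i j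

/-- All nonzero entries lie in the upper left `n × n` corner. -/
def Supp (n : ℕ) (f : FinMat A) : Prop := ∀ i j, n ≤ i ∨ n ≤ j → f.1 i j = 0

theorem eventually_supp (f : FinMat A) : ∀ᶠ n in atTop, f.Supp n := by
  obtain ⟨n, hn⟩ := f.2
  filter_upwards [eventually_ge_atTop n] with m hm i j hij
  exact hn i j (hij.imp hm.trans hm.trans)

theorem ext_entries {f g : FinMat A} (h : ∀ i j, f.1 i j = g.1 i j) : f = g :=
  Subtype.ext (funext fun i => funext fun j => h i j)

theorem ext_corner {f g : FinMat A} (h : ∀ᶠ n in atTop, f.corner n = g.corner n) : f = g := by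
  refine ext_entries fun i j => ?_
  obtain ⟨n, hn, hi, hj⟩ := (h.and ((eventually_gt_atTop i).and (eventually_gt_atTop j))).exists
  exact congrFun (congrFun hn ⟨i, hi⟩) ⟨j, hj⟩

instance : Zero (FinMat A) := ⟨⟨fun _ _ => 0, 0, fun _ _ _ => rfl⟩⟩

instance : Add (FinMat A) := ⟨fun f g => ⟨fun i j => f.1 i j + g.1 i j, by
  obtain ⟨n, hf, hg⟩ := (f.eventually_supp.and g.eventually_supp).exists
  exact ⟨n, fun i j h => by simp [hf i j h, hg i j h]⟩⟩⟩

instance : Neg (FinMat A) := ⟨fun f => ⟨fun i j => -f.1 i j, by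
  obtain ⟨n, hf⟩ := f.eventually_supp.exists
  exact ⟨n, fun i j h => by simp [hf i j h]⟩⟩⟩

instance : SMul ℂ (FinMat A) := ⟨fun c f => ⟨fun i j => c • f.1 i j, by
  obtain ⟨n, hf⟩ := f.eventually_supp.exists
  exact ⟨n, fun i j h => by simp [hf i j h]⟩⟩⟩

instance : Star (FinMat A) := ⟨fun f => ⟨fun i j => star (f.1 j i), by
  obtain ⟨n, hf⟩ := f.eventually_supp.exists
  exact ⟨n, fun i j h => by simp [hf j i h.symm]⟩⟩⟩

/-- The matrix product; each sum has finitely many nonzero terms. -/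
instance : Mul (FinMat A) := ⟨fun f g => ⟨fun i j => ∑ᶠ k, f.1 i k * g.1 k j, by
  obtain ⟨n, hf, hg⟩ := (f.eventually_supp.and g.eventually_supp).exists
  refine ⟨n, fun i j h => finsum_eq_zero_of_forall_eq_zero fun k => ?_⟩
  rcases h with h | h
  · simp [hf i k (Or.inl h)]
  · simp [hg k j (Or.inr h)]⟩⟩

theorem corner_zero (n : ℕ) : corner n (0 : FinMat A) = 0 := rfl

theorem corner_add (n : ℕ) (f g : FinMat A) : corner n (f + g) = corner n f + corner n g := rfl

theorem corner_neg (n : ℕ) (f : FinMat A) : corner n (-f) = -corner n f := rfl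

theorem corner_smul (n : ℕ) (c : ℂ) (f : FinMat A) : corner n (c • f) = c • corner n f := rfl

theorem corner_star (n : ℕ) (f : FinMat A) : corner n (star f) = star (corner n f) := rfl

theorem corner_mul {n : ℕ} {f : FinMat A} (hf : f.Supp n) (g : FinMat A) :
    corner n (f * g) = corner n f * corner n g := by
  ext i j
  rw [CStarMatrix.mul_apply]
  change (∑ᶠ k, f.1 i k * g.1 k j) = ∑ k : Fin n, f.1 i k * g.1 k j
  rw [finsum_eq_sum_of_support_subset (s := Finset.range n), Finset.sum_range]
  intro k hk
  simp only [Finset.coe_range, Set.mem_Iio]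
  by_contra hlt
  exact hk (by simp [hf i k (Or.inr (not_lt.1 hlt))])

instance : AddCommGroup (FinMat A) where
  add_assoc _ _ _ := ext_entries fun _ _ => add_assoc _ _ _
  zero_add _ := ext_entries fun _ _ => zero_add _
  add_zero _ := ext_entries fun _ _ => add_zero _
  add_comm _ _ := ext_entries fun _ _ => add_comm _ _
  neg_add_cancel _ := ext_entries fun _ _ => neg_add_cancel _
  nsmul := nsmulRec
  zsmul := zsmulRec

instance : Module ℂ (FinMat A) where
  one_smul _ := ext_entries fun _ _ => one_smul _ _
  mul_smul _ _ _ := ext_entries fun _ _ => mul_smul _ _ _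
  smul_zero _ := ext_entries fun _ _ => smul_zero _
  smul_add _ _ _ := ext_entries fun _ _ => smul_add _ _ _
  add_smul _ _ _ := ext_entries fun _ _ => add_smul _ _ _
  zero_smul _ := ext_entries fun _ _ => zero_smul _ _

theorem eventually_corner_mul (f g : FinMat A) :
    ∀ᶠ n in atTop, corner n (f * g) = corner n f * corner n g := by
  filter_upwards [f.eventually_supp] with n hn using corner_mul hn g

instance : NonUnitalRing (FinMat A) where
  left_distrib f g h := ext_corner <| by
    filter_upwards [f.eventually_supp] with n hf
    simp only [corner_mul hf, corner_add, mul_add]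
  right_distrib f g h := ext_corner <| by
    filter_upwards [f.eventually_supp, g.eventually_supp,
      (f + g).eventually_supp] with n hf hg hfg
    simp only [corner_mul hf, corner_mul hg, corner_mul hfg, corner_add, add_mul]
  zero_mul f := ext_corner <| by
    filter_upwards [eventually_corner_mul 0 f] with n h
    simp only [h, corner_zero, zero_mul]
  mul_zero f := ext_corner <| by
    filter_upwards [eventually_corner_mul f 0] with n h
    simp only [h, corner_zero, mul_zero]
  mul_assoc f g h := ext_corner <| by
    filter_upwards [f.eventually_supp, g.eventually_supp,
      (f * g).eventually_supp] with n hf hg hfg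
    simp only [corner_mul hf, corner_mul hg, corner_mul hfg, mul_assoc]

instance : StarRing (FinMat A) where
  star_involutive _ := ext_entries fun _ _ => star_star _
  star_add _ _ := ext_entries fun _ _ => star_add _ _
  star_mul f g := ext_corner <| by
    filter_upwards [eventually_corner_mul f g, eventually_corner_mul (star g) (star f)]
      with n h1 h2
    simp only [h1, h2, corner_star, star_mul]

instance : IsScalarTower ℂ (FinMat A) (FinMat A) where
  smul_assoc c f g := ext_corner <| by
    filter_upwards [eventually_corner_mul f g, eventually_corner_mul (c • f) g] with n h1 h2
    simp only [smul_eq_mul, h1, h2, corner_smul, smul_mul_assoc]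

instance : SMulCommClass ℂ (FinMat A) (FinMat A) where
  smul_comm c f g := ext_corner <| by
    filter_upwards [eventually_corner_mul f g, eventually_corner_mul f (c • g)] with n h1 h2
    simp only [smul_eq_mul, h1, h2, corner_smul, mul_smul_comm]

instance : StarModule ℂ (FinMat A) where
  star_smul _ _ := ext_entries fun _ _ => star_smul _ _

/-- Extend an `m × m` matrix by zero to an infinite matrix. -/
def ofCorner {m : ℕ} (M : CStarMatrix (Fin m) (Fin m) A) : FinMat A :=
  ⟨fun i j => if h : i < m ∧ j < m then M ⟨i, h.1⟩ ⟨j, h.2⟩ else 0, m, fun i j h =>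
    dif_neg (by omega)⟩

theorem supp_ofCorner {m : ℕ} (M : CStarMatrix (Fin m) (Fin m) A) : (ofCorner M).Supp m :=
  fun i j h => dif_neg (by omega)

theorem corner_ofCorner {m : ℕ} (M : CStarMatrix (Fin m) (Fin m) A) :
    corner m (ofCorner M) = M := by
  ext i j
  change (if h : (i : ℕ) < m ∧ (j : ℕ) < m then M ⟨i, h.1⟩ ⟨j, h.2⟩ else 0) = M i j
  rw [dif_pos ⟨i.2, j.2⟩]

theorem ofCorner_corner {m : ℕ} {f : FinMat A} (hf : f.Supp m) : ofCorner (corner m f) = f := by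
  refine ext_entries fun i j => ?_
  change (if h : i < m ∧ j < m then f.1 i j else 0) = f.1 i j
  split_ifs with h
  · rfl
  · exact (hf i j (by omega)).symm

theorem supp_mono {m n : ℕ} (h : m ≤ n) {f : FinMat A} (hf : f.Supp m) : f.Supp n :=
  fun i j hij => hf i j (hij.imp h.trans h.trans)

theorem ofCorner_mul {m : ℕ} (M N : CStarMatrix (Fin m) (Fin m) A) :
    ofCorner (M * N) = ofCorner M * ofCorner N := by
  have hs : (ofCorner M * ofCorner N).Supp m := by
    intro i j h
    refine finsum_eq_zero_of_forall_eq_zero fun k => ?_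
    rcases h with h | h
    · simp [supp_ofCorner M i k (Or.inl h)]
    · simp [supp_ofCorner N k j (Or.inr h)]
  rw [← ofCorner_corner hs, corner_mul (supp_ofCorner M), corner_ofCorner, corner_ofCorner]

/-- The upper left corner embedding `M_m(A) → M_n(A)`, for `m ≤ n`. -/
def pad {m n : ℕ} (h : m ≤ n) :
    CStarMatrix (Fin m) (Fin m) A →⋆ₙₐ[ℂ] CStarMatrix (Fin n) (Fin n) A where
  toFun M := corner n (ofCorner M)
  map_smul' c M := by
    rw [MonoidHom.id_apply, ← corner_smul]
    congr 1
    refine ext_entries fun i j => ?_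
    change (if h : i < m ∧ j < m then _ else _) = c • (if h : i < m ∧ j < m then _ else _)
    split_ifs <;> simp
  map_zero' := by
    change _ = corner n (0 : FinMat A)
    congr 1
    refine ext_entries fun i j => ?_
    change (if h : i < m ∧ j < m then _ else _) = (0 : A)
    split_ifs <;> simp
  map_add' M N := by
    rw [← corner_add]
    congr 1
    refine ext_entries fun i j => ?_
    change (if h : i < m ∧ j < m then _ else _) =
      (if h : i < m ∧ j < m then _ else _) + (if h : i < m ∧ j < m then _ else _)
    split_ifs <;> simp
  map_mul' M N := by
    rw [ofCorner_mul, corner_mul (supp_mono h (supp_ofCorner M))]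
  map_star' M := by
    rw [← corner_star]
    congr 1
    refine ext_entries fun i j => ?_
    change (if h : i < m ∧ j < m then _ else _) = star (if h : j < m ∧ i < m then _ else _)
    by_cases h : i < m ∧ j < m
    · rw [dif_pos h, dif_pos h.symm]; rfl
    · rw [dif_neg h, dif_neg (by omega), star_zero]

theorem pad_injective {m n : ℕ} (h : m ≤ n) : Function.Injective (pad (A := A) h) := by
  intro M N hMN
  have h1 : ofCorner M = ofCorner N := by
    rw [← ofCorner_corner (supp_mono h (supp_ofCorner M)),
      ← ofCorner_corner (supp_mono h (supp_ofCorner N))]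
    exact congrArg ofCorner hMN
  rw [← corner_ofCorner M, h1, corner_ofCorner]

theorem norm_corner_eq {m n : ℕ} (h : m ≤ n) {f : FinMat A} (hf : f.Supp m) :
    ‖corner n f‖ = ‖corner m f‖ := by
  have := NonUnitalStarAlgHom.norm_map (pad (A := A) h) (pad_injective h) (corner m f)
  rw [← this]
  change _ = ‖corner n (ofCorner (corner m f))‖
  rw [ofCorner_corner hf]

/-- The C*-norm of a finite matrix, computed in any sufficiently large matrix algebra. -/
instance : Norm (FinMat A) := ⟨fun f => ‖corner f.2.choose f‖⟩

theorem norm_eq {n : ℕ} {f : FinMat A} (hf : f.Supp n) : ‖f‖ = ‖corner n f‖ := by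
  have h0 : f.Supp f.2.choose := f.2.choose_spec
  change ‖corner f.2.choose f‖ = _
  rw [← norm_corner_eq (le_max_left _ n) h0, ← norm_corner_eq (le_max_right f.2.choose n) hf]

theorem eventually_norm_eq (f : FinMat A) : ∀ᶠ n in atTop, ‖f‖ = ‖corner n f‖ := by
  filter_upwards [f.eventually_supp] with n hn using norm_eq hn

theorem normCore : NormedSpace.Core ℂ (FinMat A) where
  norm_nonneg f := norm_nonneg (corner f.2.choose f)
  norm_smul c f := by
    obtain ⟨n, h1, h2⟩ := (f.eventually_norm_eq.and (c • f).eventually_norm_eq).exists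
    rw [h1, h2, corner_smul, norm_smul]
  norm_triangle f g := by
    obtain ⟨n, h1, h2, h3⟩ := (f.eventually_norm_eq.and
      (g.eventually_norm_eq.and (f + g).eventually_norm_eq)).exists
    rw [h1, h2, h3, corner_add]
    exact norm_add_le _ _
  norm_eq_zero_iff f := by
    constructor
    · intro h
      refine ext_corner ?_
      filter_upwards [f.eventually_norm_eq] with n hn
      rw [corner_zero, ← norm_eq_zero, ← hn, h]
    · rintro rfl
      obtain ⟨n, hn⟩ := (0 : FinMat A).eventually_norm_eq.exists
      rw [hn, corner_zero, norm_zero]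

instance instNACG : NormedAddCommGroup (FinMat A) := NormedAddCommGroup.ofCore normCore

instance instNormedSpace : NormedSpace ℂ (FinMat A) := NormedSpace.ofCore normCore

instance instNonUnitalNormedRing : NonUnitalNormedRing (FinMat A) :=
  { instNACG, (inferInstance : NonUnitalRing (FinMat A)) with
    norm_mul_le := fun f g => by
      obtain ⟨n, h1, h2, h3, h4⟩ := (f.eventually_norm_eq.and
        (g.eventually_norm_eq.and
          ((f * g).eventually_norm_eq.and (eventually_corner_mul f g)))).exists
      rw [h1, h2, h3, h4]
      exact norm_mul_le _ _ }

instance instCStarRing : CStarRing (FinMat A) where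
  norm_mul_self_le f := by
    obtain ⟨n, h1, h3, h4⟩ := (f.eventually_norm_eq.and
      ((star f * f).eventually_norm_eq.and (eventually_corner_mul (star f) f))).exists
    rw [h1, h3, h4, corner_star, CStarRing.norm_star_mul_self]

/-- The matrix with the single entry `a`, in the upper left position. -/
def single (a : A) : FinMat A :=
  ⟨fun i j => if i = 0 ∧ j = 0 then a else 0, 1, fun i j h => if_neg (by omega)⟩

end FinMat

open UniformSpace

/-- The C*-algebra `A ⊗ 𝕂`, as the completion of the finite matrices over `A`. -/
def Stabilization : Type u := Completion (FinMat A)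

namespace Stabilization

variable {A}

instance instNACG : NormedAddCommGroup (Stabilization A) :=
  inferInstanceAs (NormedAddCommGroup (Completion (FinMat A)))

instance instNormedSpace : NormedSpace ℂ (Stabilization A) :=
  inferInstanceAs (NormedSpace ℂ (Completion (FinMat A)))

instance instComplete : CompleteSpace (Stabilization A) :=
  inferInstanceAs (CompleteSpace (Completion (FinMat A)))

/-- The inclusion of the finite matrices. -/
def incl : FinMat A →ₗᵢ[ℂ] Stabilization A := Completion.toComplₗᵢ (𝕜 := ℂ) (E := FinMat A)

theorem denseRange_incl : DenseRange (incl (A := A)) := Completion.denseRange_coe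

theorem isDenseInducing_incl : IsDenseInducing (incl (A := A)) :=
  ⟨incl.isometry.isUniformInducing.isInducing, denseRange_incl⟩

/-- Multiplication is the continuous extension of the multiplication of finite matrices. -/
instance instMul : Mul (Stabilization A) :=
  ⟨fun x y => (isDenseInducing_incl.prodMap isDenseInducing_incl).extend
    (fun p : FinMat A × FinMat A => incl (p.1 * p.2)) (x, y)⟩

/-- The involution is the continuous extension of the involution of finite matrices. -/
instance instStar : Star (Stabilization A) :=
  ⟨isDenseInducing_incl.extend fun f : FinMat A => incl (star f)⟩

theorem incl_mul (f g : FinMat A) : incl (f * g) = incl f * incl g :=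
  ((isDenseInducing_incl.prodMap isDenseInducing_incl).extend_eq
    (incl.continuous.comp continuous_mul) (f, g)).symm

theorem incl_star (f : FinMat A) : incl (star f) = star (incl f) :=
  (isDenseInducing_incl.extend_eq (incl.continuous.comp continuous_star) f).symm

instance instContinuousMul : ContinuousMul (Stabilization A) where
  continuous_mul := by
    let m : FinMat A →+ FinMat A →+ Stabilization A :=
      (AddMonoidHom.mul : FinMat A →+ FinMat A →+ FinMat A).compr₂
        (incl (A := A)).toLinearMap.toAddMonoidHom
    have hm : Continuous fun p : FinMat A × FinMat A => m p.1 p.2 :=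
      incl.continuous.comp continuous_mul
    have di : IsDenseInducing ((incl (A := A)).toLinearMap.toAddMonoidHom) :=
      isDenseInducing_incl
    exact (di.extend_Z_bilin di hm :)

instance instContinuousStar : ContinuousStar (Stabilization A) where
  continuous_star := by
    have hu : UniformContinuous fun f : FinMat A => incl (star f) :=
      incl.isometry.uniformContinuous.comp
        (starₗᵢ ℂ (E := FinMat A)).isometry.uniformContinuous
    exact (uniformContinuous_uniformly_extend incl.isometry.isUniformInducing denseRange_incl
      hu).continuous

instance instNonUnitalRing : NonUnitalRing (Stabilization A) :=
  { (inferInstance : AddCommGroup (Stabilization A)), instMul with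
    left_distrib := fun a b c => by
      refine denseRange_incl.induction_on₃
        (p := fun a b c : Stabilization A => a * (b + c) = a * b + a * c)
        (isClosed_eq (by fun_prop) (by fun_prop)) (fun a b c => ?_) a b c
      simp only [← map_add, ← incl_mul, mul_add]
    right_distrib := fun a b c => by
      refine denseRange_incl.induction_on₃
        (p := fun a b c : Stabilization A => (a + b) * c = a * c + b * c)
        (isClosed_eq (by fun_prop) (by fun_prop)) (fun a b c => ?_) a b c
      simp only [← map_add, ← incl_mul, add_mul]
    zero_mul := fun a => by
      refine denseRange_incl.induction_on (p := fun a : Stabilization A => 0 * a = 0) a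
        (isClosed_eq (by fun_prop) (by fun_prop)) (fun a => ?_)
      rw [← map_zero incl, ← incl_mul, zero_mul]
    mul_zero := fun a => by
      refine denseRange_incl.induction_on (p := fun a : Stabilization A => a * 0 = 0) a
        (isClosed_eq (by fun_prop) (by fun_prop)) (fun a => ?_)
      rw [← map_zero incl, ← incl_mul, mul_zero]
    mul_assoc := fun a b c => by
      refine denseRange_incl.induction_on₃
        (p := fun a b c : Stabilization A => a * b * c = a * (b * c))
        (isClosed_eq (by fun_prop) (by fun_prop)) (fun a b c => ?_) a b c
      simp only [← incl_mul, mul_assoc] }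

instance instNonUnitalNormedRing : NonUnitalNormedRing (Stabilization A) :=
  { instNACG, instNonUnitalRing with
    norm_mul_le := fun a b => by
      refine denseRange_incl.induction_on₂
        (p := fun a b : Stabilization A => ‖a * b‖ ≤ ‖a‖ * ‖b‖)
        (isClosed_le (by fun_prop) (by fun_prop)) (fun a b => ?_) a b
      simp only [← incl_mul, LinearIsometry.norm_map]
      exact norm_mul_le _ _ }

instance instStarRing : StarRing (Stabilization A) where
  star_involutive a := by
    refine denseRange_incl.induction_on (p := fun a : Stabilization A => star (star a) = a) a
      (isClosed_eq (by fun_prop) (by fun_prop)) (fun a => ?_)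
    simp only [← incl_star, star_star]
  star_mul a b := by
    refine denseRange_incl.induction_on₂
      (p := fun a b : Stabilization A => star (a * b) = star b * star a)
      (isClosed_eq (by fun_prop) (by fun_prop)) (fun a b => ?_) a b
    simp only [← incl_star, ← incl_mul, star_mul]
  star_add a b := by
    refine denseRange_incl.induction_on₂
      (p := fun a b : Stabilization A => star (a + b) = star a + star b)
      (isClosed_eq (by fun_prop) (by fun_prop)) (fun a b => ?_) a b
    simp only [← incl_star, ← map_add, star_add]

instance instNonUnitalCStarAlgebra : NonUnitalCStarAlgebra (Stabilization A) where
  norm_mul_self_le a := by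
    refine denseRange_incl.induction_on
      (p := fun a : Stabilization A => ‖a‖ * ‖a‖ ≤ ‖star a * a‖) a
      (isClosed_le (by fun_prop) (by fun_prop)) (fun a => ?_)
    simp only [← incl_star, ← incl_mul, LinearIsometry.norm_map]
    exact CStarRing.norm_star_mul_self.ge
  smul_assoc c a b := by
    refine denseRange_incl.induction_on₂
      (p := fun a b : Stabilization A => (c • a) • b = c • a • b)
      (isClosed_eq ((continuous_fst.const_smul c).mul continuous_snd)
        ((continuous_fst.mul continuous_snd).const_smul c))
      (fun a b => ?_) a b
    simp only [smul_eq_mul, ← map_smul, ← incl_mul, smul_mul_assoc]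
  smul_comm c a b := by
    refine denseRange_incl.induction_on₂
      (p := fun a b : Stabilization A => c • a • b = a • c • b)
      (isClosed_eq ((continuous_fst.mul continuous_snd).const_smul c)
        (continuous_fst.mul (continuous_snd.const_smul c)))
      (fun a b => ?_) a b
    simp only [smul_eq_mul, ← map_smul, ← incl_mul, mul_smul_comm]
  star_smul c a := by
    refine denseRange_incl.induction_on
      (p := fun a : Stabilization A => star (c • a) = star c • star a) a
      (isClosed_eq (continuous_star.comp (continuous_id.const_smul c))
        (continuous_star.const_smul (star c))) (fun a => ?_)
    simp only [← incl_star, ← map_smul, star_smul]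

/-- The embedding `a ↦ a ⊗ e₁₁` of `A` into `A ⊗ 𝕂`. -/
def e11 (a : A) : Stabilization A := incl (FinMat.single a)

end Stabilization
end StabilizationSection

section PedersenSection

variable (A : Type u) [NonUnitalCStarAlgebra A]

/-- Simplicity of a C*-algebra: no nontrivial closed two-sided ideals. -/
def IsSimpleCStar : Prop :=
  Nontrivial A ∧ ∀ I : Submodule ℂ A, IsTwoSided I → IsClosed (I : Set A) → I = ⊥ ∨ I = ⊤

variable {A} in
/-- `a ∈ A₊`. -/
def IsPos (a : A) : Prop := ∃ b : A, a = star b * b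

variable {A} in
/-- The involution carries a two-sided ideal to a two-sided ideal. -/
def starIdeal (I : Submodule ℂ A) : Submodule ℂ A where
  carrier := {x | star x ∈ I}
  add_mem' hx hy := by
    simp only [Set.mem_ofPred_eq, star_add]
    exact I.add_mem hx hy
  zero_mem' := by simp
  smul_mem' c x hx := by
    simp only [Set.mem_ofPred_eq, star_smul]
    exact I.smul_mem _ hx

variable {A} in
theorem dense_starIdeal {I : Submodule ℂ A} (h : Dense (I : Set A)) :
    Dense (starIdeal I : Set A) :=
  h.preimage (Homeomorph.mk (star_involutive.toPerm _) continuous_star continuous_star).isOpenMap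

variable {A} in
theorem isTwoSided_starIdeal {I : Submodule ℂ A} (h : IsTwoSided I) :
    IsTwoSided (starIdeal I) := by
  intro a x hx
  change star (a * x) ∈ I ∧ star (x * a) ∈ I
  rw [star_mul, star_mul]
  exact ⟨(h _ _ hx).2, (h _ _ hx).1⟩

/-- The Pedersen ideal: the smallest dense two-sided ideal (not necessarily closed). -/
def Ped : NonUnitalStarSubalgebra ℂ A where
  carrier := {x | ∀ I : Submodule ℂ A, IsTwoSided I → Dense (I : Set A) → x ∈ I}
  add_mem' hx hy I hI hd := I.add_mem (hx I hI hd) (hy I hI hd)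
  zero_mem' I _ _ := I.zero_mem
  mul_mem' {a _} _ hy I hI hd := (hI a _ (hy I hI hd)).1
  smul_mem' c _ hx I hI hd := I.smul_mem c (hx I hI hd)
  star_mem' hx I hI hd := hx (starIdeal I) (isTwoSided_starIdeal hI) (dense_starIdeal hd)

variable {A}

/-- `(a - ε)₊`, by functional calculus. -/
def cut (ε : ℝ) (a : A) : A := cfcₙ (fun t : ℝ => max (t - ε) 0) a

/-- The function that is `0` on `(-∞, ε]`, `1` on `[2ε, ∞)` and linear on `[ε, 2ε]`. -/
def fn (ε : ℝ) (t : ℝ) : ℝ := max 0 (min 1 ((t - ε) / ε))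

/-- The hereditary C*-subalgebra of `A` generated by a positive element `a`, that is, the closure
of `a A a`. -/
def Her (a : A) : Set A := closure (Set.range fun x : A => a * x * a)

/-- A dense ideal contains every element that has a local unit. -/
theorem mem_of_local_unit {I : Submodule ℂ A} (hI : IsTwoSided I) (hd : Dense (I : Set A))
    {g c : A} (hg : g * c = g) : g ∈ I := by
  obtain ⟨y, hy, hyc⟩ := Metric.dense_iff.1 hd c 1 one_pos
  have hu : IsUnit (1 - ((c - y : A) : Unitization ℂ A)) := by
    refine isUnit_one_sub_of_norm_lt_one ?_
    rw [Unitization.norm_inr, ← dist_eq_norm, dist_comm]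
    exact hy
  obtain ⟨v, hv⟩ := hu.exists_right_inv
  have h1 : ((g : A) : Unitization ℂ A) * (1 - ((c - y : A) : Unitization ℂ A))
      = ((g * y : A) : Unitization ℂ A) := by
    have h2 : g * (c - y) = g - g * y := by rw [mul_sub, hg]
    rw [mul_sub, mul_one, ← Unitization.inr_mul, h2, ← Unitization.inr_sub]
    congr 1
    abel
  have h3 : ((g : A) : Unitization ℂ A) = ((g * y : A) : Unitization ℂ A) * v := by
    rw [← h1, mul_assoc, hv, mul_one]
  have h4 : g = v.fst • (g * y) + (g * y) * v.snd := by
    have := congrArg (fun z : Unitization ℂ A => z.snd) h3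
    simpa using this
  rw [h4]
  have h5 : g * y ∈ I := (hI g y hyc).1
  exact I.add_mem (I.smul_mem _ h5) (hI _ _ h5).2

theorem cut_mem_ped {ε : ℝ} (hε : 0 < ε) (a : A) : cut ε a ∈ Ped A := by
  intro I hI hd
  refine mem_of_local_unit (c := cfcₙ (fun t : ℝ => max 0 (min 1 (t / ε))) a) hI hd ?_
  unfold cut
  rw [← cfcₙ_mul (fun t : ℝ => max (t - ε) 0) (fun t : ℝ => max 0 (min 1 (t / ε))) a
    (by fun_prop) (by simp [hε.le]) (by fun_prop) (by simp)]
  congr 1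
  funext t
  rcases le_total t ε with h | h
  · simp [max_eq_right (sub_nonpos.2 h)]
  · have : 1 ≤ t / ε := (one_le_div hε).2 h
    simp [min_eq_left this]

end PedersenSection

section QuasitraceSection

open scoped ComplexOrder ENNReal

/-- Quasitraces on a complex *-algebra. -/
structure IsQuasitrace {P : Type u} [NonUnitalRing P] [StarRing P] [Module ℂ P]
    (τ : P → ℂ) : Prop where
  nonneg : ∀ x : P, 0 ≤ τ (star x * x)
  trace : ∀ x : P, τ (star x * x) = τ (x * star x)
  linear : ∀ C : NonUnitalStarSubalgebra ℂ P, (∀ x ∈ C, ∀ y ∈ C, x * y = y * x) →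
    ∀ x ∈ C, ∀ y ∈ C, ∀ c : ℂ, τ (c • x + y) = c * τ x + τ y
  re_im : ∀ a b : P, IsSelfAdjoint a → IsSelfAdjoint b →
    τ (a + Complex.I • b) = τ a + Complex.I * τ b

/-- A 2-quasitrace is a quasitrace `τ` that extends to a quasitrace on the `2 × 2` matrices. -/
def Is2Quasitrace {P : Type u} [NonUnitalRing P] [StarRing P] [Module ℂ P] (τ : P → ℂ) : Prop :=
  IsQuasitrace τ ∧ ∃ σ : Matrix (Fin 2) (Fin 2) P → ℂ, IsQuasitrace σ ∧
    ∀ a : P, σ !![a, 0; 0, 0] = τ a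

variable (A : Type u) [NonUnitalCStarAlgebra A]

/-- The densely defined 2-quasitraces on `A ⊗ 𝕂`, with the topology of pointwise convergence on
the Pedersen ideal of `A ⊗ 𝕂`. -/
abbrev QTilde : Type u := {τ : Ped (Stabilization A) → ℂ // Is2Quasitrace τ}

variable {A}

open Classical in
/-- The value `τ(a)` in `[0, ∞]` for positive `a` in `A ⊗ 𝕂`: outside the Pedersen ideal it is
`lim τ((a - ε)₊)` as `ε` decreases to `0`, an increasing limit. -/
def QTilde.val (τ : QTilde A) (a : Stabilization A) : ℝ≥0∞ :=
  if h : a ∈ Ped (Stabilization A) then ENNReal.ofReal (τ.1 ⟨a, h⟩).re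
  else ⨆ ε : Set.Ioi (0 : ℝ), ENNReal.ofReal (τ.1 ⟨cut (ε : ℝ) a, cut_mem_ped ε.2 a⟩).re

/-- `‖τ|_A‖`, the supremum of `τ(a ⊗ e₁₁)` over the positive `a` in the unit ball of `Ped(A)`. -/
def QTilde.normOn (τ : QTilde A) : ℝ≥0∞ :=
  ⨆ a ∈ {a : A | a ∈ Ped A ∧ IsPos a ∧ ‖a‖ ≤ 1}, τ.val (Stabilization.e11 a)

variable (A) in
/-- `QT(A)`. -/
def QT : Set (QTilde A) := {τ | τ.normOn = 1}

/-- `‖x‖₂`, the supremum of `τ(x* x)^{1/2}` over the closure of `QT(A)`. -/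
def norm2 (x : Stabilization A) : ℝ≥0∞ :=
  ⨆ τ ∈ closure (QT A), (τ.val (star x * x)) ^ (1 / 2 : ℝ)

/-- `d_τ(a)`, the increasing limit of `τ(f_{1/n}(a))`. -/
def dimFun (τ : QTilde A) (a : Stabilization A) : ℝ≥0∞ :=
  ⨆ n : ℕ, τ.val (cfcₙ (fn (1 / (n + 1))) a)

/-- The tracial oscillation `ω(a)` of a positive element, a decreasing limit over `n`. Each
`f_{1/n}(a)` is in the Pedersen ideal, so that the subtracted value is finite. -/
def tracialOsc (a : Stabilization A) : ℝ≥0∞ :=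
  ⨅ n : ℕ, ⨆ τ ∈ closure (QT A), dimFun τ a - τ.val (cfcₙ (fn (1 / (n + 1))) a)

/-- Tracial approximate oscillation zero, for a positive element of `Ped(A ⊗ 𝕂)`. -/
def HasTAOZ (a : Stabilization A) : Prop :=
  ∀ ε : ℝ, 0 < ε → ∃ c ∈ Her a, IsPos c ∧ norm2 (a - c) < ENNReal.ofReal ε ∧ ‖c‖ ≤ ‖a‖ ∧
    tracialOsc c < ENNReal.ofReal ε

variable (A) in
/-- The C*-algebra of bounded sequences in `A`. -/
abbrev LInfty : Type u := lp (fun _ : ℕ => A) ∞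

variable (A) in
/-- The set `J_A` of all bounded sequences with `‖x_n‖₂ → 0`. -/
def JSet : Set (LInfty A) :=
  {x | Tendsto (fun n : ℕ => norm2 (Stabilization.e11 (x n))) atTop (𝓝 0)}

variable (A) in
/-- The quotient C*-algebra `l^∞(A) / J_A`. The set `J_A` is a closed self-adjoint two-sided ideal,
hence equal to the closed ideal that it generates; the quotient is taken by the latter. -/
abbrev LInftyModJ : Type u := (ClosedStarIdeal.span (JSet A)).Quotient

/-- Real rank zero: in the unitization, the invertible self-adjoint elements are dense in the
self-adjoint elements. -/
def RealRankZero (B : Type u) [NonUnitalCStarAlgebra B] : Prop :=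
  ∀ x : Unitization ℂ B, IsSelfAdjoint x →
    x ∈ closure {y : Unitization ℂ B | IsSelfAdjoint y ∧ IsUnit y}

end QuasitraceSection

end

/-!
Write `B = A ⊗ 𝕂`. Everything rests on elementary properties of 2-quasitraces, which are only
additive on commuting elements. They are monotone on `B₊` (`IsQuasitrace.extVal_mono`): if
`a ≤ b + δ`, then a polar decomposition argument moves the part of `a` above a level `t > δ` below a
local unit of `b` (`IsQuasitrace.extVal_level_le`), and slicing `a` and `b` into layers gives the
comparison of `(a - δ - 3 ε)₊` with `(b - ε)₊`. Membership of square roots in the Pedersen ideal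
(`sqrt_mem_ped`) makes this work on the Pedersen ideal. Since any two positive elements of `B` are
equivalent to orthogonal ones, quasitraces are subadditive up to a factor `2`
(`QTilde.val_add_le`). Hence `‖·‖₂` is a quasi-norm that is finite on the Pedersen ideal,
*-invariant, and compatible with multiplication by bounded elements.

(i) ⇒ (ii) is the inclusion of the Pedersen ideal of `A` into that of `B` (`e11_mem_ped`).

(ii) ⇒ (iii) (`realRankZero_of_hasTAOZ`). For a self-adjoint bounded sequence `x` and `t ≥ 0`, the
elements `(x_n - t)₊` are approximated in trace norm by elements `c_n` of small oscillation. A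
spectral ramp `p_n` of `c_n` is then nearly a projection and nearly a unit for `c_n`
(`exists_fn_almost_projection`), so that `p = (p_n)` is modulo `J_A` a projection with
`p (x - t) = (x - t)₊`. Then `x - t + δ (2 p - 1)` is self-adjoint and invertible for all `δ > 0`,
because its product with the symmetry `2 p - 1` is `|x - t| + δ`.

(iii) ⇒ (i) (`hasTAOZ_of_realRankZero`). Schur complements extend the perturbation property of real
rank zero to matrices, with diagonal perturbations (`exists_diagonal_isUnit`). Hence a positive
matrix over `l^∞(A)/J_A` has a projection on which it is bounded below and away from which it is
small (`RealRankZero.exists_matrix_projection`). These matrices map to `l^∞(B)/N`, where `N` is the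
ideal of sequences that are null in trace norm after multiplication with elements of the Pedersen
ideal (`nullIdeal`). For `a` in `Ped(B)₊` this yields a projection `p` in `l^∞(B)/N` adapted to
`√a`, and `z = √a p √a` has a spectral gap `(0, κ²)` (`eq_zero_or_le_of_mem_quasispectrum`). On
representatives `z_k`, the distance `‖a - z_k‖₂` is small, and the mass of `z_k` in the spectral band
of the gap tends to `0` (`exists_compression`). This mass bounds the oscillation of `(z_k - s)₊`
for a level `s` in the gap (`tracialOsc_cut_le`), and `(z_k - s)₊` is in `Her(a)`.
-/

open scoped ComplexOrder ENNReal

/-! ### Functional calculus and factorization in C*-algebras -/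

section CStarTools

variable {B : Type*} [NonUnitalCStarAlgebra B]

/-- The functional calculi of `x* x` and `x x*` are intertwined by `x`. -/
theorem mul_cfcₙ_star_mul_self (x : B) (f : ℝ → ℝ) (hf : Continuous f) (hf0 : f 0 = 0) :
    x * cfcₙ f (star x * x) = cfcₙ f (x * star x) * x := by
  have ha : IsSelfAdjoint (star x * x) := .star_mul_self x
  have hb : IsSelfAdjoint (x * star x) := .mul_star_self x
  have hs : quasispectrum ℝ (x * star x) ⊆ quasispectrum ℝ (star x * x) :=
    (quasispectrum.mul_comm x (star x)).le
  have key : ∀ g : ContinuousMapZero (quasispectrum ℝ (star x * x)) ℝ,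
      x * cfcₙHom ha g = cfcₙHomSuperset hb hs g * x := by
    intro g
    induction g using ContinuousMapZero.induction_on_of_compact with
    | zero => rw [map_zero, map_zero, mul_zero, zero_mul]
    | smul r f hf => rw [map_smul, map_smul, mul_smul_comm, smul_mul_assoc, hf]
    | id => rw [cfcₙHom_id ha, cfcₙHomSuperset_id, mul_assoc]
    | star_id => rw [map_star, map_star, cfcₙHom_id ha, cfcₙHomSuperset_id, ha.star_eq,
        hb.star_eq, mul_assoc]
    | add f g hf hg => rw [map_add, map_add, mul_add, add_mul, hf, hg]
    | mul f g hf hg => rw [map_mul, map_mul, ← mul_assoc, hf, mul_assoc, hg, mul_assoc]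
    | frequently f hf =>
      have hc1 := cfcₙHom_continuous (R := ℝ) ha
      have hc2 := cfcₙHomSuperset_continuous (R := ℝ) hb hs
      have hcl : IsClosed {g | x * cfcₙHom ha g = cfcₙHomSuperset hb hs g * x} :=
        isClosed_eq (by fun_prop) (by fun_prop)
      have := mem_closure_of_frequently_of_tendsto
        (s := {g | x * cfcₙHom ha g = cfcₙHomSuperset hb hs g * x}) hf tendsto_id
      rwa [hcl.closure_eq] at this
  have := key ⟨⟨_, hf.continuousOn.domRestrict⟩, hf0⟩
  rw [cfcₙ_apply f _ hf.continuousOn hf0 ha, cfcₙ_apply f _ hf.continuousOn hf0 hb, this]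
  rfl

theorem quasispectrum_le_norm {h : B} (hh : IsSelfAdjoint h) {t : ℝ}
    (ht : t ∈ quasispectrum ℝ h) : |t| ≤ ‖h‖ := by
  have := norm_apply_le_norm_cfcₙ (fun t : ℝ => t) h ht
  rwa [cfcₙ_id' ℝ h] at this

variable [PartialOrder B] [StarOrderedRing B]

theorem quasispectrum_nonneg' {h : B} (hh : 0 ≤ h) {t : ℝ} (ht : t ∈ quasispectrum ℝ h) : 0 ≤ t :=
  quasispectrum_nonneg_of_nonneg h hh t ht

theorem isPos_iff_nonneg {a : B} : IsPos a ↔ 0 ≤ a :=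
  CStarAlgebra.nonneg_iff_eq_star_mul_self.symm

/-- A variant of the conjugation inequality for `1 - f(h)` in place of `f(h)`. -/
theorem sub_conj_le {z h g : B} (hz : star z * z ≤ h) (hg : IsSelfAdjoint g) :
    star (z * g - z) * (z * g - z) ≤ g * h * g - g * h - h * g + h := by
  have h0 : 0 ≤ ((h - star z * z : B) : Unitization ℂ B) :=
    Unitization.inr_nonneg_iff.2 (sub_nonneg.2 hz)
  have h1 := star_left_conjugate_nonneg h0 ((g : Unitization ℂ B) - 1)
  rw [← sub_nonneg, ← Unitization.inr_nonneg_iff]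
  convert h1 using 1
  simp only [star_sub, star_mul, star_one, ← Unitization.inr_star, hg.star_eq, mul_sub, sub_mul,
    Unitization.inr_sub, Unitization.inr_add, Unitization.inr_mul, mul_assoc, one_mul, mul_one]
  abel

/-- `‖z f(h)‖ ≤ C` if `z* z ≤ h` and `t f(t)² ≤ C²`. -/
theorem norm_mul_cfcₙ_le {z h : B} (hh : 0 ≤ h) (hz : star z * z ≤ h) {f : ℝ → ℝ}
    (hf : Continuous f) (hf0 : f 0 = 0) {C : ℝ} (hC : 0 ≤ C)
    (hfC : ∀ t, 0 ≤ t → t ≤ ‖h‖ → t * f t ^ 2 ≤ C ^ 2) : ‖z * cfcₙ f h‖ ≤ C := by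
  have hs : IsSelfAdjoint (cfcₙ f h) := cfcₙ_predicate f h
  have h1 : star (z * cfcₙ f h) * (z * cfcₙ f h) ≤ cfcₙ (fun t => t * f t ^ 2) h := by
    have h2 := star_left_conjugate_le_conjugate hz (cfcₙ f h)
    have h3 : cfcₙ (fun t => t * f t ^ 2) h = star (cfcₙ f h) * h * cfcₙ f h := by
      rw [hs.star_eq]
      have h6 : cfcₙ (fun t : ℝ => t) h = h := cfcₙ_id' ℝ h (ha := .of_nonneg hh)
      have h7 : cfcₙ (fun t => t * f t ^ 2) h = cfcₙ (fun t => f t * t * f t) h := by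
        congr 1; funext t; ring
      rw [h7, cfcₙ_mul (fun t => f t * t) f h, cfcₙ_mul f (fun t => t) h, h6]
    rw [h3]
    simpa only [star_mul, mul_assoc] using h2
  have h4 : ‖cfcₙ (fun t => t * f t ^ 2) h‖ ≤ C ^ 2 := by
    refine norm_cfcₙ_le fun t ht => ?_
    have h0 := quasispectrum_nonneg' hh ht
    rw [Real.norm_of_nonneg (by positivity)]
    exact hfC t h0 ((le_abs_self _).trans (quasispectrum_le_norm (.of_nonneg hh) ht))
  have h5 := CStarAlgebra.norm_le_norm_of_nonneg_of_le (star_mul_self_nonneg _) h1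
  rw [CStarRing.norm_star_mul_self] at h5
  nlinarith [norm_nonneg (z * cfcₙ f h)]

/-- `‖z f(h) - z‖ ≤ C` if `z* z ≤ h` and `t (f(t) - 1)² ≤ C²`. -/
theorem norm_mul_cfcₙ_sub_le {z h : B} (hh : 0 ≤ h) (hz : star z * z ≤ h) {f : ℝ → ℝ}
    (hf : Continuous f) (hf0 : f 0 = 0) {C : ℝ} (hC : 0 ≤ C)
    (hfC : ∀ t, 0 ≤ t → t ≤ ‖h‖ → t * (f t - 1) ^ 2 ≤ C ^ 2) : ‖z * cfcₙ f h - z‖ ≤ C := by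
  have hs : IsSelfAdjoint (cfcₙ f h) := cfcₙ_predicate f h
  have h1 : star (z * cfcₙ f h - z) * (z * cfcₙ f h - z)
      ≤ cfcₙ (fun t => t * (f t - 1) ^ 2) h := by
    have h2 := sub_conj_le hz hs
    have h3 : cfcₙ (fun t => t * (f t - 1) ^ 2) h
        = cfcₙ f h * h * cfcₙ f h - cfcₙ f h * h - h * cfcₙ f h + h := by
      have h6 : cfcₙ (fun t : ℝ => t) h = h := cfcₙ_id' ℝ h (ha := .of_nonneg hh)
      have h7 : cfcₙ (fun t => t * (f t - 1) ^ 2) h =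
          cfcₙ (fun t => f t * t * f t - f t * t - t * f t + t) h := by
        congr 1; funext t; ring
      rw [h7, cfcₙ_add (fun t => f t * t * f t - f t * t - t * f t) (fun t => t) h,
        cfcₙ_sub (fun t => f t * t * f t - f t * t) (fun t => t * f t) h,
        cfcₙ_sub (fun t => f t * t * f t) (fun t => f t * t) h,
        cfcₙ_mul (fun t => f t * t) f h, cfcₙ_mul f (fun t => t) h, cfcₙ_mul (fun t => t) f h, h6]
    rwa [h3]
  have h4 : ‖cfcₙ (fun t => t * (f t - 1) ^ 2) h‖ ≤ C ^ 2 := by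
    refine norm_cfcₙ_le fun t ht => ?_
    have h0 := quasispectrum_nonneg' hh ht
    rw [Real.norm_of_nonneg (by positivity)]
    exact hfC t h0 ((le_abs_self _).trans (quasispectrum_le_norm (.of_nonneg hh) ht))
  have h5 := CStarAlgebra.norm_le_norm_of_nonneg_of_le (star_mul_self_nonneg _) h1
  rw [CStarRing.norm_star_mul_self] at h5
  nlinarith [norm_nonneg (z * cfcₙ f h - z)]

/-- A bounded substitute for `t ↦ t ^ (-α)`: it agrees with it on `[δ, ∞)` and is continuous. -/
noncomputable def cutInvPow (α δ t : ℝ) : ℝ := t ^ α / max t δ ^ (2 * α)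

section cutInvPow

variable {α δ : ℝ}

theorem continuous_cutInvPow (hα : 0 < α) (hδ : 0 < δ) : Continuous (cutInvPow α δ) := by
  unfold cutInvPow
  refine Continuous.div ?_ ?_ fun t => ?_
  · exact continuous_id.rpow_const fun _ => Or.inr hα.le
  · exact (continuous_id.max continuous_const).rpow_const fun _ => Or.inr (by positivity)
  · have : 0 < max t δ := lt_max_of_lt_right hδ
    positivity

theorem cutInvPow_zero (hα : 0 < α) : cutInvPow α δ 0 = 0 := by
  simp [cutInvPow, Real.zero_rpow hα.ne']

theorem cutInvPow_mul (hα : 0 < α) (hδ : 0 < δ) {t : ℝ} (ht : 0 ≤ t) :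
    cutInvPow α δ t * t ^ α ∈ Set.Icc (0 : ℝ) 1 ∧ (δ ≤ t → cutInvPow α δ t * t ^ α = 1) := by
  have hm : 0 < max t δ := lt_max_of_lt_right hδ
  have h1 : cutInvPow α δ t * t ^ α = (t / max t δ) ^ (2 * α) := by
    rw [Real.div_rpow ht hm.le, cutInvPow, div_mul_eq_mul_div, two_mul, ← Real.rpow_add' ht]
    positivity
  rw [h1]
  refine ⟨⟨by positivity, ?_⟩, fun h => ?_⟩
  · exact Real.rpow_le_one (by positivity) ((div_le_one hm).2 (le_max_left _ _)) (by positivity)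
  · rw [max_eq_left h, div_self (by linarith), Real.one_rpow]

theorem rpow_one_sub_mul (hα : 0 < α) {t : ℝ} (ht : 0 ≤ t) : t = t ^ (1 - 2 * α) * (t ^ α) ^ 2 := by
  rw [← Real.rpow_natCast, ← Real.rpow_mul ht]
  rcases ht.eq_or_lt with rfl | h
  · rw [Real.zero_rpow (x := α * (2 : ℕ)) (by positivity), mul_zero]
  · rw [← Real.rpow_add h]
    norm_num [mul_comm]

theorem cutInvPow_sub_sq_le (hα : 0 < α) (hα' : α < 1 / 2) {δ' m : ℝ} (hδ : 0 < δ) (hδ' : 0 < δ')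
    (h1 : δ ≤ m) (h2 : δ' ≤ m) {t : ℝ} (ht : 0 ≤ t) :
    t * (cutInvPow α δ t - cutInvPow α δ' t) ^ 2 ≤ m ^ (1 - 2 * α) := by
  obtain ⟨⟨a1, a2⟩, a3⟩ := cutInvPow_mul hα hδ ht
  obtain ⟨⟨b1, b2⟩, b3⟩ := cutInvPow_mul hα hδ' ht
  have e : t * (cutInvPow α δ t - cutInvPow α δ' t) ^ 2 = t ^ (1 - 2 * α) *
      (cutInvPow α δ t * t ^ α - cutInvPow α δ' t * t ^ α) ^ 2 := by
    nth_rewrite 1 [rpow_one_sub_mul hα ht]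
    ring
  have hm : 0 ≤ m := hδ.le.trans h1
  rw [e]
  rcases le_total m t with h | h
  · rw [a3 (h1.trans h), b3 (h2.trans h)]
    simp only [sub_self, ne_eq, OfNat.ofNat_ne_zero, not_false_eq_true, zero_pow, mul_zero]
    positivity
  · calc _ ≤ t ^ (1 - 2 * α) * 1 := by
          gcongr
          nlinarith
      _ ≤ _ := by
          rw [mul_one]
          exact Real.rpow_le_rpow ht h (by linarith)

theorem cutInvPow_mul_sub_one_sq_le (hα : 0 < α) (hδ : 0 < δ) {t : ℝ} (ht : 0 ≤ t) :
    t * (cutInvPow α δ t * t ^ α - 1) ^ 2 ≤ δ := by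
  obtain ⟨⟨a1, a2⟩, a3⟩ := cutInvPow_mul hα hδ ht
  rcases le_total δ t with h | h
  · rw [a3 h]; simpa using hδ.le
  · have : (cutInvPow α δ t * t ^ α - 1) ^ 2 ≤ 1 := by nlinarith
    nlinarith

theorem abs_cutInvPow_sq_sub_le (hα : 0 < α) (hα' : α < 1 / 2) (hδ : 0 < δ) {t : ℝ} (ht : 0 ≤ t) :
    |cutInvPow α δ t * t * cutInvPow α δ t - t ^ (1 - 2 * α)| ≤ δ ^ (1 - 2 * α) := by
  obtain ⟨⟨a1, a2⟩, a3⟩ := cutInvPow_mul hα hδ ht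
  have e : cutInvPow α δ t * t * cutInvPow α δ t - t ^ (1 - 2 * α) = t ^ (1 - 2 * α) *
      ((cutInvPow α δ t * t ^ α) ^ 2 - 1) := by
    nth_rewrite 2 [rpow_one_sub_mul hα ht]
    ring
  have h0 : 0 ≤ t ^ (1 - 2 * α) := by positivity
  rw [e, abs_mul, abs_of_nonneg h0]
  rcases le_total δ t with h | h
  · rw [a3 h]
    simp only [one_pow, sub_self, abs_zero, mul_zero]
    positivity
  · calc _ ≤ t ^ (1 - 2 * α) * 1 := by
          gcongr
          rw [abs_le]
          constructor <;> nlinarith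
      _ ≤ _ := by
          rw [mul_one]
          exact Real.rpow_le_rpow ht h (by linarith)

end cutInvPow

/-- Simultaneous factorization through a fractional power: if `∑ wᵢ* wᵢ ≤ h`, then every `wᵢ` is
a left multiple `vᵢ h^α`, for `α < 1/2`. The factors inherit the left units of the `wᵢ`, and
`∑ vᵢ* vᵢ = h^(1-2α)` if `∑ wᵢ* wᵢ = h`. -/
theorem exists_factor_rpow {ι : Type*} [Fintype ι] (w : ι → B) {h : B}
    (hw : ∑ i, star (w i) * w i ≤ h) {α : ℝ} (hα : 0 < α) (hα' : α < 1 / 2) :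
    ∃ v : ι → B, (∀ i, w i = v i * cfcₙ (fun t : ℝ => t ^ α) h) ∧
      (∀ u i, u * w i = w i → u * v i = v i) ∧
      (∑ i, star (w i) * w i = h →
        ∑ i, star (v i) * v i = cfcₙ (fun t : ℝ => t ^ (1 - 2 * α)) h) := by
  have hh : 0 ≤ h := (Finset.sum_nonneg fun i _ => star_mul_self_nonneg (w i)).trans hw
  have hi : ∀ i, star (w i) * w i ≤ h := fun i =>
    (Finset.single_le_sum (f := fun i => star (w i) * w i)
      (fun i _ => star_mul_self_nonneg (w i)) (Finset.mem_univ i)).trans hw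
  let d : ℕ → ℝ := fun n => 1 / (n + 1)
  have hd : ∀ n, 0 < d n := fun n => by positivity
  have hd0 : Tendsto d atTop (𝓝 0) := tendsto_one_div_add_atTop_nhds_zero_nat
  have hk : ∀ n, Continuous (cutInvPow α (d n)) := fun n => continuous_cutInvPow hα (hd n)
  have hk0 : ∀ n, cutInvPow α (d n) 0 = 0 := fun n => cutInvPow_zero hα
  have hp : Continuous fun t : ℝ => t ^ α := continuous_id.rpow_const fun _ => Or.inr hα.le
  have hp0 : (0 : ℝ) ^ α = 0 := Real.zero_rpow hα.ne'
  have hq : Continuous fun t : ℝ => t ^ (1 - 2 * α) :=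
    continuous_id.rpow_const fun _ => Or.inr (by linarith)
  have hq0 : (0 : ℝ) ^ (1 - 2 * α) = 0 := Real.zero_rpow (by linarith)
  have hr : ∀ {β : ℝ}, 0 < β → Tendsto (fun n => d n ^ β) atTop (𝓝 0) := fun {β} hβ => by
    have := hd0.rpow_const (p := β) (Or.inr hβ.le)
    rwa [Real.zero_rpow hβ.ne'] at this
  have hanti : ∀ {m n : ℕ}, n ≤ m → d m ≤ d n := fun {m n} h =>
    one_div_le_one_div_of_le (by positivity) (by gcongr)
  have hcau : ∀ i, CauchySeq fun n => w i * cfcₙ (cutInvPow α (d n)) h := by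
    intro i
    refine cauchySeq_of_le_tendsto_0 (fun n => d n ^ (1 / 2 - α)) (fun m n N hm hn => ?_)
      (hr (by linarith))
    rw [dist_eq_norm, ← mul_sub, ← cfcₙ_sub _ _ _ (hk m).continuousOn (hk0 m)
      (hk n).continuousOn (hk0 n)]
    refine norm_mul_cfcₙ_le hh (hi i) ((hk m).sub (hk n)) (by simp [hk0])
      (Real.rpow_nonneg (hd N).le _) fun t ht _ => ?_
    refine (cutInvPow_sub_sq_le hα hα' (hd m) (hd n) (hanti hm) (hanti hn) ht).trans_eq ?_
    rw [← Real.rpow_natCast, ← Real.rpow_mul (hd N).le]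
    congr 1
    push_cast
    ring
  choose v hv using fun i => cauchySeq_tendsto_of_complete (hcau i)
  refine ⟨v, fun i => ?_, fun u i hu => ?_, fun he => ?_⟩
  · have h1 : Tendsto (fun n => w i * cfcₙ (cutInvPow α (d n)) h * cfcₙ (fun t : ℝ => t ^ α) h)
        atTop (𝓝 (v i * cfcₙ (fun t : ℝ => t ^ α) h)) := (hv i).mul_const _
    refine tendsto_nhds_unique ?_ h1
    rw [tendsto_iff_norm_sub_tendsto_zero]
    refine squeeze_zero (fun _ => norm_nonneg _) (fun n => ?_) (hr (β := 1 / 2) (by norm_num))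
    rw [mul_assoc, ← cfcₙ_mul _ _ _ (hk n).continuousOn (hk0 n) hp.continuousOn hp0]
    refine norm_mul_cfcₙ_sub_le hh (hi i) ((hk n).mul hp) (by simp [hk0])
      (Real.rpow_nonneg (hd n).le _) fun t ht _ => ?_
    refine (cutInvPow_mul_sub_one_sq_le hα (hd n) ht).trans_eq ?_
    rw [← Real.rpow_natCast, ← Real.rpow_mul (hd n).le]
    norm_num
  · have h1 := (hv i).const_mul u
    refine tendsto_nhds_unique h1 ((hv i).congr fun n => ?_)
    rw [← mul_assoc, hu]
  · have h1 : Tendsto (fun n => ∑ i, star (w i * cfcₙ (cutInvPow α (d n)) h) *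
        (w i * cfcₙ (cutInvPow α (d n)) h)) atTop (𝓝 (∑ i, star (v i) * v i)) :=
      tendsto_finsetSum _ fun i _ => ((hv i).star).mul (hv i)
    refine tendsto_nhds_unique h1 ?_
    rw [tendsto_iff_norm_sub_tendsto_zero]
    refine squeeze_zero (fun _ => norm_nonneg _) (fun n => ?_)
      (hr (β := 1 - 2 * α) (by linarith))
    have hs : IsSelfAdjoint (cfcₙ (cutInvPow α (d n)) h) := cfcₙ_predicate _ h
    have h6 : cfcₙ (fun t : ℝ => t) h = h := cfcₙ_id' ℝ h (ha := .of_nonneg hh)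
    have h2 : ∑ i, star (w i * cfcₙ (cutInvPow α (d n)) h) * (w i * cfcₙ (cutInvPow α (d n)) h)
        = cfcₙ (fun t => cutInvPow α (d n) t * t * cutInvPow α (d n) t) h := by
      rw [cfcₙ_mul (fun t => cutInvPow α (d n) t * t) _ h
          ((hk n).mul continuous_id).continuousOn (by simp) (hk n).continuousOn (hk0 n),
        cfcₙ_mul _ (fun t => t) h (hk n).continuousOn (hk0 n) continuous_id.continuousOn rfl, h6]
      simp only [star_mul, hs.star_eq, mul_assoc]
      rw [← Finset.mul_sum]
      congr 1
      rw [← he, Finset.sum_mul]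
      simp only [mul_assoc]
    rw [h2, ← cfcₙ_sub (fun t => cutInvPow α (d n) t * t * cutInvPow α (d n) t) _ _
      (((hk n).mul continuous_id).mul (hk n)).continuousOn (by simp) hq.continuousOn hq0]
    refine norm_cfcₙ_le fun t ht => ?_
    exact abs_cutInvPow_sq_sub_le hα hα' (hd n) (quasispectrum_nonneg' hh ht)

end CStarTools

/-! ### Ramp functions -/

section RampFunction

theorem continuous_fn {ε : ℝ} : Continuous (fn ε) := by
  unfold fn; fun_prop

theorem fn_nonneg (ε t : ℝ) : 0 ≤ fn ε t := le_max_left _ _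

theorem fn_le_one (ε t : ℝ) : fn ε t ≤ 1 := max_le zero_le_one (min_le_left _ _)

theorem fn_eq_zero {ε t : ℝ} (hε : 0 < ε) (h : t ≤ ε) : fn ε t = 0 :=
  max_eq_left ((min_le_right _ _).trans (div_nonpos_of_nonpos_of_nonneg (by linarith) hε.le))

theorem fn_eq_one {ε t : ℝ} (hε : 0 < ε) (h : 2 * ε ≤ t) : fn ε t = 1 := by
  have : 1 ≤ (t - ε) / ε := (one_le_div hε).2 (by linarith)
  simp [fn, min_eq_left this]

theorem fn_zero {ε : ℝ} (hε : 0 < ε) : fn ε 0 = 0 := fn_eq_zero hε hε.le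

end RampFunction

/-! ### Square roots in the Pedersen ideal -/

section PedersenIdeal

variable {B : Type*} [NonUnitalCStarAlgebra B]

theorem mul_mem_ped_left (a : B) {x : B} (hx : x ∈ Ped B) : a * x ∈ Ped B :=
  fun I hI hd => (hI a x (hx I hI hd)).1

theorem mul_mem_ped_right {x : B} (hx : x ∈ Ped B) (a : B) : x * a ∈ Ped B :=
  fun I hI hd => (hI a x (hx I hI hd)).2

/-- An element `f(a)` with `f` vanishing near `0` has the local unit `f_{ε/2}(a)`. -/
theorem cfcₙ_mem_ped {f : ℝ → ℝ} (hf : Continuous f) {ε : ℝ} (hε : 0 < ε)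
    (h : ∀ t ≤ ε, f t = 0) (a : B) : cfcₙ f a ∈ Ped B := by
  intro I hI hd
  refine mem_of_local_unit (c := cfcₙ (fn (ε / 2)) a) hI hd ?_
  rw [← cfcₙ_mul f _ a hf.continuousOn (h 0 hε.le) continuous_fn.continuousOn
    (fn_zero (half_pos hε))]
  congr 1
  funext t
  rcases le_total t ε with ht | ht
  · simp [h t ht]
  · rw [fn_eq_one (half_pos hε) (by linarith), mul_one]

theorem fn_mem_ped {ε : ℝ} (hε : 0 < ε) (a : B) : cfcₙ (fn ε) a ∈ Ped B :=
  cfcₙ_mem_ped continuous_fn hε (fun _ h => fn_eq_zero hε h) a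

theorem fn_half_mul_fn {ε : ℝ} (hε : 0 < ε) (t : ℝ) : fn (ε / 2) t * fn ε t = fn ε t := by
  rcases le_total t ε with ht | ht
  · simp [fn_eq_zero hε ht]
  · rw [fn_eq_one (half_pos hε) (by linarith), one_mul]

theorem cfcₙ_fn_half_mul {ε : ℝ} (hε : 0 < ε) (a : B) :
    cfcₙ (fn (ε / 2)) a * cfcₙ (fn ε) a = cfcₙ (fn ε) a := by
  rw [← cfcₙ_mul _ _ a continuous_fn.continuousOn (fn_zero (half_pos hε)) continuous_fn.continuousOn
    (fn_zero hε)]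
  simp only [fn_half_mul_fn hε]

/-- `h` is a finite sum of elements `w* w` for which `w` has a left unit in the Pedersen ideal. -/
def IsPedSum (h : B) : Prop :=
  ∃ (n : ℕ) (w c : Fin n → B), (∀ i, c i ∈ Ped B ∧ c i * w i = w i) ∧
    h = ∑ i, star (w i) * w i

namespace IsPedSum

theorem add {h k : B} (hh : IsPedSum h) (hk : IsPedSum k) : IsPedSum (h + k) := by
  obtain ⟨n, w, c, h1, rfl⟩ := hh
  obtain ⟨m, w', c', h2, rfl⟩ := hk
  refine ⟨n + m, Fin.append w w', Fin.append c c', fun i => ?_, ?_⟩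
  · refine Fin.addCases (fun i => ?_) (fun i => ?_) i
    · simpa using h1 i
    · simpa using h2 i
  · simp [Fin.sum_univ_add]

theorem conj {h : B} (hh : IsPedSum h) (b : B) : IsPedSum (star b * h * b) := by
  obtain ⟨n, w, c, h1, rfl⟩ := hh
  refine ⟨n, fun i => w i * b, c, fun i => ⟨(h1 i).1, ?_⟩, ?_⟩
  · rw [← mul_assoc, (h1 i).2]
  · simp [Finset.mul_sum, Finset.sum_mul, mul_assoc]

theorem smul {h : B} (hh : IsPedSum h) (z : ℂ) : IsPedSum ((star z * z) • h) := by
  obtain ⟨n, w, c, h1, rfl⟩ := hh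
  refine ⟨n, fun i => z • w i, c, fun i => ⟨(h1 i).1, ?_⟩, ?_⟩
  · rw [mul_smul_comm, (h1 i).2]
  · simp [Finset.smul_sum, smul_mul_smul_comm]

theorem zero : IsPedSum (0 : B) := ⟨0, fun _ => 0, fun _ => 0, fun i => i.elim0, by simp⟩

end IsPedSum

variable [PartialOrder B] [StarOrderedRing B]

variable (B) in
/-- The elements `x` for which `x* x` and `x x*` are dominated by finite sums `∑ w* w`, in which
every `w` has a left unit in the Pedersen ideal. -/
def pedDominated : Submodule ℂ B where
  carrier := {x | (∃ h, IsPedSum h ∧ star x * x ≤ h) ∧ ∃ k, IsPedSum k ∧ x * star x ≤ k}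
  zero_mem' := ⟨⟨0, .zero, by simp⟩, ⟨0, .zero, by simp⟩⟩
  add_mem' := by
    have key : ∀ x y h k : B, star x * x ≤ h → star y * y ≤ k →
        star (x + y) * (x + y) ≤ (h + k) + (h + k) := by
      intro x y h k h1 h2
      have h3 : star (x + y) * (x + y) =
          (star x * x + star y * y) + (star x * x + star y * y) - star (x - y) * (x - y) := by
        simp only [star_add, star_sub, add_mul, mul_add, sub_mul, mul_sub]; abel
      rw [h3]
      exact (sub_le_self _ (star_mul_self_nonneg _)).trans
        (add_le_add (add_le_add h1 h2) (add_le_add h1 h2))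
    rintro x y ⟨⟨h, hh, h1⟩, k, hk, h2⟩ ⟨⟨h', hh', h1'⟩, k', hk', h2'⟩
    refine ⟨⟨_, (hh.add hh').add (hh.add hh'), key _ _ _ _ h1 h1'⟩,
      ⟨_, (hk.add hk').add (hk.add hk'), ?_⟩⟩
    have := key (star x) (star y) k k' (by simpa using h2) (by simpa using h2')
    simpa using this
  smul_mem' := by
    have key : ∀ (z : ℂ) (x h : B), star x * x ≤ h →
        star (z • x) * (z • x) ≤ (star z * z) • h := by
      intro z x h hx
      obtain ⟨y, hy⟩ := CStarAlgebra.nonneg_iff_eq_star_mul_self.1 (sub_nonneg.2 hx)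
      rw [← sub_nonneg]
      have : (star z * z) • h - star (z • x) * (z • x) = star (z • y) * (z • y) := by
        rw [star_smul, star_smul, smul_mul_smul_comm, smul_mul_smul_comm, ← smul_sub, hy]
      rw [this]
      exact star_mul_self_nonneg _
    rintro z x ⟨⟨h, hh, h1⟩, k, hk, h2⟩
    refine ⟨⟨_, hh.smul z, key z x h h1⟩, ⟨_, hk.smul (star z), ?_⟩⟩
    have := key (star z) (star x) k (by simpa using h2)
    simpa using this

theorem star_mem_pedDominated {x : B} (hx : x ∈ pedDominated B) : star x ∈ pedDominated B := by
  obtain ⟨⟨h, hh, h1⟩, k, hk, h2⟩ := hx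
  exact ⟨⟨k, hk, by simpa using h2⟩, ⟨h, hh, by simpa using h1⟩⟩

theorem mul_mem_pedDominated (b : B) {x : B} (hx : x ∈ pedDominated B) :
    b * x ∈ pedDominated B := by
  obtain ⟨⟨h, hh, h1⟩, k, hk, h2⟩ := hx
  refine ⟨⟨_, hh.smul (‖b‖ : ℂ), ?_⟩, ⟨_, hk.conj (star b), ?_⟩⟩
  · have h3 : star (b * x) * (b * x) ≤ ‖star b * b‖ • (star x * x) := by
      have := CStarAlgebra.star_left_conjugate_le_norm_smul (a := x) (b := star b * b)
      simpa [mul_assoc] using this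
    have h4 : (star (‖b‖ : ℂ) * (‖b‖ : ℂ)) • h = ‖star b * b‖ • h := by
      rw [CStarRing.norm_star_mul_self, ← Complex.coe_smul]
      simp
    rw [h4]
    exact h3.trans (smul_le_smul_of_nonneg_left h1 (norm_nonneg _))
  · have := star_left_conjugate_le_conjugate h2 (star b)
    simpa [mul_assoc] using this

theorem isTwoSided_pedDominated : IsTwoSided (pedDominated B) := fun a x hx =>
  ⟨mul_mem_pedDominated a hx, by
    simpa using star_mem_pedDominated
      (mul_mem_pedDominated (star a) (star_mem_pedDominated hx))⟩

/-- If `z* z ≤ h`, then the ramps of `h` are approximate right units for `z`. -/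
theorem norm_mul_fn_sub_le {z h : B} (hh : 0 ≤ h) (hz : star z * z ≤ h) {ε : ℝ} (hε : 0 < ε) :
    ‖z * cfcₙ (fn ε) h - z‖ ≤ √(2 * ε) := by
  refine norm_mul_cfcₙ_sub_le hh hz continuous_fn (fn_zero hε) (Real.sqrt_nonneg _)
    fun t ht _ => ?_
  rw [Real.sq_sqrt (by positivity)]
  rcases le_total (2 * ε) t with h | h
  · rw [fn_eq_one hε h]; simpa using hε.le
  · have h1 := fn_nonneg ε t
    have h2 := fn_le_one ε t
    have h3 : (fn ε t - 1) ^ 2 ≤ 1 := by nlinarith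
    nlinarith

/-- Every `b` is the limit of the elements `b f_ε(b* b)`. -/
theorem dense_pedDominated : Dense (pedDominated B : Set B) := by
  rw [Metric.dense_iff]
  intro b r hr
  have hε : 0 < r ^ 2 / 8 := by positivity
  refine ⟨b * cfcₙ (fn (r ^ 2 / 8)) (star b * b), ?_, ?_⟩
  · rw [Metric.mem_ball, dist_eq_norm]
    refine (norm_mul_fn_sub_le (star_mul_self_nonneg b) le_rfl hε).trans_lt ?_
    rw [Real.sqrt_lt' hr]
    nlinarith
  · refine mul_mem_pedDominated b ?_
    have hs : IsSelfAdjoint (cfcₙ (fn (r ^ 2 / 8)) (star b * b)) := cfcₙ_predicate _ _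
    have : IsPedSum (star (cfcₙ (fn (r ^ 2 / 8)) (star b * b)) *
        cfcₙ (fn (r ^ 2 / 8)) (star b * b)) :=
      ⟨1, fun _ => cfcₙ (fn (r ^ 2 / 8)) (star b * b),
        fun _ => cfcₙ (fn (r ^ 2 / 8 / 2)) (star b * b),
        fun _ => ⟨fn_mem_ped (half_pos hε) _, cfcₙ_fn_half_mul hε _⟩, by simp⟩
    refine ⟨⟨_, this, le_rfl⟩, ⟨_, this, ?_⟩⟩
    rw [hs.star_eq]

/-- Powers less than `1` of `h = ∑ w* w` are again sums `∑ v* v`, in which every `v` has the same left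
unit in the Pedersen ideal as `w`. -/
theorem IsPedSum.rpow_mem_ped {h : B} (hh : IsPedSum h) {α : ℝ} (hα : 0 < α) (hα' : α < 1 / 2) :
    cfcₙ (fun t : ℝ => t ^ (1 - 2 * α)) h ∈ Ped B := by
  obtain ⟨n, w, c, h1, h2⟩ := hh
  obtain ⟨v, -, hv, hv'⟩ := exists_factor_rpow w h2.ge hα hα'
  rw [← hv' h2.symm]
  refine sum_mem fun i _ => mul_mem_ped_left _ ?_
  rw [← hv (c i) i (h1 i).2]
  exact mul_mem_ped_right (h1 i).1 _

/-- The Pedersen ideal contains the square roots of its positive elements. -/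
theorem sqrt_mem_ped {a : B} (ha : 0 ≤ a) (h : a ∈ Ped B) : CFC.sqrt a ∈ Ped B := by
  -- `a² ≤ k`, hence `a ≤ √k`, and `√a` is a multiple of `(√k)^(1/4)`
  obtain ⟨⟨k, hk, hak⟩, -⟩ := h _ isTwoSided_pedDominated dense_pedDominated
  have hk0 : 0 ≤ k := (star_mul_self_nonneg a).trans hak
  rw [(IsSelfAdjoint.of_nonneg ha).star_eq] at hak
  have h1 : a ≤ CFC.sqrt k := by
    have := CFC.monotone_sqrt hak
    rwa [CFC.sqrt_mul_self a ha] at this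
  have h2 : ∑ _i : Unit, star (CFC.sqrt a) * CFC.sqrt a ≤ CFC.sqrt k := by
    rw [(IsSelfAdjoint.of_nonneg (CFC.sqrt_nonneg a)).star_eq, CFC.sqrt_mul_sqrt_self a ha]
    simpa using h1
  obtain ⟨v, hv, -, -⟩ := exists_factor_rpow (fun _ : Unit => CFC.sqrt a) h2
    (α := 1 / 4) (by norm_num) (by norm_num)
  rw [hv ()]
  refine mul_mem_ped_left _ ?_
  have h3 : cfcₙ (fun t : ℝ => t ^ (1 / 4 : ℝ)) (CFC.sqrt k)
      = cfcₙ (fun t : ℝ => t ^ (1 - 2 * (7 / 16) : ℝ)) k := by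
    rw [CFC.sqrt_eq_real_sqrt k hk0, ← cfcₙ_comp (fun t : ℝ => t ^ (1 / 4 : ℝ)) Real.sqrt k
      (continuous_id.rpow_const fun _ => Or.inr (by norm_num)).continuousOn
      (Real.zero_rpow (by norm_num)) Real.continuous_sqrt.continuousOn Real.sqrt_zero
      (.of_nonneg hk0)]
    refine cfcₙ_congr fun t ht => ?_
    have := quasispectrum_nonneg' hk0 ht
    simp only [Function.comp]
    rw [Real.sqrt_eq_rpow, ← Real.rpow_mul this]
    norm_num
  rw [h3]
  exact hk.rpow_mem_ped (by norm_num) (by norm_num)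

end PedersenIdeal

/-! ### Quasitraces on the Pedersen ideal -/

section QuasitraceTheory

variable {B : Type u} [NonUnitalCStarAlgebra B]

open Classical in
/-- The extension of a quasitrace `τ` on the Pedersen ideal to a `[0, ∞]`-valued function on the
positive cone. -/
noncomputable def extVal (τ : Ped B → ℂ) (a : B) : ℝ≥0∞ :=
  if h : a ∈ Ped B then ENNReal.ofReal (τ ⟨a, h⟩).re
  else ⨆ ε : Set.Ioi (0 : ℝ), ENNReal.ofReal (τ ⟨cut (ε : ℝ) a, cut_mem_ped ε.2 a⟩).re

variable {τ : Ped B → ℂ}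

theorem extVal_of_mem {a : B} (h : a ∈ Ped B) : extVal τ a = ENNReal.ofReal (τ ⟨a, h⟩).re :=
  dif_pos h

theorem extVal_ne_top {a : B} (h : a ∈ Ped B) : extVal τ a ≠ ∞ := by
  rw [extVal_of_mem h]; exact ENNReal.ofReal_ne_top

/-- A quasitrace is linear on pairs of commuting self-adjoint elements. -/
theorem IsQuasitrace.map_smul_add (hτ : IsQuasitrace τ) {x y : Ped B} (hx : IsSelfAdjoint x)
    (hy : IsSelfAdjoint y) (hxy : Commute x y) (c : ℂ) : τ (c • x + y) = c * τ x + τ y := by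
  have hcomm : ∀ a ∈ ({x, y} : Set (Ped B)), ∀ b ∈ ({x, y} : Set (Ped B)), a * b = b * a := by
    rintro a (rfl | rfl) b (rfl | rfl)
    exacts [rfl, hxy, hxy.symm, rfl]
  have hstar : ∀ a ∈ ({x, y} : Set (Ped B)), ∀ b ∈ ({x, y} : Set (Ped B)),
      a * star b = star b * a := by
    rintro a ha b (rfl | rfl)
    · rw [hx.star_eq]; exact hcomm _ ha _ (Or.inl rfl)
    · rw [hy.star_eq]; exact hcomm _ ha _ (Or.inr rfl)
  have := NonUnitalStarAlgebra.isMulCommutative_adjoin ℂ hcomm hstar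
  refine hτ.linear (NonUnitalStarAlgebra.adjoin ℂ {x, y}) (fun a ha b hb => ?_) x
    (NonUnitalStarAlgebra.subset_adjoin ℂ _ (Or.inl rfl)) y
    (NonUnitalStarAlgebra.subset_adjoin ℂ _ (Or.inr rfl)) c
  exact congrArg Subtype.val (mul_comm' (⟨a, ha⟩ : NonUnitalStarAlgebra.adjoin ℂ {x, y}) ⟨b, hb⟩)

theorem IsQuasitrace.extVal_trace_of_mem (hτ : IsQuasitrace τ) {y : B} (hy : y ∈ Ped B) :
    extVal τ (star y * y) = extVal τ (y * star y) := by
  rw [extVal_of_mem (mul_mem_ped_left _ hy), extVal_of_mem (mul_mem_ped_right hy _)]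
  exact congrArg (fun z : ℂ => ENNReal.ofReal z.re) (hτ.trace ⟨y, hy⟩)

theorem IsQuasitrace.extVal_smul_of_mem (hτ : IsQuasitrace τ) {a : B} (ha : IsSelfAdjoint a)
    (h : a ∈ Ped B) {r : ℝ} (hr : 0 ≤ r) :
    extVal τ (r • a) = ENNReal.ofReal r * extVal τ a := by
  have h0 : τ 0 = 0 := by
    have := hτ.map_smul_add (x := 0) (y := 0) (.zero _) (.zero _) (Commute.zero_left _) 1
    simpa using this
  have h1 := hτ.map_smul_add (x := ⟨a, h⟩) (y := 0) (Subtype.ext ha) (.zero _)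
    (Commute.zero_right _) (r : ℂ)
  have h2 : r • a ∈ Ped B := by
    rw [← Complex.coe_smul]; exact (Ped B).smul_mem' _ h
  have h3 : (⟨r • a, h2⟩ : Ped B) = (r : ℂ) • ⟨a, h⟩ + 0 := by
    rw [add_zero]; exact Subtype.ext (Complex.coe_smul r a).symm
  rw [extVal_of_mem h2, extVal_of_mem h, h3, h1, h0, add_zero, Complex.re_ofReal_mul,
    ENNReal.ofReal_mul hr]

theorem extVal_zero (hτ : IsQuasitrace τ) : extVal τ 0 = 0 := by
  have := hτ.extVal_smul_of_mem (a := 0) (.zero _) (Ped B).zero_mem le_rfl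
  simpa using this

variable [PartialOrder B] [StarOrderedRing B]

theorem IsQuasitrace.re_nonneg (hτ : IsQuasitrace τ) {a : B} (ha : 0 ≤ a) (h : a ∈ Ped B) :
    0 ≤ (τ ⟨a, h⟩).re := by
  have h1 := hτ.nonneg ⟨CFC.sqrt a, sqrt_mem_ped ha h⟩
  have h2 : star (⟨CFC.sqrt a, sqrt_mem_ped ha h⟩ : Ped B) * ⟨CFC.sqrt a, sqrt_mem_ped ha h⟩
      = ⟨a, h⟩ := by
    refine Subtype.ext ?_
    change star (CFC.sqrt a) * CFC.sqrt a = a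
    rw [(IsSelfAdjoint.of_nonneg (CFC.sqrt_nonneg a)).star_eq, CFC.sqrt_mul_sqrt_self a ha]
  rw [h2] at h1
  exact (Complex.le_def.1 h1).1

theorem IsQuasitrace.extVal_add_of_mem (hτ : IsQuasitrace τ) {a b : B} (ha : 0 ≤ a) (hb : 0 ≤ b)
    (h : a ∈ Ped B) (h' : b ∈ Ped B) (hab : Commute a b) :
    extVal τ (a + b) = extVal τ a + extVal τ b := by
  have h1 := hτ.map_smul_add (x := ⟨a, h⟩) (y := ⟨b, h'⟩)
    (Subtype.ext (IsSelfAdjoint.of_nonneg ha)) (Subtype.ext (IsSelfAdjoint.of_nonneg hb))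
    (Subtype.ext hab) 1
  rw [one_smul, one_mul] at h1
  rw [extVal_of_mem h, extVal_of_mem h', extVal_of_mem ((Ped B).add_mem h h'),
    ← ENNReal.ofReal_add (hτ.re_nonneg ha h) (hτ.re_nonneg hb h'), ← Complex.add_re, ← h1]
  rfl

theorem IsQuasitrace.extVal_mono_of_commute (hτ : IsQuasitrace τ) {a b : B} (ha : 0 ≤ a)
    (hab : a ≤ b) (h : a ∈ Ped B) (h' : b ∈ Ped B) (hc : Commute a b) :
    extVal τ a ≤ extVal τ b := by
  have h1 := hτ.extVal_add_of_mem ha (sub_nonneg.2 hab) h ((Ped B).sub_mem h' h)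
    (hc.sub_right (Commute.refl a))
  rw [add_sub_cancel] at h1
  rw [h1]
  exact le_self_add

/-- `y` is a left multiple of `(y* y)^(1/4)`. -/
theorem mem_ped_of_star_mul_self_mem {y : B} (h : star y * y ∈ Ped B) : y ∈ Ped B := by
  have h0 : 0 ≤ star y * y := star_mul_self_nonneg y
  obtain ⟨v, hv, -, -⟩ := exists_factor_rpow (fun _ : Unit => y) (h := star y * y)
    (by simp) (α := 1 / 4) (by norm_num) (by norm_num)
  rw [show y = _ from hv ()]
  refine mul_mem_ped_left _ ?_
  have h3 : cfcₙ (fun t : ℝ => t ^ (1 / 4 : ℝ)) (star y * y)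
      = CFC.sqrt (CFC.sqrt (star y * y)) := by
    rw [CFC.sqrt_eq_real_sqrt _ (CFC.sqrt_nonneg _), CFC.sqrt_eq_real_sqrt _ h0,
      ← cfcₙ_comp Real.sqrt Real.sqrt (star y * y) Real.continuous_sqrt.continuousOn
      Real.sqrt_zero Real.continuous_sqrt.continuousOn Real.sqrt_zero (.of_nonneg h0)]
    refine cfcₙ_congr fun t ht => ?_
    have := quasispectrum_nonneg' h0 ht
    simp only [Function.comp]
    rw [Real.sqrt_eq_rpow, Real.sqrt_eq_rpow, ← Real.rpow_mul this]
    norm_num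
  rw [h3]
  exact sqrt_mem_ped (CFC.sqrt_nonneg _) (sqrt_mem_ped h0 h)

theorem mul_sqrt_eq_of_mul_eq {u b : B} (hb : 0 ≤ b) (hu : IsSelfAdjoint u) (h : u * b = b) :
    u * CFC.sqrt b = CFC.sqrt b := by
  have h1 : b * u = b := by
    have := congrArg star h
    rwa [star_mul, hu.star_eq, (IsSelfAdjoint.of_nonneg hb).star_eq] at this
  have hs : star (CFC.sqrt b) = CFC.sqrt b :=
    (IsSelfAdjoint.of_nonneg (CFC.sqrt_nonneg b)).star_eq
  rw [← sub_eq_zero, ← CStarRing.mul_star_self_eq_zero_iff]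
  have h2 : (u * CFC.sqrt b - CFC.sqrt b) * star (u * CFC.sqrt b - CFC.sqrt b)
      = u * (CFC.sqrt b * CFC.sqrt b) * u - u * (CFC.sqrt b * CFC.sqrt b)
        - (CFC.sqrt b * CFC.sqrt b) * u + CFC.sqrt b * CFC.sqrt b := by
    simp only [star_sub, star_mul, hs, hu.star_eq, mul_sub, sub_mul, mul_assoc]
    abel
  rw [h2, CFC.sqrt_mul_sqrt_self b hb, h, h1]
  abel

/-- `a ≤ b + δ · 1`, expressed without a unit. -/
def LeAddConst (a b : B) (δ : ℝ) : Prop :=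
  ∀ x : B, star x * a * x ≤ star x * b * x + δ • (star x * x)

theorem LeAddConst.of_le {a b : B} (h : a ≤ b) : LeAddConst a b 0 := fun x => by
  simpa using star_left_conjugate_le_conjugate h x

theorem LeAddConst.trans {a b c : B} {δ δ' : ℝ} (h : LeAddConst a b δ) (h' : LeAddConst b c δ') :
    LeAddConst a c (δ + δ') := fun x => by
  refine (h x).trans ((add_le_add_left (h' x) _).trans_eq ?_)
  rw [add_smul]; abel

theorem LeAddConst.add {a b a' b' : B} {δ δ' : ℝ} (h : LeAddConst a b δ)
    (h' : LeAddConst a' b' δ') : LeAddConst (a + a') (b + b') (δ + δ') := fun x => by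
  simp only [mul_add, add_mul]
  refine (add_le_add (h x) (h' x)).trans_eq ?_
  rw [add_smul]; abel

/-- A comparison of spectral levels: if `a ≤ b + δ` and `u` is a unit for `b`, then the part of
`a` above a level `t > δ` is equivalent to an element below `u²`. -/
theorem IsQuasitrace.extVal_level_le (hτ : IsQuasitrace τ) {a b u : B} (ha : 0 ≤ a) (hb : 0 ≤ b)
    (hu : IsSelfAdjoint u) (huP : u ∈ Ped B) (hub : u * b = b) {δ t : ℝ} (hδ : 0 ≤ δ) (hδt : δ < t)
    (hab : LeAddConst a b δ) {g : ℝ → ℝ} (hg : Continuous g) (hgt : ∀ s ≤ t, g s = 0)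
    (hg1 : ∀ s, |g s| ≤ 1) :
    extVal τ (cfcₙ g a * cfcₙ g a) ≤ extVal τ (u * u) := by
  have h0t : 0 < t := hδ.trans_lt hδt
  have hg0 : g 0 = 0 := hgt 0 h0t.le
  set G := cfcₙ g a with hG
  have hGs : star G = G := (cfcₙ_predicate g a : IsSelfAdjoint G).star_eq
  have hGP : G ∈ Ped B := cfcₙ_mem_ped hg h0t hgt a
  have hκ : 0 < t - δ := sub_pos.2 hδt
  have hsb : star (CFC.sqrt b) = CFC.sqrt b :=
    (IsSelfAdjoint.of_nonneg (CFC.sqrt_nonneg b)).star_eq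
  have hid : cfcₙ (fun t : ℝ => t) a = a := cfcₙ_id' ℝ a (ha := .of_nonneg ha)
  have h1 : t • (G * G) ≤ G * a * G := by
    have e1 : t • (G * G) = cfcₙ (fun s => t * (g s * g s)) a := by
      rw [cfcₙ_const_mul t (fun s => g s * g s) a (hg.mul hg).continuousOn (by simp [hg0]),
        cfcₙ_mul g g a hg.continuousOn hg0 hg.continuousOn hg0]
    have e2 : G * a * G = cfcₙ (fun s => g s * s * g s) a := by
      rw [cfcₙ_mul (fun s => g s * s) g a (hg.mul continuous_id).continuousOn (by simp)
        hg.continuousOn hg0, cfcₙ_mul g (fun s => s) a hg.continuousOn hg0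
        continuous_id.continuousOn rfl, hid]
    rw [e1, e2]
    refine cfcₙ_mono (fun s _ => ?_) (continuous_const.mul (hg.mul hg)).continuousOn
      ((hg.mul continuous_id).mul hg).continuousOn (by simp [hg0]) (by simp)
    rcases le_total s t with h | h
    · simp [hgt s h]
    · nlinarith [mul_self_nonneg (g s)]
  have h2 : (t - δ) • (G * G) ≤ star (CFC.sqrt b * G) * (CFC.sqrt b * G) := by
    have h3 := h1.trans (by simpa only [hGs] using hab G)
    rw [sub_smul, sub_le_iff_le_add]
    refine h3.trans_eq ?_
    congr 1
    have h4 : G * CFC.sqrt b * (CFC.sqrt b * G) = G * (CFC.sqrt b * CFC.sqrt b) * G := by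
      simp only [mul_assoc]
    rw [star_mul, hsb, hGs, h4, CFC.sqrt_mul_sqrt_self b hb]
  -- `x` carries the part of `a` above `t`: it has the left unit `u`, and `x* x` dominates `G²`
  set x := CFC.sqrt b * G with hx
  have hux : u * x = x := by rw [hx, ← mul_assoc, mul_sqrt_eq_of_mul_eq hb hu hub]
  obtain ⟨v, hv1, hv2, hv3⟩ := exists_factor_rpow (fun _ : Unit => x) (h := star x * x)
    (by simp) (α := 1 / 4) (by norm_num) (by norm_num)
  have hsq : √(t - δ) * √(t - δ) = t - δ := Real.mul_self_sqrt hκ.le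
  have hsq' : √(t - δ) ≠ 0 := (Real.sqrt_pos.2 hκ).ne'
  obtain ⟨W, hW, -, -⟩ := exists_factor_rpow (fun _ : Unit => √(t - δ) • G) (h := star x * x)
    (by
      simp only [Finset.univ_unique, Finset.sum_const, Finset.card_singleton, one_smul]
      rw [star_smul, smul_mul_smul_comm, hGs]
      simpa [hsq] using h2) (α := 1 / 4) (by norm_num) (by norm_num)
  have huv : u * v () = v () := hv2 u () hux
  have hvv : star (v ()) * v () = cfcₙ (fun t : ℝ => t ^ (1 / 2 : ℝ)) (star x * x) := by
    have := hv3 (by simp)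
    norm_num at this ⊢
    exact this
  have hrr : cfcₙ (fun t : ℝ => t ^ (1 / 2 : ℝ)) (star x * x) =
      cfcₙ (fun t : ℝ => t ^ (1 / 4 : ℝ)) (star x * x) *
        cfcₙ (fun t : ℝ => t ^ (1 / 4 : ℝ)) (star x * x) := by
    have hc : Continuous fun t : ℝ => t ^ (1 / 4 : ℝ) :=
      continuous_id.rpow_const fun _ => Or.inr (by norm_num)
    have h0 : (0 : ℝ) ^ (1 / 4 : ℝ) = 0 := Real.zero_rpow (by norm_num)
    rw [← cfcₙ_mul _ _ _ hc.continuousOn h0 hc.continuousOn h0]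
    refine cfcₙ_congr fun s hs => ?_
    have := quasispectrum_nonneg' (star_mul_self_nonneg x) hs
    change s ^ (1 / 2 : ℝ) = s ^ (1 / 4 : ℝ) * s ^ (1 / 4 : ℝ)
    rw [← Real.rpow_add_of_nonneg this (by norm_num) (by norm_num)]
    norm_num
  set r := cfcₙ (fun t : ℝ => t ^ (1 / 4 : ℝ)) (star x * x) with hr
  have hrs : star r = r := (cfcₙ_predicate _ _ : IsSelfAdjoint r).star_eq
  -- `y* y = G²`, while `y` has the left unit `u`, so that `y y* ≤ u²`
  set y := (√(t - δ))⁻¹ • (v () * star (W ())) with hy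
  have hyy : star y * y = G * G := by
    have e : G = (√(t - δ))⁻¹ • (W () * r) := by
      rw [← hW (), smul_smul, inv_mul_cancel₀ hsq', one_smul]
    have e' : G * G = ((√(t - δ))⁻¹ * (√(t - δ))⁻¹) • (W () * (r * r) * star (W ())) := by
      nth_rewrite 2 [← hGs]
      rw [e, star_smul, star_trivial, smul_mul_smul_comm, star_mul, hrs]
      simp only [mul_assoc]
    rw [e', ← hrr, ← hvv, hy, star_smul, star_trivial, smul_mul_smul_comm]
    simp only [star_mul, star_star, mul_assoc]
  have huy : u * y = y := by rw [hy, mul_smul_comm, ← mul_assoc, huv]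
  have hyP : y ∈ Ped B := mem_ped_of_star_mul_self_mem (hyy ▸ mul_mem_ped_left G hGP)
  rw [← hyy, hτ.extVal_trace_of_mem hyP]
  have hyu : y * star y * u = y * star y := by
    have := congrArg star huy
    rw [star_mul, hu.star_eq] at this
    rw [mul_assoc, this]
  have huy' : u * (y * star y) = y * star y := by rw [← mul_assoc, huy]
  refine hτ.extVal_mono_of_commute (mul_star_self_nonneg y) ?_ (mul_mem_ped_right hyP _)
    (mul_mem_ped_left u huP) ?_
  · have h4 : ‖y * star y‖ ≤ 1 := by
      rw [CStarRing.norm_self_mul_star, ← CStarRing.norm_star_mul_self, hyy]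
      have : ‖G‖ ≤ 1 := norm_cfcₙ_le fun s _ => hg1 s
      calc ‖G * G‖ ≤ ‖G‖ * ‖G‖ := norm_mul_le _ _
        _ ≤ 1 * 1 := by gcongr
        _ = 1 := one_mul 1
    have h5 := CStarAlgebra.star_left_conjugate_le_norm_smul (a := u) (b := y * star y)
      (.mul_star_self y)
    rw [hu.star_eq, huy', hyu] at h5
    refine h5.trans ?_
    have h6 : 0 ≤ u * u := by simpa [hu.star_eq] using star_mul_self_nonneg u
    simpa using smul_le_smul_of_nonneg_right h4 h6
  · change y * star y * (u * u) = u * u * (y * star y)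
    rw [← mul_assoc, hyu, hyu, mul_assoc, huy', huy']

end QuasitraceTheory

/-! ### Layers of real numbers -/

section Layers

/-- The layer of height `c` above the level `s`. -/
def layer (s c t : ℝ) : ℝ := min (max (t - s) 0) c

theorem continuous_layer {s c : ℝ} : Continuous (layer s c) := by
  unfold layer; fun_prop

theorem layer_nonneg {s c : ℝ} (hc : 0 ≤ c) (t : ℝ) : 0 ≤ layer s c t :=
  le_min (le_max_right _ _) hc

theorem layer_eq_zero {s c t : ℝ} (hc : 0 ≤ c) (h : t ≤ s) : layer s c t = 0 := by
  rw [layer, max_eq_right (by linarith), min_eq_left hc]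

theorem layer_zero {s c : ℝ} (hs : 0 ≤ s) (hc : 0 ≤ c) : layer s c 0 = 0 := layer_eq_zero hc hs

theorem layer_add {s c d : ℝ} (hc : 0 ≤ c) (hd : 0 ≤ d) (t : ℝ) :
    layer s (c + d) t = layer s c t + layer (s + c) d t := by
  unfold layer
  rcases le_total t s with h | h
  · rw [max_eq_right (by linarith), max_eq_right (by linarith), min_eq_left (by linarith),
      min_eq_left hc, min_eq_left hd, add_zero]
  · rw [max_eq_left (by linarith)]
    rcases le_total t (s + c) with h' | h'
    · rw [max_eq_right (by linarith), min_eq_left (by linarith), min_eq_left (by linarith),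
        min_eq_left hd, add_zero]
    · rw [max_eq_left (by linarith), min_eq_right (a := t - s) (b := c) (by linarith)]
      rcases le_total (t - s) (c + d) with h3 | h3
      · rw [min_eq_left h3, min_eq_left (by linarith)]; ring
      · rw [min_eq_right h3, min_eq_right (by linarith)]

theorem layer_le {s c t : ℝ} : layer s c t ≤ max (t - s) 0 := min_le_left _ _

theorem layer_eq {s c t : ℝ} (hc : 0 ≤ c) (hs : 0 ≤ s) (h : t ≤ c) :
    layer s c t = max (t - s) 0 :=
  min_eq_left (max_le (by linarith) hc)

end Layers

/-! ### Monotonicity and subadditivity of quasitraces -/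

section QuasitraceOrder

variable {B : Type u} [NonUnitalCStarAlgebra B]

theorem continuous_max_sub {ε : ℝ} : Continuous fun t : ℝ => max (t - ε) 0 := by fun_prop

theorem max_sub_zero {ε : ℝ} (hε : 0 ≤ ε) : max ((0 : ℝ) - ε) 0 = 0 := max_eq_right (by linarith)

theorem cfcₙ_layer_mem_ped {s c : ℝ} (hs : 0 < s) (hc : 0 ≤ c) (a : B) :
    cfcₙ (layer s c) a ∈ Ped B :=
  cfcₙ_mem_ped continuous_layer hs (fun _ h => layer_eq_zero hc h) a

variable [PartialOrder B] [StarOrderedRing B]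

theorem cut_nonneg (ε : ℝ) (a : B) : 0 ≤ cut ε a := cfcₙ_nonneg fun _ _ => le_max_right _ _

theorem leAddConst_of_norm_sub_le {a b : B} (ha : IsSelfAdjoint a) (hb : IsSelfAdjoint b) {δ : ℝ}
    (h : ‖a - b‖ ≤ δ) : LeAddConst a b δ := fun x => by
  have h1 := CStarAlgebra.star_left_conjugate_le_norm_smul (a := x) (ha.sub hb)
  rw [mul_sub, sub_mul, sub_le_iff_le_add'] at h1
  exact h1.trans (add_le_add_right
    (smul_le_smul_of_nonneg_right h (star_mul_self_nonneg x)) _)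

theorem norm_sub_cut_le {b : B} (hb : 0 ≤ b) {s : ℝ} (hs : 0 ≤ s) : ‖b - cut s b‖ ≤ s := by
  have hid : cfcₙ (fun t : ℝ => t) b = b := cfcₙ_id' ℝ b (ha := .of_nonneg hb)
  nth_rewrite 1 [← hid]
  rw [cut, ← cfcₙ_sub (fun t : ℝ => t) _ b continuous_id.continuousOn rfl
    continuous_max_sub.continuousOn (max_sub_zero hs)]
  refine norm_cfcₙ_le fun t ht => ?_
  have := quasispectrum_nonneg' hb ht
  rw [Real.norm_eq_abs, abs_le]
  rcases le_total t s with h | h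
  · rw [max_eq_right (by linarith)]; constructor <;> linarith
  · rw [max_eq_left (by linarith)]; constructor <;> linarith

theorem leAddConst_cut {b : B} (hb : 0 ≤ b) {s : ℝ} (hs : 0 ≤ s) : LeAddConst b (cut s b) s :=
  leAddConst_of_norm_sub_le (.of_nonneg hb) (.of_nonneg (cut_nonneg s b)) (norm_sub_cut_le hb hs)

variable {τ : Ped B → ℂ}

/-- The comparison of spectral levels, applied to one layer of height `ε`: the layer of `b` is a unit
for `(b - s - ε)₊`, which differs from `b` by at most `s + ε`. -/
theorem IsQuasitrace.extVal_layer_le (hτ : IsQuasitrace τ) {a b : B} (ha : 0 ≤ a) (hb : 0 ≤ b)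
    {δ ε s : ℝ} (hδ : 0 ≤ δ) (hε : 0 < ε) (hs : 0 < s) (hab : LeAddConst a b δ) :
    extVal τ (cfcₙ (layer (δ + s + 2 * ε) ε) a) ≤ extVal τ (cfcₙ (layer s ε) b) := by
  let g : ℝ → ℝ → ℝ := fun r t => √(layer r ε t / ε)
  have hgc : ∀ r, Continuous (g r) := fun r =>
    Real.continuous_sqrt.comp (continuous_layer.div_const _)
  have hg0 : ∀ r t, t ≤ r → g r t = 0 := fun r t h => by simp [g, layer_eq_zero hε.le h]
  have hgg : ∀ r t, ε * (g r t * g r t) = layer r ε t := fun r t => by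
    simp only [g]
    rw [Real.mul_self_sqrt (div_nonneg (layer_nonneg hε.le t) hε.le)]
    field_simp
  have hg1 : ∀ r t, |g r t| ≤ 1 := fun r t => by
    rw [abs_of_nonneg (Real.sqrt_nonneg _), Real.sqrt_le_iff, one_pow, div_le_one hε]
    exact ⟨zero_le_one, min_le_right _ _⟩
  have hval : ∀ r, 0 < r → ∀ c : B, extVal τ (cfcₙ (layer r ε) c)
      = ENNReal.ofReal ε * extVal τ (cfcₙ (g r) c * cfcₙ (g r) c) := by
    intro r hr c
    have hs : IsSelfAdjoint (cfcₙ (g r) c * cfcₙ (g r) c) := by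
      have : IsSelfAdjoint (cfcₙ (g r) c) := cfcₙ_predicate _ _
      simpa [this.star_eq] using IsSelfAdjoint.star_mul_self (cfcₙ (g r) c)
    rw [← hτ.extVal_smul_of_mem hs
      (mul_mem_ped_left _ (cfcₙ_mem_ped (hgc r) hr (hg0 r) c)) hε.le,
      ← cfcₙ_mul _ _ c (hgc r).continuousOn (hg0 r 0 hr.le) (hgc r).continuousOn (hg0 r 0 hr.le),
      ← cfcₙ_const_mul ε (fun t => g r t * g r t) c ((hgc r).mul (hgc r)).continuousOn
        (by simp [hg0 r 0 hr.le])]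
    simp only [hgg]
  rw [hval _ (by positivity), hval _ hs]
  gcongr
  refine hτ.extVal_level_le ha (cut_nonneg (s + ε) b) (cfcₙ_predicate _ _)
    (cfcₙ_mem_ped (hgc s) hs (hg0 s) b) ?_ (δ := δ + (s + ε)) (t := δ + s + 2 * ε) (by positivity)
    (by linarith) (hab.trans (leAddConst_cut hb (by positivity))) (hgc _) (hg0 _) (hg1 _)
  rw [cut, ← cfcₙ_mul _ _ b (hgc s).continuousOn (hg0 s 0 hs.le) continuous_max_sub.continuousOn
    (max_sub_zero (by positivity))]
  congr 1
  funext t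
  rcases le_total t (s + ε) with h | h
  · rw [max_eq_right (by linarith), mul_zero]
  · have : layer s ε t = ε := by
      rw [layer, max_eq_left (by linarith), min_eq_right (by linarith)]
    simp [g, this, hε.ne']

/-- Quasitraces respect `a ≤ b + δ` up to a small shift of the spectral levels. -/
theorem IsQuasitrace.extVal_cut_le_cut (hτ : IsQuasitrace τ) {a b : B} (ha : 0 ≤ a) (hb : 0 ≤ b)
    {δ ε : ℝ} (hδ : 0 ≤ δ) (hε : 0 < ε) (hab : LeAddConst a b δ) :
    extVal τ (cut (δ + 3 * ε) a) ≤ extVal τ (cut ε b) := by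
  have key : ∀ n : ℕ, extVal τ (cfcₙ (layer (δ + 3 * ε) (n * ε)) a)
      ≤ extVal τ (cfcₙ (layer ε (n * ε)) b) := by
    have hstep : ∀ (n : ℕ) (r : ℝ), 0 < r → ∀ c : B,
        extVal τ (cfcₙ (layer r ((n + 1 : ℕ) * ε)) c) = extVal τ (cfcₙ (layer r (n * ε)) c)
          + extVal τ (cfcₙ (layer (r + n * ε) ε) c) := by
      intro n r hr c
      have hn : 0 ≤ (n : ℝ) * ε := by positivity
      rw [← hτ.extVal_add_of_mem (cfcₙ_nonneg fun t _ => layer_nonneg hn t)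
        (cfcₙ_nonneg fun t _ => layer_nonneg hε.le t) (cfcₙ_layer_mem_ped hr hn c)
        (cfcₙ_layer_mem_ped (by positivity) hε.le c) (cfcₙ_commute_cfcₙ _ _ _),
        ← cfcₙ_add _ _ c continuous_layer.continuousOn (layer_zero hr.le hn)
          continuous_layer.continuousOn (layer_zero (by positivity) hε.le)]
      have : ∀ t, layer r ((n + 1 : ℕ) * ε) t = layer r (n * ε) t + layer (r + n * ε) ε t := by
        intro t
        rw [← layer_add hn hε.le]
        push_cast
        congr 1; ring
      exact congrArg (fun f => extVal τ (cfcₙ f c)) (funext this)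
    intro n
    induction n with
    | zero =>
      have : ∀ r : ℝ, layer r ((0 : ℕ) * ε) = fun _ => 0 := fun r => by
        funext t; simp [layer]
      rw [this, cfcₙ_const_zero, extVal_zero hτ]
      exact zero_le
    | succ n ih =>
      rw [hstep n _ (by positivity), hstep n _ hε]
      refine add_le_add ih ?_
      have := hτ.extVal_layer_le ha hb hδ hε (s := ε + n * ε) (by positivity) hab
      rwa [show δ + (ε + n * ε) + 2 * ε = δ + 3 * ε + n * ε by ring] at this
  obtain ⟨n, hn⟩ := exists_nat_ge (‖a‖ / ε)
  have hn' : ‖a‖ ≤ n * ε := (div_le_iff₀ hε).1 hn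
  have h1 : cut (δ + 3 * ε) a = cfcₙ (layer (δ + 3 * ε) (n * ε)) a := by
    refine cfcₙ_congr fun t ht => ?_
    have := (le_abs_self _).trans (quasispectrum_le_norm (.of_nonneg ha) ht)
    exact (layer_eq (by positivity) (by positivity) (this.trans hn')).symm
  rw [h1]
  refine (key n).trans (hτ.extVal_mono_of_commute
    (cfcₙ_nonneg fun t _ => layer_nonneg (by positivity) t) ?_
    (cfcₙ_layer_mem_ped hε (by positivity) b) (cut_mem_ped hε b) (cfcₙ_commute_cfcₙ _ _ _))
  exact cfcₙ_mono (fun t _ => layer_le) continuous_layer.continuousOn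
    continuous_max_sub.continuousOn (layer_zero hε.le (by positivity)) (max_sub_zero hε.le)

theorem IsQuasitrace.extVal_cut_le (hτ : IsQuasitrace τ) {a : B} (ha : 0 ≤ a) {ε : ℝ} (hε : 0 < ε) :
    extVal τ (cut ε a) ≤ extVal τ a := by
  by_cases h : a ∈ Ped B
  · refine hτ.extVal_mono_of_commute (cut_nonneg _ _) ?_ (cut_mem_ped hε a) h
      ((Commute.refl a).cfcₙ_real _)
    have hid : cfcₙ (fun t : ℝ => t) a = a := cfcₙ_id' ℝ a (ha := .of_nonneg ha)
    conv_rhs => rw [← hid]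
    refine cfcₙ_mono (fun t ht => ?_) continuous_max_sub.continuousOn continuous_id.continuousOn
      (max_sub_zero hε.le) rfl
    exact max_le (by linarith) (quasispectrum_nonneg' ha ht)
  · conv_rhs => rw [extVal, dif_neg h]
    rw [extVal_of_mem (cut_mem_ped hε a)]
    exact le_iSup (fun ε : Set.Ioi (0 : ℝ) => ENNReal.ofReal (τ ⟨cut (ε : ℝ) a, _⟩).re) ⟨ε, hε⟩

/-- The extended quasitrace is determined by its values on the elements `(a - ε)₊`, also on the
Pedersen ideal. -/
theorem IsQuasitrace.extVal_eq_iSup (hτ : IsQuasitrace τ) {a : B} (ha : 0 ≤ a) :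
    extVal τ a = ⨆ ε : Set.Ioi (0 : ℝ), extVal τ (cut (ε : ℝ) a) := by
  refine le_antisymm ?_ (iSup_le fun ε => hτ.extVal_cut_le ha ε.2)
  by_cases h : a ∈ Ped B
  · have hs := sqrt_mem_ped ha h
    have hfin := extVal_ne_top (τ := τ) hs
    have hid : cfcₙ (fun t : ℝ => t) a = a := cfcₙ_id' ℝ a (ha := .of_nonneg ha)
    -- the part `min(a, ε)` that is cut off is at most `√ε √a`
    have hbound : ∀ ε : ℝ, 0 < ε → extVal τ a ≤ extVal τ (cut ε a)
        + ENNReal.ofReal (√ε) * extVal τ (CFC.sqrt a) := by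
      intro ε hε
      have hm : Continuous fun t : ℝ => min t ε := by fun_prop
      have h1 : a = cut ε a + cfcₙ (fun t => min t ε) a := by
        rw [cut, ← cfcₙ_add _ _ a continuous_max_sub.continuousOn (max_sub_zero hε.le)
          hm.continuousOn (min_eq_left hε.le)]
        conv_lhs => rw [← hid]
        congr 1
        funext t
        rcases le_total t ε with h | h
        · rw [max_eq_right (by linarith), min_eq_left h, zero_add]
        · rw [max_eq_left (by linarith), min_eq_right h]; ring
      have h2 : 0 ≤ cfcₙ (fun t => min t ε) a :=
        cfcₙ_nonneg fun t ht => le_min (quasispectrum_nonneg' ha ht) hε.le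
      have h3 : cfcₙ (fun t => min t ε) a ∈ Ped B := by
        have : cfcₙ (fun t => min t ε) a = a - cut ε a := by
          rw [eq_sub_iff_add_eq', ← h1]
        rw [this]
        exact (Ped B).sub_mem h (cut_mem_ped hε a)
      have hsq : CFC.sqrt a = cfcₙ Real.sqrt a := CFC.sqrt_eq_real_sqrt a ha
      have h4 : √ε • CFC.sqrt a ∈ Ped B := by
        rw [← Complex.coe_smul]; exact (Ped B).smul_mem' _ hs
      calc extVal τ a = extVal τ (cut ε a) + extVal τ (cfcₙ (fun t => min t ε) a) := by
            conv_lhs => rw [h1]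
            exact hτ.extVal_add_of_mem (cut_nonneg _ _) h2 (cut_mem_ped hε a) h3
              (cfcₙ_commute_cfcₙ _ _ _)
        _ ≤ extVal τ (cut ε a) + extVal τ (√ε • CFC.sqrt a) := by
            gcongr
            refine hτ.extVal_mono_of_commute h2 ?_ h3 h4 ?_
            · rw [hsq, ← cfcₙ_const_mul _ _ a Real.continuous_sqrt.continuousOn Real.sqrt_zero]
              refine cfcₙ_mono (fun t ht => ?_) hm.continuousOn
                (continuous_const.mul Real.continuous_sqrt).continuousOn (min_eq_left hε.le)
                (by simp)
              have ht0 := quasispectrum_nonneg' ha ht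
              rw [← Real.sqrt_mul hε.le]
              refine Real.le_sqrt_of_sq_le ?_
              rw [sq]
              exact mul_le_mul (min_le_right _ _) (min_le_left _ _) (le_min ht0 hε.le) hε.le
            · rw [hsq]
              exact (cfcₙ_commute_cfcₙ _ _ _).smul_right _
        _ = _ := by
            rw [hτ.extVal_smul_of_mem (.of_nonneg (CFC.sqrt_nonneg a)) hs (Real.sqrt_nonneg _)]
    have hlim : Tendsto (fun ε : ℝ => (⨆ ε : Set.Ioi (0 : ℝ), extVal τ (cut (ε : ℝ) a))
        + ENNReal.ofReal (√ε) * extVal τ (CFC.sqrt a)) (𝓝[>] 0)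
        (𝓝 ((⨆ ε : Set.Ioi (0 : ℝ), extVal τ (cut (ε : ℝ) a)) + 0)) := by
      refine tendsto_const_nhds.add ?_
      have h1 : Tendsto (fun ε : ℝ => ENNReal.ofReal (√ε)) (𝓝[>] 0) (𝓝 0) := by
        have : Tendsto (fun ε : ℝ => ENNReal.ofReal (√ε)) (𝓝 0) (𝓝 (ENNReal.ofReal (√0))) :=
          (ENNReal.continuous_ofReal.comp Real.continuous_sqrt).tendsto 0
        rw [Real.sqrt_zero, ENNReal.ofReal_zero] at this
        exact this.mono_left nhdsWithin_le_nhds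
      have := ENNReal.Tendsto.mul_const h1 (b := extVal τ (CFC.sqrt a)) (Or.inr hfin)
      rwa [zero_mul] at this
    rw [add_zero] at hlim
    refine ge_of_tendsto hlim ?_
    filter_upwards [self_mem_nhdsWithin] with ε hε
    refine (hbound ε hε).trans ?_
    gcongr
    exact le_iSup (fun ε : Set.Ioi (0 : ℝ) => extVal τ (cut (ε : ℝ) a)) ⟨ε, hε⟩
  · rw [extVal, dif_neg h]
    exact iSup_mono fun ε => (extVal_of_mem (cut_mem_ped ε.2 a)).ge

theorem IsQuasitrace.extVal_mono (hτ : IsQuasitrace τ) {a b : B} (ha : 0 ≤ a) (hab : a ≤ b) :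
    extVal τ a ≤ extVal τ b := by
  have hb : 0 ≤ b := ha.trans hab
  rw [hτ.extVal_eq_iSup ha]
  refine iSup_le fun ⟨ε, hε⟩ => ?_
  have hε' : 0 < ε / 3 := div_pos hε (by norm_num)
  have := hτ.extVal_cut_le_cut ha hb le_rfl hε' (.of_le hab)
  rw [zero_add, mul_div_cancel₀ _ (by norm_num : (3 : ℝ) ≠ 0)] at this
  exact this.trans (hτ.extVal_cut_le hb hε')

/-- Outside the Pedersen ideal, `(x* x - ε)₊` and `(x x* - ε)₊` are of the form `y* y` and `y y*`. -/
theorem IsQuasitrace.extVal_trace (hτ : IsQuasitrace τ) (x : B) :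
    extVal τ (star x * x) = extVal τ (x * star x) := by
  rw [hτ.extVal_eq_iSup (star_mul_self_nonneg x), hτ.extVal_eq_iSup (mul_star_self_nonneg x)]
  refine iSup_congr fun ⟨ε, hε⟩ => ?_
  have hε : 0 < ε := hε
  -- `k(t)² t = (t - ε)₊`
  let k : ℝ → ℝ := fun t => √(max (t - ε) 0 / max t ε)
  have hkc : Continuous k := by
    refine Real.continuous_sqrt.comp (continuous_max_sub.div (by fun_prop) fun t => ?_)
    exact (lt_max_of_lt_right hε).ne'
  have hk0 : ∀ t ≤ ε, k t = 0 := fun t ht => by simp [k, max_eq_right (sub_nonpos.2 ht)]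
  have hk00 := hk0 0 hε.le
  have hkk : ∀ t, k t * k t * t = max (t - ε) 0 := fun t => by
    rcases le_total t ε with ht | ht
    · rw [hk0 t ht, max_eq_right (by linarith)]; ring
    · simp only [k]
      rw [Real.mul_self_sqrt (by positivity), max_eq_left (a := t) ht]
      have : t ≠ 0 := by linarith
      field_simp
  have hks : ∀ a : B, star (cfcₙ k a) = cfcₙ k a := fun a =>
    (cfcₙ_predicate k a : IsSelfAdjoint _).star_eq
  have hcut : ∀ a : B, 0 ≤ a → cut ε a = cfcₙ k a * cfcₙ k a * a := by
    intro a ha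
    have hid : cfcₙ (fun t : ℝ => t) a = a := cfcₙ_id' ℝ a (ha := .of_nonneg ha)
    nth_rewrite 4 [← hid]
    rw [← cfcₙ_mul _ _ a hkc.continuousOn hk00 hkc.continuousOn hk00,
      ← cfcₙ_mul (fun t => k t * k t) (fun t => t) a (hkc.mul hkc).continuousOn (by simp [hk00])
      continuous_id.continuousOn rfl]
    simp only [hkk]
    rfl
  set y := x * cfcₙ k (star x * x) with hy
  have hyP : y ∈ Ped B := mul_mem_ped_left _ (cfcₙ_mem_ped hkc hε hk0 _)
  have h1 : star y * y = cut ε (star x * x) := by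
    rw [hcut _ (star_mul_self_nonneg x), hy, star_mul, hks]
    have hc : Commute (cfcₙ k (star x * x)) (star x * x) := (Commute.refl _).cfcₙ_real _
    rw [mul_assoc (cfcₙ k (star x * x)) (cfcₙ k (star x * x)), hc.eq]
    simp only [mul_assoc]
  have h2 : y * star y = cut ε (x * star x) := by
    rw [hcut _ (mul_star_self_nonneg x), hy, mul_cfcₙ_star_mul_self x k hkc hk00, star_mul, hks]
    have hc : Commute (cfcₙ k (x * star x)) (x * star x) := (Commute.refl _).cfcₙ_real _
    rw [mul_assoc (cfcₙ k (x * star x)) (cfcₙ k (x * star x)), hc.eq]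
    simp only [mul_assoc]
  rw [← h1, ← h2]
  exact hτ.extVal_trace_of_mem hyP

theorem IsQuasitrace.extVal_smul_le (hτ : IsQuasitrace τ) {a : B} (ha : 0 ≤ a) {r : ℝ}
    (hr : 0 ≤ r) : extVal τ (r • a) ≤ ENNReal.ofReal r * extVal τ a := by
  rcases hr.eq_or_lt with rfl | hr
  · rw [zero_smul, extVal_zero hτ]; exact zero_le
  rw [hτ.extVal_eq_iSup (smul_nonneg hr.le ha)]
  refine iSup_le fun ⟨ε, hε⟩ => ?_
  have hε : 0 < ε := hε
  have h1 : cut ε (r • a) = r • cut (ε / r) a := by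
    rw [cut, cut, ← cfcₙ_comp_const_mul r _ a continuous_max_sub.continuousOn
      (max_sub_zero hε.le) (.of_nonneg ha), ← cfcₙ_smul r _ a continuous_max_sub.continuousOn
      (max_sub_zero (by positivity))]
    congr 1
    funext t
    rw [smul_eq_mul, mul_max_of_nonneg _ _ hr.le, mul_zero]
    congr 1
    field_simp
  rw [h1, hτ.extVal_smul_of_mem (.of_nonneg (cut_nonneg _ _)) (cut_mem_ped (by positivity) a) hr.le]
  gcongr
  exact hτ.extVal_cut_le ha (by positivity)

/-- Additivity holds on the commuting elements `(c - η)₊` and `(d - η)₊` of the Pedersen ideal, and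
`c + d` exceeds their sum by at most `2 η`. -/
theorem IsQuasitrace.extVal_add_le_of_commute (hτ : IsQuasitrace τ) {c d : B} (hc : 0 ≤ c)
    (hd : 0 ≤ d) (hcd : Commute c d) : extVal τ (c + d) ≤ extVal τ c + extVal τ d := by
  rw [hτ.extVal_eq_iSup (add_nonneg hc hd)]
  refine iSup_le fun ⟨ε, hε⟩ => ?_
  have hη : 0 < ε / 5 := div_pos hε (by norm_num)
  have h1 := hτ.extVal_cut_le_cut (add_nonneg hc hd)
    (add_nonneg (cut_nonneg (ε / 5) c) (cut_nonneg (ε / 5) d)) (add_nonneg hη.le hη.le) hη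
    ((leAddConst_cut hc hη.le).add (leAddConst_cut hd hη.le))
  have h2 : ε / 5 + ε / 5 + 3 * (ε / 5) = ε := by ring
  rw [h2] at h1
  refine h1.trans ((hτ.extVal_cut_le (add_nonneg (cut_nonneg _ c) (cut_nonneg _ d)) hη).trans ?_)
  have h3 : Commute (cut (ε / 5) c) (cut (ε / 5) d) :=
    ((hcd.cfcₙ_real _).symm.cfcₙ_real _).symm
  rw [hτ.extVal_add_of_mem (cut_nonneg _ _) (cut_nonneg _ _) (cut_mem_ped hη c) (cut_mem_ped hη d)
    h3]
  exact add_le_add (hτ.extVal_cut_le hc hη) (hτ.extVal_cut_le hd hη)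

end QuasitraceOrder

/-! ### Matrix units and stability of `A ⊗ 𝕂` -/

section MatrixUnits

variable {A : Type u} [NonUnitalCStarAlgebra A]

namespace FinMat

/-- The matrix with the single entry `a`, in position `(i, j)`. -/
def unit (i j : ℕ) (a : A) : FinMat A :=
  ⟨fun k l => if k = i ∧ l = j then a else 0, max i j + 1, fun k l h => if_neg (by omega)⟩

theorem unit_add (i j : ℕ) (a b : A) : unit i j (a + b) = unit i j a + unit i j b :=
  ext_entries fun k l => by
    change (if _ then _ else _) = (if _ then _ else _) + (if _ then _ else _)
    split_ifs <;> simp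

theorem unit_smul (i j : ℕ) (c : ℂ) (a : A) : unit i j (c • a) = c • unit i j a :=
  ext_entries fun k l => by
    change (if _ then _ else _) = c • (if _ then _ else _)
    split_ifs <;> simp

theorem star_unit (i j : ℕ) (a : A) : star (unit i j a) = unit j i (star a) :=
  ext_entries fun k l => by
    change star (if l = i ∧ k = j then a else 0) = if k = j ∧ l = i then star a else 0
    by_cases h : l = i ∧ k = j
    · rw [if_pos h, if_pos h.symm]
    · rw [if_neg h, if_neg (fun h' => h h'.symm), star_zero]

theorem unit_mul (i j : ℕ) (a : A) (f : FinMat A) (k l : ℕ) :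
    (unit i j a * f).1 k l = if k = i then a * f.1 j l else 0 := by
  change (∑ᶠ m, (if k = i ∧ m = j then a else 0) * f.1 m l) = _
  rw [finsum_eq_single _ j fun m hm => by rw [if_neg (fun h => hm h.2), zero_mul]]
  by_cases h : k = i <;> simp [h]

theorem unit_mul_unit (i j k l : ℕ) (a b : A) :
    unit i j a * unit k l b = if j = k then unit i l (a * b) else 0 :=
  ext_entries fun m n => by
    rw [unit_mul]
    change (if m = i then a * (if j = k ∧ n = l then b else 0) else 0) = _
    by_cases hj : j = k
    · simp only [hj, true_and, if_true]
      change _ = if m = i ∧ n = l then a * b else 0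
      by_cases hm : m = i <;> by_cases hn : n = l <;> simp [hm, hn]
    · simp only [hj, false_and, if_false, mul_zero, ite_self]
      rfl

theorem sum_apply {ι : Type*} (s : Finset ι) (F : ι → FinMat A) (k l : ℕ) :
    (∑ i ∈ s, F i).1 k l = ∑ i ∈ s, (F i).1 k l := by
  classical
  induction s using Finset.induction_on with
  | empty => rfl
  | insert a s ha ih =>
    rw [Finset.sum_insert ha, Finset.sum_insert ha, ← ih]
    rfl

theorem eq_sum_unit {n : ℕ} {f : FinMat A} (hf : f.Supp n) :
    f = ∑ i : Fin n, ∑ j : Fin n, unit i j (f.1 i j) := by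
  refine ext_entries fun k l => ?_
  simp only [sum_apply]
  change _ = ∑ i : Fin n, ∑ j : Fin n, if k = i ∧ l = j then f.1 i j else 0
  by_cases h : k < n ∧ l < n
  · rw [Finset.sum_eq_single (⟨k, h.1⟩ : Fin n), Finset.sum_eq_single (⟨l, h.2⟩ : Fin n)]
    · simp
    · intro j _ hj
      exact if_neg fun h' => hj (Fin.ext h'.2.symm)
    · simp
    · intro i _ hi
      exact Finset.sum_eq_zero fun j _ => if_neg fun h' => hi (Fin.ext h'.1.symm)
    · simp
  · rw [hf k l (by omega)]
    refine (Finset.sum_eq_zero fun i _ => Finset.sum_eq_zero fun j _ => if_neg fun h' => h ?_).symm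
    exact ⟨h'.1 ▸ i.2, h'.2 ▸ j.2⟩

/-- The isometry that moves row `m` of a matrix to row `2 m + k`, for `k < 2`. -/
def spread (k : ℕ) (f : FinMat A) : FinMat A :=
  ⟨fun i j => if i % 2 = k then f.1 (i / 2) j else 0, by
    obtain ⟨n, hn⟩ := f.2
    refine ⟨2 * n + 2, fun i j h => ?_⟩
    change (if i % 2 = k then f.1 (i / 2) j else 0) = 0
    split_ifs
    · exact hn _ _ (by omega)
    · rfl⟩

theorem star_spread_mul_spread {k : ℕ} (hk : k < 2) (f g : FinMat A) :
    star (spread k f) * spread k g = star f * g := by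
  refine ext_entries fun i j => ?_
  let F : ℕ → A := fun r => star (if r % 2 = k then f.1 (r / 2) i else 0) *
    (if r % 2 = k then g.1 (r / 2) j else 0)
  change (∑ᶠ r, F r) = ∑ᶠ m, star (f.1 m i) * g.1 m j
  have hinj : Function.Injective fun m : ℕ => 2 * m + k := fun a b h => by
    simp only at h; omega
  have h1 : (∑ᶠ r, F r) = ∑ᶠ r ∈ Set.range fun m : ℕ => 2 * m + k, F r := by
    rw [finsum_mem_def, Set.indicator_eq_self.2]
    intro r hr
    by_contra hr'
    refine hr ?_
    have : r % 2 ≠ k := fun h => hr' ⟨r / 2, by simp only; omega⟩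
    simp [F, this]
  rw [h1, finsum_mem_range hinj]
  refine finsum_congr fun m => ?_
  have h2 : (2 * m + k) % 2 = k := by omega
  have h3 : (2 * m + k) / 2 = m := by omega
  simp [F, h2, h3]

theorem star_spread_mul_spread_of_ne {k l : ℕ} (hkl : k ≠ l) (f g : FinMat A) :
    star (spread k f) * spread l g = 0 := by
  refine ext_entries fun i j => finsum_eq_zero_of_forall_eq_zero fun r => ?_
  change star (if r % 2 = k then f.1 (r / 2) i else 0) *
    (if r % 2 = l then g.1 (r / 2) j else 0) = 0
  by_cases h : r % 2 = k
  · rw [if_neg (fun h' => hkl (h.symm.trans h')), mul_zero]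
  · rw [if_neg h, star_zero, zero_mul]

/-- The linear isometry underlying `spread`. -/
def spreadₗ (k : ℕ) (hk : k < 2) : FinMat A →ₗᵢ[ℂ] FinMat A where
  toFun := spread k
  map_add' f g := ext_entries fun i j => by
    change (if _ then _ else _) = (if _ then _ else _) + (if _ then _ else _)
    split_ifs
    · rfl
    · simp
  map_smul' c f := ext_entries fun i j => by
    change (if _ then _ else _) = c • (if _ then _ else _)
    split_ifs
    · rfl
    · simp
  norm_map' f := by
    change ‖spread k f‖ = ‖f‖
    have : ‖spread k f‖ * ‖spread k f‖ = ‖f‖ * ‖f‖ := by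
      rw [← CStarRing.norm_star_mul_self, ← CStarRing.norm_star_mul_self,
        star_spread_mul_spread hk]
    exact (mul_self_inj (norm_nonneg _) (norm_nonneg _)).1 this

end FinMat

namespace Stabilization

noncomputable instance instPartialOrder : PartialOrder (Stabilization A) :=
  CStarAlgebra.spectralOrder _

instance instStarOrderedRing : StarOrderedRing (Stabilization A) :=
  CStarAlgebra.spectralOrderedRing _

/-- The isometry `spread` on the completion. -/
noncomputable def spreadExt (k : ℕ) (hk : k < 2) : Stabilization A → Stabilization A :=
  isDenseInducing_incl.extend fun f : FinMat A => incl (FinMat.spreadₗ k hk f)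

@[fun_prop]
theorem continuous_spreadExt (k : ℕ) (hk : k < 2) : Continuous (spreadExt (A := A) k hk) := by
  have hu : UniformContinuous fun f : FinMat A => incl (FinMat.spreadₗ k hk f) :=
    incl.isometry.uniformContinuous.comp (FinMat.spreadₗ k hk).isometry.uniformContinuous
  exact (uniformContinuous_uniformly_extend incl.isometry.isUniformInducing denseRange_incl
    hu).continuous

theorem spreadExt_incl (k : ℕ) (hk : k < 2) (f : FinMat A) :
    spreadExt k hk (incl f) = incl (FinMat.spread k f) :=
  isDenseInducing_incl.extend_eq
    (incl.continuous.comp (FinMat.spreadₗ k hk).isometry.continuous) f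

theorem star_spreadExt_mul_self (k : ℕ) (hk : k < 2) (x y : Stabilization A) :
    star (spreadExt k hk x) * spreadExt k hk y = star x * y := by
  refine denseRange_incl.induction_on₂
    (p := fun x y : Stabilization A => star (spreadExt k hk x) * spreadExt k hk y = star x * y)
    (isClosed_eq (by fun_prop) (by fun_prop)) (fun f g => ?_) x y
  rw [spreadExt_incl, spreadExt_incl, ← incl_star, ← incl_mul, FinMat.star_spread_mul_spread hk,
    incl_mul, incl_star]

theorem star_spreadExt_mul (x y : Stabilization A) :
    star (spreadExt 0 (by norm_num) x) * spreadExt 1 (by norm_num) y = 0 := by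
  refine denseRange_incl.induction_on₂
    (p := fun x y : Stabilization A =>
      star (spreadExt 0 (by norm_num) x) * spreadExt 1 (by norm_num) y = 0)
    (isClosed_eq (by fun_prop) (by fun_prop)) (fun f g => ?_) x y
  rw [spreadExt_incl, spreadExt_incl, ← incl_star, ← incl_mul,
    FinMat.star_spread_mul_spread_of_ne (by norm_num), map_zero]

/-- By stability, any two positive elements are `x* x` and `y* y` with orthogonal ranges. -/
theorem exists_orthogonal_factors {a b : Stabilization A} (ha : 0 ≤ a) (hb : 0 ≤ b) :
    ∃ x y : Stabilization A, star x * x = a ∧ star y * y = b ∧ star x * y = 0 := by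
  refine ⟨spreadExt 0 (by norm_num) (CFC.sqrt a), spreadExt 1 (by norm_num) (CFC.sqrt b), ?_, ?_,
    star_spreadExt_mul _ _⟩
  · rw [star_spreadExt_mul_self, (IsSelfAdjoint.of_nonneg (CFC.sqrt_nonneg a)).star_eq,
      CFC.sqrt_mul_sqrt_self a ha]
  · rw [star_spreadExt_mul_self, (IsSelfAdjoint.of_nonneg (CFC.sqrt_nonneg b)).star_eq,
      CFC.sqrt_mul_sqrt_self b hb]

/-- The embedding `a ↦ a ⊗ eᵢⱼ`. -/
noncomputable def matUnit (i j : ℕ) : A →ₗ[ℂ] Stabilization A where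
  toFun a := incl (FinMat.unit i j a)
  map_add' a b := by rw [FinMat.unit_add, map_add]
  map_smul' c a := by rw [FinMat.unit_smul, map_smul, RingHom.id_apply]

theorem matUnit_apply (i j : ℕ) (a : A) : matUnit i j a = incl (FinMat.unit i j a) := rfl

theorem matUnit_mul (i j l : ℕ) (a b : A) :
    matUnit i j a * matUnit j l b = matUnit i l (a * b) := by
  simp only [matUnit_apply]
  rw [← incl_mul, FinMat.unit_mul_unit, if_pos rfl]

theorem matUnit_mul_of_ne (i : ℕ) {j k : ℕ} (hjk : j ≠ k) (l : ℕ) (a b : A) :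
    matUnit i j a * matUnit k l b = 0 := by
  simp only [matUnit_apply]
  rw [← incl_mul, FinMat.unit_mul_unit, if_neg hjk, map_zero]

theorem star_matUnit (i j : ℕ) (a : A) : star (matUnit i j a) = matUnit j i (star a) := by
  simp only [matUnit_apply]
  rw [← incl_star, FinMat.star_unit]

theorem matUnit_injective (i j : ℕ) : Function.Injective (matUnit (A := A) i j) := by
  intro a b h
  have h1 := incl.injective h
  have h2 := congrArg (fun f : FinMat A => f.1 i j) h1
  simpa [FinMat.unit] using h2

/-- The diagonal embeddings are *-homomorphisms. -/
noncomputable def diagHom (i : ℕ) : A →⋆ₙₐ[ℂ] Stabilization A where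
  toFun := matUnit i i
  map_smul' c a := map_smul _ c a
  map_zero' := map_zero _
  map_add' a b := map_add _ a b
  map_mul' a b := (matUnit_mul i i i a b).symm
  map_star' a := (star_matUnit i i a).symm

theorem diagHom_apply (i : ℕ) (a : A) : diagHom i a = matUnit i i a := rfl

theorem norm_matUnit (i j : ℕ) (a : A) : ‖matUnit i j a‖ = ‖a‖ := by
  have h1 : ‖matUnit i j a‖ * ‖matUnit i j a‖ = ‖a‖ * ‖a‖ := by
    rw [← CStarRing.norm_star_mul_self, star_matUnit, matUnit_mul, ← diagHom_apply,
      NonUnitalStarAlgHom.norm_map (diagHom j) (matUnit_injective j j),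
      CStarRing.norm_star_mul_self]
  exact (mul_self_inj (norm_nonneg _) (norm_nonneg _)).1 h1

theorem norm_e11 (a : A) : ‖e11 a‖ = ‖a‖ := norm_matUnit 0 0 a

theorem continuous_diagHom (i : ℕ) : Continuous (diagHom (A := A) i) :=
  (NonUnitalStarAlgHom.isometry (diagHom i) (matUnit_injective i i)).continuous

/-- The embedding of `A` commutes with functional calculus. -/
theorem e11_cfcₙ {f : ℝ → ℝ} (hf : Continuous f) (hf0 : f 0 = 0) {a : A} (ha : IsSelfAdjoint a) :
    e11 (cfcₙ f a) = cfcₙ f (e11 a) := by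
  have h1 : IsSelfAdjoint (diagHom 0 a) := ha.map (diagHom 0)
  exact NonUnitalStarAlgHom.map_cfcₙ (S := ℂ) (diagHom (A := A) 0) f a hf.continuousOn hf0
    (continuous_diagHom 0) ha h1

end Stabilization

end MatrixUnits

/-! ### The trace norm -/

section TraceNorm

variable {A : Type u} [NonUnitalCStarAlgebra A]

namespace QTilde

variable (τ : QTilde A)

theorem val_eq_extVal (a : Stabilization A) : τ.val a = extVal τ.1 a := rfl

theorem val_ne_top {a : Stabilization A} (h : a ∈ Ped (Stabilization A)) : τ.val a ≠ ∞ :=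
  extVal_ne_top h

theorem val_mono {a b : Stabilization A} (ha : 0 ≤ a) (hab : a ≤ b) : τ.val a ≤ τ.val b :=
  τ.2.1.extVal_mono ha hab

theorem val_trace (x : Stabilization A) : τ.val (star x * x) = τ.val (x * star x) :=
  τ.2.1.extVal_trace x

theorem val_smul_le {a : Stabilization A} (ha : 0 ≤ a) {r : ℝ} (hr : 0 ≤ r) :
    τ.val (r • a) ≤ ENNReal.ofReal r * τ.val a :=
  τ.2.1.extVal_smul_le ha hr

/-- Subadditivity up to a constant. Stability moves the two elements to orthogonal ones, on which
the quasitrace is additive. -/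
theorem val_add_le {a b : Stabilization A} (ha : 0 ≤ a) (hb : 0 ≤ b) :
    τ.val (a + b) ≤ 2 * (τ.val a + τ.val b) := by
  obtain ⟨x, y, rfl, rfl, hxy⟩ := Stabilization.exists_orthogonal_factors ha hb
  have hyx : star y * x = 0 := by simpa using congrArg star hxy
  have h1 : star (x + y) * (x + y) = star x * x + star y * y := by
    simp only [star_add, mul_add, add_mul, hxy, hyx]; abel
  have h2 : (x + y) * star (x + y) ≤ (2 : ℝ) • (x * star x + y * star y) := by
    have : (x + y) * star (x + y) =
        (2 : ℝ) • (x * star x + y * star y) - (x - y) * star (x - y) := by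
      simp only [star_add, star_sub, add_mul, mul_add, sub_mul, mul_sub, two_smul]; abel
    rw [this]
    exact sub_le_self _ (mul_star_self_nonneg _)
  have hc : Commute (x * star x) (y * star y) := by
    change x * star x * (y * star y) = y * star y * (x * star x)
    rw [mul_assoc, ← mul_assoc (star x), hxy, zero_mul, mul_zero, mul_assoc, ← mul_assoc (star y),
      hyx, zero_mul, mul_zero]
  calc τ.val (star x * x + star y * y) = τ.val ((x + y) * star (x + y)) := by
        rw [← h1, val_trace]
    _ ≤ τ.val ((2 : ℝ) • (x * star x + y * star y)) :=
        τ.val_mono (mul_star_self_nonneg _) h2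
    _ ≤ ENNReal.ofReal 2 * τ.val (x * star x + y * star y) :=
        τ.val_smul_le (add_nonneg (mul_star_self_nonneg _) (mul_star_self_nonneg _)) zero_le_two
    _ ≤ 2 * (τ.val (x * star x) + τ.val (y * star y)) := by
        rw [ENNReal.ofReal_ofNat]
        gcongr
        exact τ.2.1.extVal_add_le_of_commute (mul_star_self_nonneg _) (mul_star_self_nonneg _) hc
    _ = 2 * (τ.val (star x * x) + τ.val (star y * y)) := by rw [val_trace, val_trace]

/-- The value on `(x + y)* (x + y)`. -/
theorem val_star_mul_self_add_le (x y : Stabilization A) :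
    τ.val (star (x + y) * (x + y)) ≤ 4 * (τ.val (star x * x) + τ.val (star y * y)) := by
  have h0 : (0 : Stabilization A) ≤ star x * x + star y * y :=
    add_nonneg (star_mul_self_nonneg _) (star_mul_self_nonneg _)
  have h2 : star (x + y) * (x + y) ≤ (2 : ℝ) • (star x * x + star y * y) := by
    have : star (x + y) * (x + y) =
        (2 : ℝ) • (star x * x + star y * y) - star (x - y) * (x - y) := by
      simp only [star_add, star_sub, add_mul, mul_add, sub_mul, mul_sub, two_smul]; abel
    rw [this]
    exact sub_le_self _ (star_mul_self_nonneg _)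
  calc τ.val (star (x + y) * (x + y)) ≤ τ.val ((2 : ℝ) • (star x * x + star y * y)) :=
        τ.val_mono (star_mul_self_nonneg _) h2
    _ ≤ ENNReal.ofReal 2 * τ.val (star x * x + star y * y) := τ.val_smul_le h0 zero_le_two
    _ ≤ 2 * (2 * (τ.val (star x * x) + τ.val (star y * y))) := by
        rw [ENNReal.ofReal_ofNat]
        gcongr
        exact τ.val_add_le (star_mul_self_nonneg _) (star_mul_self_nonneg _)
    _ = _ := by rw [← mul_assoc]; norm_num

end QTilde

theorem val_le_norm2_sq {τ : QTilde A} (hτ : τ ∈ closure (QT A)) (x : Stabilization A) :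
    τ.val (star x * x) ≤ norm2 x ^ 2 := by
  have h : τ.val (star x * x) ^ (1 / 2 : ℝ) ≤ norm2 x :=
    le_iSup₂ (f := fun (τ : QTilde A) (_ : τ ∈ closure (QT A)) =>
      τ.val (star x * x) ^ (1 / 2 : ℝ)) τ hτ
  rw [one_div, ENNReal.rpow_inv_le_iff zero_lt_two] at h
  exact_mod_cast h

theorem norm2_le {x : Stabilization A} {C : ℝ≥0∞}
    (h : ∀ τ ∈ closure (QT A), τ.val (star x * x) ≤ C ^ 2) : norm2 x ≤ C := by
  refine iSup₂_le fun τ hτ => ?_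
  rw [one_div, ENNReal.rpow_inv_le_iff zero_lt_two]
  exact_mod_cast h τ hτ

@[simp]
theorem norm2_star (x : Stabilization A) : norm2 (star x) = norm2 x := by
  unfold norm2
  simp only [star_star, QTilde.val_trace]

theorem norm2_mul_le_left (b x : Stabilization A) :
    norm2 (b * x) ≤ ENNReal.ofReal ‖b‖ * norm2 x := by
  refine norm2_le fun τ hτ => ?_
  have h1 : star (b * x) * (b * x) ≤ (‖b‖ * ‖b‖) • (star x * x) := by
    have := CStarAlgebra.star_left_conjugate_le_norm_smul (a := x) (b := star b * b)
    rw [CStarRing.norm_star_mul_self] at this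
    simpa [mul_assoc] using this
  calc τ.val (star (b * x) * (b * x)) ≤ τ.val ((‖b‖ * ‖b‖) • (star x * x)) :=
        τ.val_mono (star_mul_self_nonneg _) h1
    _ ≤ ENNReal.ofReal (‖b‖ * ‖b‖) * τ.val (star x * x) :=
        τ.val_smul_le (star_mul_self_nonneg _) (by positivity)
    _ ≤ ENNReal.ofReal (‖b‖ * ‖b‖) * norm2 x ^ 2 := by gcongr; exact val_le_norm2_sq hτ x
    _ = (ENNReal.ofReal ‖b‖ * norm2 x) ^ 2 := by
        rw [ENNReal.ofReal_mul (norm_nonneg _)]; ring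

theorem norm2_mul_le_right (x b : Stabilization A) :
    norm2 (x * b) ≤ ENNReal.ofReal ‖b‖ * norm2 x := by
  rw [← norm2_star, star_mul]
  refine (norm2_mul_le_left _ _).trans_eq ?_
  rw [norm_star, norm2_star]

theorem norm2_add_le (x y : Stabilization A) : norm2 (x + y) ≤ 2 * (norm2 x + norm2 y) := by
  refine norm2_le fun τ hτ => (τ.val_star_mul_self_add_le x y).trans ?_
  calc 4 * (τ.val (star x * x) + τ.val (star y * y)) ≤ 4 * (norm2 x ^ 2 + norm2 y ^ 2) := by
        gcongr <;> exact val_le_norm2_sq hτ _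
    _ ≤ 4 * (norm2 x ^ 2 + norm2 y ^ 2 + 2 * norm2 x * norm2 y) := by
        refine mul_le_mul_right le_self_add _
    _ = (2 * (norm2 x + norm2 y)) ^ 2 := by ring

@[simp]
theorem norm2_zero : norm2 (0 : Stabilization A) = 0 :=
  le_antisymm (norm2_le fun τ _ => by
    rw [mul_zero, QTilde.val_eq_extVal, extVal_zero τ.2.1]; exact zero_le) zero_le

theorem norm2_smul_le (c : ℂ) (x : Stabilization A) :
    norm2 (c • x) ≤ ENNReal.ofReal ‖c‖ * norm2 x := by
  refine norm2_le fun τ hτ => ?_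
  have h1 : star (c • x) * (c • x) = (‖c‖ * ‖c‖) • (star x * x) := by
    rw [star_smul, smul_mul_smul_comm, ← Complex.coe_smul]
    congr 1
    rw [Complex.star_def, mul_comm, Complex.mul_conj, Complex.normSq_eq_norm_sq]
    push_cast; ring
  rw [h1]
  calc _ ≤ ENNReal.ofReal (‖c‖ * ‖c‖) * τ.val (star x * x) :=
        τ.val_smul_le (star_mul_self_nonneg _) (by positivity)
    _ ≤ ENNReal.ofReal (‖c‖ * ‖c‖) * norm2 x ^ 2 := by gcongr; exact val_le_norm2_sq hτ x
    _ = (ENNReal.ofReal ‖c‖ * norm2 x) ^ 2 := by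
        rw [ENNReal.ofReal_mul (norm_nonneg _)]; ring

@[simp]
theorem norm2_neg (x : Stabilization A) : norm2 (-x) = norm2 x := by
  unfold norm2; simp

theorem norm2_sub_le (x y : Stabilization A) : norm2 (x - y) ≤ 2 * (norm2 x + norm2 y) := by
  rw [sub_eq_add_neg, ← norm2_neg y]; exact norm2_add_le _ _

end TraceNorm

/-! ### The corner `A` of `A ⊗ 𝕂` -/

section Corner

variable {A : Type u} [NonUnitalCStarAlgebra A]

open Stabilization

theorem e11_mul (a b : A) : e11 (a * b) = e11 a * e11 b := (matUnit_mul 0 0 0 a b).symm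

theorem star_e11 (a : A) : star (e11 a) = e11 (star a) := star_matUnit 0 0 a

theorem e11_nonneg [PartialOrder A] [StarOrderedRing A] {a : A} (ha : 0 ≤ a) :
    0 ≤ e11 a := by
  obtain ⟨b, rfl⟩ := CStarAlgebra.nonneg_iff_eq_star_mul_self.1 ha
  rw [e11_mul, ← star_e11]
  exact star_mul_self_nonneg _

theorem e11_cut {ε : ℝ} (hε : 0 ≤ ε) {a : A} (ha : IsSelfAdjoint a) :
    e11 (cut ε a) = cut ε (e11 a) :=
  e11_cfcₙ continuous_max_sub (max_sub_zero hε) ha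

/-- A dense ideal of `A ⊗ 𝕂` meets the corner `A` in a dense ideal, since it contains all elements
of the corner that have a local unit. -/
theorem e11_mem_ped {a : A} (ha : a ∈ Ped A) : e11 a ∈ Ped (Stabilization A) := by
  let _ : PartialOrder A := CStarAlgebra.spectralOrder A
  have _ : StarOrderedRing A := CStarAlgebra.spectralOrderedRing A
  intro I hI hd
  refine ha (I.comap (matUnit 0 0)) (fun b x hx => ?_) ?_
  · change e11 x ∈ I at hx
    change e11 (b * x) ∈ I ∧ e11 (x * b) ∈ I
    rw [e11_mul, e11_mul]
    exact hI _ _ hx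
  · rw [Metric.dense_iff]
    intro b r hr
    have hε : 0 < r ^ 2 / 8 := by positivity
    refine ⟨b * cfcₙ (fn (r ^ 2 / 8)) (star b * b), ?_, ?_⟩
    · rw [Metric.mem_ball, dist_eq_norm]
      refine (norm_mul_fn_sub_le (star_mul_self_nonneg b) le_rfl hε).trans_lt ?_
      rw [Real.sqrt_lt' hr]
      nlinarith
    · change e11 _ ∈ I
      rw [e11_mul]
      refine (hI _ _ (mem_of_local_unit (c := e11 (cfcₙ (fn (r ^ 2 / 8 / 2)) (star b * b)))
        hI hd ?_)).1
      have h1 : Commute (cfcₙ (fn (r ^ 2 / 8)) (star b * b))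
          (cfcₙ (fn (r ^ 2 / 8 / 2)) (star b * b)) := cfcₙ_commute_cfcₙ _ _ _
      rw [← e11_mul, h1.eq, cfcₙ_fn_half_mul hε]

variable [PartialOrder A] [StarOrderedRing A]

/-- The normalization of `QT(A)` bounds the values on `A`, and the bound passes to the closure, which
is taken pointwise on the Pedersen ideal. -/
theorem val_e11_le_of_mem {τ : QTilde A} (hτ : τ ∈ closure (QT A)) {a : A} (ha : 0 ≤ a)
    (h : a ∈ Ped A) : τ.val (e11 a) ≤ ENNReal.ofReal ‖a‖ := by
  have hP := e11_mem_ped h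
  have key : ∀ τ ∈ QT A, τ.val (e11 a) ≤ ENNReal.ofReal ‖a‖ := by
    intro τ hτ
    rcases eq_or_ne a 0 with rfl | h0
    · have : e11 (0 : A) = 0 := map_zero (matUnit 0 0)
      rw [this, QTilde.val_eq_extVal, extVal_zero τ.2.1]; exact zero_le
    have hn : 0 < ‖a‖ := norm_pos_iff.2 h0
    have h1 : τ.val (e11 (‖a‖⁻¹ • a)) ≤ 1 := by
      rw [← show τ.normOn = 1 from hτ]
      refine le_iSup₂ (f := fun (a : A) (_ : a ∈ {a : A | a ∈ Ped A ∧ IsPos a ∧ ‖a‖ ≤ 1}) =>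
        τ.val (e11 a)) _ ⟨?_, ?_, ?_⟩
      · rw [← Complex.coe_smul]; exact (Ped A).smul_mem _ h
      · exact CStarAlgebra.nonneg_iff_eq_star_mul_self.1 (smul_nonneg (by positivity) ha)
      · rw [norm_smul, norm_inv, norm_norm, inv_mul_cancel₀ hn.ne']
    have h2 : e11 a = ‖a‖ • e11 (‖a‖⁻¹ • a) := by
      have : e11 (‖a‖⁻¹ • a) = ‖a‖⁻¹ • e11 a := by
        simp only [← Complex.coe_smul]; exact map_smul (matUnit 0 0) _ _
      rw [this, smul_smul, mul_inv_cancel₀ hn.ne', one_smul]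
    rw [h2]
    calc _ ≤ ENNReal.ofReal ‖a‖ * τ.val (e11 (‖a‖⁻¹ • a)) :=
          τ.val_smul_le (e11_nonneg (smul_nonneg (by positivity) ha)) (norm_nonneg _)
      _ ≤ ENNReal.ofReal ‖a‖ := mul_le_of_le_one_right zero_le h1
  have hcl : IsClosed {τ : QTilde A | (τ.1 ⟨e11 a, hP⟩).re ≤ ‖a‖} :=
    isClosed_le (Complex.continuous_re.comp ((continuous_apply _).comp continuous_subtype_val))
      continuous_const
  have h3 := closure_minimal (fun τ hτ => ?_) hcl hτ
  · rw [QTilde.val_eq_extVal, extVal_of_mem hP]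
    exact ENNReal.ofReal_le_ofReal h3
  · have h4 := key τ hτ
    rw [QTilde.val_eq_extVal, extVal_of_mem hP] at h4
    exact (ENNReal.ofReal_le_ofReal_iff (norm_nonneg _)).1 h4

theorem val_e11_le {τ : QTilde A} (hτ : τ ∈ closure (QT A)) {a : A} (ha : 0 ≤ a) :
    τ.val (e11 a) ≤ ENNReal.ofReal ‖a‖ := by
  rw [QTilde.val_eq_extVal, τ.2.1.extVal_eq_iSup (e11_nonneg ha)]
  refine iSup_le fun ⟨ε, hε⟩ => ?_
  have hε : 0 < ε := hε
  rw [← QTilde.val_eq_extVal, ← e11_cut hε.le (.of_nonneg ha)]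
  refine (val_e11_le_of_mem hτ (cut_nonneg _ _) (cut_mem_ped hε a)).trans
    (ENNReal.ofReal_le_ofReal ?_)
  refine norm_cfcₙ_le fun t ht => ?_
  have h1 := quasispectrum_nonneg' ha ht
  have h2 := quasispectrum_le_norm (.of_nonneg ha) ht
  rw [abs_of_nonneg h1] at h2
  rw [Real.norm_of_nonneg (le_max_right _ _)]
  exact max_le (by linarith) (norm_nonneg _)

end Corner

/-! ### The trace norm of finite matrices -/

section MatrixEntries

variable {A : Type u} [NonUnitalCStarAlgebra A]

open Stabilization

theorem norm2_e11_le (x : A) : norm2 (e11 x) ≤ ENNReal.ofReal ‖x‖ := by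
  let _ : PartialOrder A := CStarAlgebra.spectralOrder A
  have _ : StarOrderedRing A := CStarAlgebra.spectralOrderedRing A
  refine norm2_le fun τ hτ => ?_
  rw [star_e11, ← e11_mul]
  refine (val_e11_le hτ (star_mul_self_nonneg x)).trans_eq ?_
  rw [CStarRing.norm_star_mul_self, ENNReal.ofReal_mul (norm_nonneg _), sq]

theorem norm2_matUnit (i j : ℕ) (x : A) : norm2 (matUnit i j x) = norm2 (e11 x) := by
  let _ : PartialOrder A := CStarAlgebra.spectralOrder A
  have _ : StarOrderedRing A := CStarAlgebra.spectralOrderedRing A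
  have key : ∀ τ : QTilde A, τ.val (star (matUnit i j x) * matUnit i j x)
      = τ.val (star (e11 x) * e11 x) := by
    intro τ
    have hs : star (CFC.sqrt (star x * x)) = CFC.sqrt (star x * x) :=
      (IsSelfAdjoint.of_nonneg (CFC.sqrt_nonneg _)).star_eq
    have hss := CFC.sqrt_mul_sqrt_self (star x * x) (star_mul_self_nonneg x)
    have h := τ.val_trace (matUnit 0 j (CFC.sqrt (star x * x)))
    rw [star_matUnit, matUnit_mul, matUnit_mul, hs, hss] at h
    rw [star_matUnit, matUnit_mul, h, star_e11, ← e11_mul]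
    rfl
  unfold norm2
  simp only [key]

variable (A) in
/-- The elements of finite trace norm form a two-sided ideal. -/
def finiteNorm2 : Submodule ℂ (Stabilization A) where
  carrier := {x | norm2 x < ∞}
  zero_mem' := by simp
  add_mem' hx hy := (norm2_add_le _ _).trans_lt
    (ENNReal.mul_lt_top ENNReal.ofNat_lt_top (ENNReal.add_lt_top.2 ⟨hx, hy⟩))
  smul_mem' c x hx := (norm2_smul_le c x).trans_lt (ENNReal.mul_lt_top ENNReal.ofReal_lt_top hx)

/-- The finite matrices have finite trace norm, so that the ideal of elements of finite trace norm is
dense and contains the Pedersen ideal. -/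
theorem norm2_lt_top {b : Stabilization A} (hb : b ∈ Ped (Stabilization A)) : norm2 b < ∞ := by
  refine hb (finiteNorm2 A) (fun a x hx => ?_) ?_
  · exact ⟨(norm2_mul_le_left a x).trans_lt (ENNReal.mul_lt_top ENNReal.ofReal_lt_top hx),
      (norm2_mul_le_right x a).trans_lt (ENNReal.mul_lt_top ENNReal.ofReal_lt_top hx)⟩
  · refine denseRange_incl.mono ?_
    rintro _ ⟨f, rfl⟩
    obtain ⟨n, hn⟩ := f.eventually_supp.exists
    rw [FinMat.eq_sum_unit hn, map_sum]
    refine sum_mem fun i _ => ?_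
    rw [map_sum]
    refine sum_mem fun j _ => ?_
    change norm2 (matUnit i j (f.1 i j)) < ∞
    rw [norm2_matUnit]
    exact (norm2_e11_le _).trans_lt ENNReal.ofReal_lt_top

end MatrixEntries

/-! ### Lifting and functional calculus along homomorphisms -/

section StarHom

/-- An injective *-homomorphism of C*-algebras reflects positivity. -/
theorem nonneg_of_map_nonneg {A B : Type*} [NonUnitalCStarAlgebra A] [NonUnitalCStarAlgebra B]
    [PartialOrder A] [StarOrderedRing A] [PartialOrder B] [StarOrderedRing B]
    (φ : A →⋆ₙₐ[ℂ] B) (hφ : Function.Injective φ) {a : A} (h : 0 ≤ φ a) : 0 ≤ a := by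
  have hs : IsSelfAdjoint a := hφ (by rw [map_star]; exact IsSelfAdjoint.of_nonneg h)
  have hc : Continuous fun r : ℝ => max (-r) 0 := by fun_prop
  have h1 : φ (cfcₙ (fun r : ℝ => max (-r) 0) a) = cfcₙ (fun r : ℝ => max (-r) 0) (φ a) :=
    NonUnitalStarAlgHom.map_cfcₙ (S := ℂ) φ _ a hc.continuousOn (by simp)
      (NonUnitalStarAlgHom.isometry φ hφ).continuous hs (hs.map φ)
  have h2 : cfcₙ (fun r : ℝ => max (-r) 0) (φ a) = 0 := by
    rw [← cfcₙ_zero ℝ (φ a)]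
    refine cfcₙ_congr fun r hr => ?_
    have := quasispectrum_nonneg' h hr
    simpa using this
  have h3 : cfcₙ (fun r : ℝ => max (-r) 0) a = 0 := hφ (by rw [h1, h2, map_zero])
  have h4 : a = cfcₙ (fun r : ℝ => max r 0) a := by
    conv_lhs => rw [← cfcₙ_id' ℝ a, ← sub_zero (cfcₙ (fun r : ℝ => r) a), ← neg_zero, ← h3]
    rw [sub_neg_eq_add, ← cfcₙ_add (fun r : ℝ => r) _ a continuous_id.continuousOn rfl
      hc.continuousOn (by simp)]
    congr 1
    funext r
    rcases le_total r 0 with h | h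
    · rw [max_eq_left (by linarith), max_eq_right h]; ring
    · rw [max_eq_right (by linarith), max_eq_left h]; ring
  rw [h4]
  exact cfcₙ_nonneg fun _ _ => le_max_right _ _

/-- The quotient map as a *-homomorphism. -/
noncomputable def ClosedStarIdeal.Quotient.mkHom {A : Type u} [NonUnitalCStarAlgebra A]
    (I : ClosedStarIdeal A) : A →⋆ₙₐ[ℂ] I.Quotient where
  toFun := mk I
  map_smul' c a := map_smul _ c a
  map_zero' := map_zero _
  map_add' a b := map_add _ a b
  map_mul' _ _ := rfl
  map_star' _ := rfl

theorem ClosedStarIdeal.Quotient.mkHom_surjective {A : Type u} [NonUnitalCStarAlgebra A]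
    (I : ClosedStarIdeal A) : Function.Surjective (mkHom I) := mk_surjective I

theorem ClosedStarIdeal.Quotient.mkHom_eq_zero {A : Type u} [NonUnitalCStarAlgebra A]
    (I : ClosedStarIdeal A) {x : A} : mkHom I x = 0 ↔ x ∈ I.carrier := mk_eq_zero I

/-- Functional calculus in `C`, described by its images under *-homomorphisms. -/
theorem exists_map_eq_cfcₙ {C : Type u} [NonUnitalCStarAlgebra C] {f : ℝ → ℝ} (hf : Continuous f)
    (hf0 : f 0 = 0) {x : C} (hx : IsSelfAdjoint x) :
    ∃ y : C, IsSelfAdjoint y ∧ ∀ (D : Type u) [NonUnitalCStarAlgebra D] (φ : C →⋆ₙₐ[ℂ] D),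
      φ y = cfcₙ f (φ x) :=
  ⟨cfcₙ f x, cfcₙ_predicate f x, fun D _ φ =>
    NonUnitalStarAlgHom.map_cfcₙ (S := ℂ) φ f x hf.continuousOn hf0
      (AddMonoidHomClass.continuous_of_bound φ 1 fun x => by
        rw [one_mul]; exact NonUnitalStarAlgHom.norm_apply_le φ x) hx (hx.map φ)⟩

theorem exists_isSelfAdjoint_lift {A B : Type*} [NonUnitalCStarAlgebra A] [NonUnitalCStarAlgebra B]
    (φ : A →⋆ₙₐ[ℂ] B) (hφ : Function.Surjective φ) {b : B} (hb : IsSelfAdjoint b) :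
    ∃ a, IsSelfAdjoint a ∧ φ a = b := by
  obtain ⟨a, rfl⟩ := hφ b
  refine ⟨(2⁻¹ : ℂ) • (a + star a), ?_, ?_⟩
  · rw [IsSelfAdjoint, star_smul, star_add, star_star, add_comm (star a)]
    congr 1
    simp
  · rw [map_smul, map_add, map_star, hb.star_eq, ← two_smul ℂ, smul_smul]
    norm_num

end StarHom

/-! ### Bounded sequences -/

section BoundedSequences

variable {A : Type u} [NonUnitalCStarAlgebra A]

namespace LInfty

/-- A bounded sequence as an element of `l^∞(A)`. -/
def ofBounded (x : ℕ → A) (C : ℝ) (h : ∀ n, ‖x n‖ ≤ C) : LInfty A :=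
  ⟨x, memℓp_infty ⟨C, by rintro _ ⟨n, rfl⟩; exact h n⟩⟩

theorem norm_apply_le (x : LInfty A) (n : ℕ) : ‖x n‖ ≤ ‖x‖ :=
  lp.norm_apply_le_norm ENNReal.top_ne_zero x n

/-- Evaluation at an index. -/
def eval (n : ℕ) : LInfty A →⋆ₙₐ[ℂ] A where
  toFun x := x n
  map_smul' _ _ := rfl
  map_zero' := rfl
  map_add' _ _ := rfl
  map_mul' _ _ := rfl
  map_star' _ := rfl

theorem mul_apply (x y : LInfty A) (n : ℕ) : (x * y) n = x n * y n := rfl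
theorem star_apply (x : LInfty A) (n : ℕ) : (star x) n = star (x n) := rfl
theorem add_apply (x y : LInfty A) (n : ℕ) : (x + y) n = x n + y n := rfl

theorem isSelfAdjoint_apply {x : LInfty A} (hx : IsSelfAdjoint x) (n : ℕ) :
    IsSelfAdjoint (x n) := hx.map (eval n)

end LInfty

end BoundedSequences

/-! ### Real rank zero from range projections -/

section Invertibles

/-- If `p` is a projection onto the positive part of `x - t`, then `x - t + δ (2 p - 1)` is
invertible, because its product with the symmetry `2 p - 1` is `|x - t| + δ`. -/
theorem isUnit_add_smul_of_projection {U : Type*} [CStarAlgebra U] {x p : U} {t : ℝ}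
    (hx : IsSelfAdjoint x) (hp : IsSelfAdjoint p) (hpp : p * p = p)
    (h : p * (x - (t : ℂ) • 1) = cfc (fun r : ℝ => max (r - t) 0) x) {δ : ℝ} (hδ : 0 < δ) :
    IsUnit (x - (t : ℂ) • 1 + (δ : ℂ) • ((2 : ℂ) • p - 1)) := by
  let _ : PartialOrder U := CStarAlgebra.spectralOrder _
  have _ : StarOrderedRing U := CStarAlgebra.spectralOrderedRing _
  set v : U := cfc (fun r : ℝ => max (r - t) 0) x with hv
  have hvs : IsSelfAdjoint v := cfc_predicate _ x
  have h2 : (x - (t : ℂ) • 1) * p = v := by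
    have := congrArg star h
    rwa [star_mul, hp.star_eq, hvs.star_eq, star_sub, hx.star_eq, star_smul, star_one,
      Complex.star_def, Complex.conj_ofReal] at this
  have hN : (0 : U) ≤ (2 : ℂ) • v - (x - (t : ℂ) • 1) := by
    have hc : Continuous fun r : ℝ => max (r - t) 0 := continuous_max_sub
    have hd : Continuous fun r : ℝ => r - t := by fun_prop
    have h3 : (2 : ℂ) • v - (x - (t : ℂ) • 1) =
        cfc (fun r : ℝ => (max (r - t) 0 + max (r - t) 0) - (r - t)) x := by
      rw [cfc_sub (fun r : ℝ => max (r - t) 0 + max (r - t) 0) (fun r => r - t) x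
          (hc.add hc).continuousOn hd.continuousOn,
        cfc_add (a := x) (fun r : ℝ => max (r - t) 0) (fun r : ℝ => max (r - t) 0)
          hc.continuousOn hc.continuousOn, ← hv,
        cfc_sub (fun r : ℝ => r) (fun _ => t) x continuous_id.continuousOn continuousOn_const,
        cfc_id' ℝ x, cfc_const t x, two_smul, Algebra.algebraMap_eq_smul_one,
        ← Complex.coe_smul]
    rw [h3]
    refine cfc_nonneg fun r _ => ?_
    rcases le_total r t with h | h
    · rw [max_eq_right (by linarith)]; linarith
    · rw [max_eq_left (by linarith)]; linarith
  set w : U := (2 : ℂ) • p - 1 with hw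
  have hww : w * w = 1 := by
    simp only [hw, sub_mul, mul_sub, smul_mul_smul_comm, hpp, mul_one, one_mul]
    module
  have h4 : (x - (t : ℂ) • 1 + (δ : ℂ) • w) * w
      = ((2 : ℂ) • v - (x - (t : ℂ) • 1)) + algebraMap ℝ U δ := by
    rw [add_mul, smul_mul_assoc, hww, hw, mul_sub, mul_smul_comm, h2, mul_one,
      Algebra.algebraMap_eq_smul_one, ← Complex.coe_smul]
  have h5 : IsUnit ((x - (t : ℂ) • 1 + (δ : ℂ) • w) * w) := by
    rw [h4]
    refine CStarAlgebra.isUnit_of_le (algebraMap ℝ U δ) (le_add_of_nonneg_left hN) ?_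
    rw [Algebra.algebraMap_eq_smul_one]
    exact IsStrictlyPositive.smul hδ isStrictlyPositive_one
  have h6 : IsUnit w := ⟨⟨w, w, hww, hww⟩, rfl⟩
  have h7 := h5.mul h6
  rwa [mul_assoc, hww, mul_one] at h7

/-- Real rank zero is a statement on the elements `x - t` with `t ≥ 0`, and follows if the positive
part of each of them is a corner of it by a projection. -/
theorem realRankZero_of_projections {Q : Type u} [NonUnitalCStarAlgebra Q]
    (h : ∀ x : Q, IsSelfAdjoint x → ∀ t : ℝ, 0 ≤ t →
      ∃ p : Q, IsSelfAdjoint p ∧ p * p = p ∧ p * x - (t : ℂ) • p = cut t x) :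
    RealRankZero Q := by
  have key : ∀ x : Q, IsSelfAdjoint x → ∀ t : ℝ, 0 ≤ t →
      (x : Unitization ℂ Q) - (t : ℂ) • 1 ∈
        closure {y : Unitization ℂ Q | IsSelfAdjoint y ∧ IsUnit y} := by
    intro x hx t ht
    obtain ⟨p, hp, hpp, hpx⟩ := h x hx t ht
    have hlim : Tendsto (fun δ : ℝ => (x : Unitization ℂ Q) - (t : ℂ) • 1 +
        (δ : ℂ) • ((2 : ℂ) • (p : Unitization ℂ Q) - 1)) (𝓝[>] 0)
        (𝓝 ((x : Unitization ℂ Q) - (t : ℂ) • 1)) := by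
      have hc : Continuous fun δ : ℝ => (x : Unitization ℂ Q) - (t : ℂ) • 1 +
        (δ : ℂ) • ((2 : ℂ) • (p : Unitization ℂ Q) - 1) := by fun_prop
      have := hc.tendsto 0
      simp only [Complex.ofReal_zero, zero_smul, add_zero] at this
      exact this.mono_left nhdsWithin_le_nhds
    refine mem_closure_of_tendsto hlim ?_
    filter_upwards [self_mem_nhdsWithin] with δ hδ
    have hXs : star (x : Unitization ℂ Q) = x :=
      hx.map (Unitization.inrNonUnitalStarAlgHom ℂ Q)
    have hPs : star (p : Unitization ℂ Q) = p :=
      hp.map (Unitization.inrNonUnitalStarAlgHom ℂ Q)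
    refine ⟨?_, isUnit_add_smul_of_projection hXs hPs ?_ ?_ hδ⟩
    rotate_left
    · rw [← Unitization.inr_mul, hpp]
    · rw [← Unitization.real_cfcₙ_eq_cfc_inr x (fun r : ℝ => max (r - t) 0) (max_sub_zero ht)]
      change _ = ((cut t x : Q) : Unitization ℂ Q)
      rw [mul_sub, mul_smul_comm, mul_one, ← hpx, Unitization.inr_sub,
        Unitization.inr_mul, Unitization.inr_smul]
    rw [IsSelfAdjoint, star_add, star_sub, star_smul, star_smul, star_sub, star_smul, star_one,
      hXs, hPs]
    simp
  have hneg : ∀ y : Unitization ℂ Q,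
      -y ∈ closure {y : Unitization ℂ Q | IsSelfAdjoint y ∧ IsUnit y} →
      y ∈ closure {y : Unitization ℂ Q | IsSelfAdjoint y ∧ IsUnit y} := by
    intro y hy
    have := map_mem_closure continuous_neg hy
      (t := {y : Unitization ℂ Q | IsSelfAdjoint y ∧ IsUnit y}) fun z hz => ⟨hz.1.neg, hz.2.neg⟩
    rwa [neg_neg] at this
  have hdec : ∀ y : Unitization ℂ Q, y = (y.snd : Unitization ℂ Q) + y.fst • 1 := by
    intro y
    ext <;> simp
  intro y hy
  have hys : IsSelfAdjoint y.snd := congrArg (fun z : Unitization ℂ Q => z.snd) hy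
  have hyf : ((y.fst.re : ℝ) : ℂ) = y.fst :=
    Complex.conj_eq_iff_re.1 (congrArg (fun z : Unitization ℂ Q => z.fst) hy)
  rcases le_total y.fst.re 0 with h0 | h0
  · have := key y.snd hys (-y.fst.re) (by linarith)
    rwa [Complex.ofReal_neg, neg_smul, sub_neg_eq_add, hyf, ← hdec y] at this
  · refine hneg y ?_
    have := key (-y.snd) hys.neg y.fst.re h0
    rw [hyf] at this
    rw [hdec y]
    convert this using 1
    rw [Unitization.inr_neg]
    abel

end Invertibles

/-! ### Hereditary subalgebras of the corner -/

section HereditaryCorner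

variable {A : Type u} [NonUnitalCStarAlgebra A]

open Stabilization

theorem e11_add (a b : A) : e11 (a + b) = e11 a + e11 b := map_add (matUnit 0 0) a b

theorem e11_sub (a b : A) : e11 (a - b) = e11 a - e11 b := map_sub (matUnit 0 0) a b

theorem e11_real_smul (r : ℝ) (a : A) : e11 (r • a) = r • e11 a := by
  simp only [← Complex.coe_smul]
  exact map_smul (matUnit 0 0) _ a

theorem e11_mono [PartialOrder A] [StarOrderedRing A] {a b : A} (h : a ≤ b) : e11 a ≤ e11 b := by
  rw [← sub_nonneg, ← e11_sub]
  exact e11_nonneg (sub_nonneg.2 h)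

theorem e11_mul_incl_mul_e11 (a b : A) (f : FinMat A) :
    e11 a * incl f * e11 b = e11 (a * f.1 0 0 * b) := by
  have h : FinMat.unit 0 0 a * f * FinMat.unit 0 0 b = FinMat.unit 0 0 (a * f.1 0 0 * b) := by
    refine FinMat.ext_entries fun k l => ?_
    change (∑ᶠ m, (FinMat.unit 0 0 a * f).1 k m * (if m = 0 ∧ l = 0 then b else 0))
      = if k = 0 ∧ l = 0 then a * f.1 0 0 * b else 0
    rw [finsum_eq_single _ 0 fun m hm => by rw [if_neg (fun h => hm h.1), mul_zero],
      FinMat.unit_mul]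
    by_cases hk : k = 0 <;> by_cases hl : l = 0 <;> simp [hk, hl]
  change incl (FinMat.unit 0 0 a) * incl f * incl (FinMat.unit 0 0 b) = _
  rw [← incl_mul, ← incl_mul, h]
  rfl

/-- A hereditary subalgebra generated by an element `a` of the corner lies in the corner, and
relations `a x - t a = a v` pass to its elements. -/
theorem exists_e11_eq_of_mem_her {a x v : A} {t : ℂ} (h : a * x - t • a = a * v)
    {c : Stabilization A} (hc : c ∈ Her (e11 a)) :
    ∃ c' : A, e11 c' = c ∧ c' * x - t • c' = c' * v := by
  have hiso : Isometry (e11 (A := A)) :=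
    AddMonoidHomClass.isometry_of_norm (matUnit 0 0) fun a => norm_matUnit 0 0 a
  let S : Set A := {z | z * x - t • z = z * v}
  have hS : IsClosed (e11 '' S) :=
    hiso.isClosedEmbedding.isClosedMap _ (isClosed_eq (by fun_prop) (by fun_prop))
  have hsub : (Set.range fun y : Stabilization A => e11 a * y * e11 a) ⊆ e11 '' S := by
    rintro _ ⟨y, rfl⟩
    refine denseRange_incl.induction_on (p := fun y => e11 a * y * e11 a ∈ e11 '' S) y
      (hS.preimage (by fun_prop)) fun f => ?_
    refine ⟨a * f.1 0 0 * a, ?_, (e11_mul_incl_mul_e11 a a f).symm⟩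
    change a * f.1 0 0 * a * x - t • (a * f.1 0 0 * a) = a * f.1 0 0 * a * v
    rw [mul_assoc _ a x, mul_assoc _ a v, ← h, mul_sub, mul_smul_comm]
  obtain ⟨z, hz, rfl⟩ := closure_minimal hsub hS hc
  exact ⟨z, rfl, hz⟩

end HereditaryCorner

/-! ### Almost projections from small oscillation -/

section AlmostProjection

variable {A : Type u} [NonUnitalCStarAlgebra A]

open Stabilization

theorem fn_anti {ε δ t : ℝ} (hε : 0 < ε) (hεδ : ε ≤ δ) : fn δ t ≤ fn ε t := by
  rcases le_total t δ with h | h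
  · rw [fn_eq_zero (hε.trans_le hεδ) h]; exact fn_nonneg _ _
  · have h1 : (t - δ) / δ ≤ (t - ε) / ε := by
      have hδ := hε.trans_le hεδ
      rw [div_le_div_iff₀ hδ hε]
      nlinarith
    exact max_le_max le_rfl (min_le_min le_rfl h1)

theorem dimFun_sub_le {τ : QTilde A} (c : Stabilization A) {k m : ℕ} (h : k ≤ m) :
    dimFun τ c - τ.val (cfcₙ (fn (1 / (m + 1))) c)
      ≤ dimFun τ c - τ.val (cfcₙ (fn (1 / (k + 1))) c) := by
  refine tsub_le_tsub_left (τ.val_mono (cfcₙ_nonneg fun t _ => fn_nonneg _ t) ?_) _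
  refine cfcₙ_mono (fun t _ => fn_anti (by positivity) ?_) continuous_fn.continuousOn
    continuous_fn.continuousOn (hf0 := fn_zero (by positivity)) (hg0 := fn_zero (by positivity))
  gcongr

/-- The increment of the spectral ramps between `1 / (k + 1)` and `1 / (2 (k + 1))` has trace at
most the oscillation at the first of them. -/
theorem val_fn_sub_fn_le {τ : QTilde A} (c : Stabilization A) (k : ℕ) :
    τ.val (cfcₙ (fn (1 / (k + 1) / 2)) c - cfcₙ (fn (1 / (k + 1))) c)
      ≤ dimFun τ c - τ.val (cfcₙ (fn (1 / (k + 1))) c) := by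
  have hk : (0 : ℝ) < 1 / (k + 1) := by positivity
  have hp := fn_mem_ped hk c
  have hf := fn_mem_ped (half_pos hk) c
  have h0 : 0 ≤ cfcₙ (fn (1 / (k + 1) / 2)) c - cfcₙ (fn (1 / (k + 1))) c :=
    sub_nonneg.2 (cfcₙ_mono (fun t _ => fn_anti (half_pos hk) (by linarith))
      continuous_fn.continuousOn continuous_fn.continuousOn
      (hf0 := fn_zero hk) (hg0 := fn_zero (half_pos hk)))
  have hadd := τ.2.1.extVal_add_of_mem h0
    (cfcₙ_nonneg (a := c) fun t _ => fn_nonneg (1 / (k + 1)) t)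
    ((Ped _).sub_mem hf hp) hp
    ((cfcₙ_commute_cfcₙ _ _ c).sub_left (Commute.refl _))
  rw [sub_add_cancel] at hadd
  have h1 : τ.val (cfcₙ (fn (1 / (k + 1) / 2)) c) ≤ dimFun τ c := by
    have h2 := le_iSup (fun n : ℕ => τ.val (cfcₙ (fn (1 / (n + 1))) c)) (2 * k + 1)
    have h3 : (1 : ℝ) / ((2 * k + 1 : ℕ) + 1) = 1 / (k + 1) / 2 := by
      push_cast; field_simp; ring
    simp only [h3] at h2
    exact h2
  refine ENNReal.le_sub_of_add_le_right (τ.val_ne_top hp) ?_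
  rw [QTilde.val_eq_extVal, QTilde.val_eq_extVal, ← hadd]
  exact h1

/-- If `c` has small tracial oscillation, then a spectral ramp `p` of `c` is close to a projection
that is a unit for `c`, in the trace norm. -/
theorem exists_fn_almost_projection [PartialOrder A] [StarOrderedRing A] {c : A} (hc : 0 ≤ c)
    {M ε : ℝ} (hM : ‖c‖ ≤ M) (hε : 0 < ε) (hω : tracialOsc (e11 c) < ENNReal.ofReal ε) :
    ∃ η : ℝ, 0 < η ∧
      norm2 (e11 (cfcₙ (fn η) c * cfcₙ (fn η) c - cfcₙ (fn η) c)) ≤ ENNReal.ofReal √ε ∧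
      norm2 (e11 (c - cfcₙ (fn η) c * c)) ≤ ENNReal.ofReal √(2 * (M ^ 2 * ε + ε ^ 2)) := by
  obtain ⟨k₀, hk₀⟩ := iInf_lt_iff.1 hω
  obtain ⟨k₁, hk₁⟩ := exists_nat_one_div_lt hε
  set k := max k₀ k₁
  have hosc : ∀ τ ∈ closure (QT A),
      dimFun τ (e11 c) - τ.val (cfcₙ (fn (1 / (k + 1))) (e11 c)) ≤ ENNReal.ofReal ε := by
    intro τ hτ
    exact (dimFun_sub_le _ (le_max_left k₀ k₁)).trans
      ((le_iSup₂ (f := fun (τ : QTilde A) (_ : τ ∈ closure (QT A)) =>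
        dimFun τ (e11 c) - τ.val (cfcₙ (fn (1 / (k₀ + 1))) (e11 c))) τ hτ).trans hk₀.le)
  have hη : (0 : ℝ) < 1 / (k + 1) := by positivity
  have hηε : (1 : ℝ) / (k + 1) ≤ ε := by
    refine le_trans ?_ hk₁.le
    have : (k₁ : ℝ) ≤ k := by exact_mod_cast le_max_right k₀ k₁
    gcongr
  set η : ℝ := 1 / (k + 1)
  have hM0 : 0 ≤ M := (norm_nonneg c).trans hM
  have hcs : IsSelfAdjoint c := .of_nonneg hc
  have hF : Continuous (fn (η / 2)) := continuous_fn
  have hp : Continuous (fn η) := continuous_fn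
  have hF0 := fn_zero (half_pos hη)
  have hp0 := fn_zero hη
  -- `D` is the increment of the ramps, moved into the corner
  set D : A := cfcₙ (fun t => fn (η / 2) t - fn η t) c with hD
  have hDc : Continuous fun t => fn (η / 2) t - fn η t := hF.sub hp
  have hD0 : fn (η / 2) 0 - fn η 0 = 0 := by rw [hF0, hp0, sub_zero]
  have hDpos : 0 ≤ D :=
    cfcₙ_nonneg fun t _ => sub_nonneg.2 (fn_anti (half_pos hη) (by linarith))
  have hDval : ∀ τ ∈ closure (QT A), τ.val (e11 D) ≤ ENNReal.ofReal ε := by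
    intro τ hτ
    have : e11 D = cfcₙ (fn (η / 2)) (e11 c) - cfcₙ (fn η) (e11 c) := by
      rw [hD, e11_cfcₙ hDc hD0 hcs, cfcₙ_sub _ _ _ hF.continuousOn hF0 hp.continuousOn hp0]
    rw [this]
    exact (val_fn_sub_fn_le _ k).trans (hosc τ hτ)
  have hid : cfcₙ (fun t : ℝ => t) c = c := cfcₙ_id' ℝ c
  refine ⟨η, hη, norm2_le fun τ hτ => ?_, norm2_le fun τ hτ => ?_⟩
  · have h1 : cfcₙ (fn η) c * cfcₙ (fn η) c - cfcₙ (fn η) c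
        = cfcₙ (fun t => fn η t * fn η t - fn η t) c := by
      rw [cfcₙ_sub (fun t => fn η t * fn η t) _ _ (hp.mul hp).continuousOn (by simp [hp0])
        hp.continuousOn hp0, cfcₙ_mul _ _ _ hp.continuousOn hp0 hp.continuousOn hp0]
    have hc1 : Continuous fun t => fn η t * fn η t - fn η t := (hp.mul hp).sub hp
    rw [h1, star_e11, ← e11_mul, (IsSelfAdjoint.cfcₙ (a := c)).star_eq,
      ← cfcₙ_mul _ _ c hc1.continuousOn (by simp [hp0]) hc1.continuousOn (by simp [hp0]),
      ← ENNReal.ofReal_pow (Real.sqrt_nonneg _), Real.sq_sqrt hε.le]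
    refine le_trans (τ.val_mono (e11_nonneg (cfcₙ_nonneg fun t _ => mul_self_nonneg _)) ?_)
      (hDval τ hτ)
    refine e11_mono (cfcₙ_mono (fun t _ => ?_) (hc1.mul hc1).continuousOn hDc.continuousOn
      (by simp [hp0]) hD0)
    have a1 := fn_nonneg η t
    have a2 := fn_le_one η t
    rcases le_total t η with h | h
    · simp [fn_eq_zero hη h, fn_nonneg]
    · rw [fn_eq_one (half_pos hη) (by linarith)]
      nlinarith [mul_nonneg a1 (sub_nonneg.2 a2), mul_nonneg (mul_nonneg a1 a1) (sub_nonneg.2 a2),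
        mul_nonneg (mul_nonneg (mul_nonneg a1 a1) a1) (sub_nonneg.2 a2)]
  · have h1 : c - cfcₙ (fn η) c * c = cfcₙ (fun t => t - fn η t * t) c := by
      rw [cfcₙ_sub (fun t => t) (fun t => fn η t * t) c continuous_id.continuousOn rfl
        (hp.mul continuous_id).continuousOn (by simp),
        cfcₙ_mul (fn η) (fun t => t) c hp.continuousOn hp0 continuous_id.continuousOn rfl, hid]
    have hc1 : Continuous fun t : ℝ => t - fn η t * t := continuous_id.sub (hp.mul continuous_id)
    have hm : Continuous fun t : ℝ => min |t| η * min |t| η := by fun_prop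
    have hm0 : min |(0 : ℝ)| η * min |(0 : ℝ)| η = 0 := by simp [hη.le]
    have hDm : Continuous fun t => M ^ 2 • (fn (η / 2) t - fn η t) := by
      exact continuous_const.mul hDc
    set R : A := cfcₙ (fun t : ℝ => min |t| η * min |t| η) c with hR
    have hRpos : 0 ≤ R := cfcₙ_nonneg fun t _ => mul_self_nonneg _
    have hRn : ‖R‖ ≤ ε ^ 2 := by
      refine norm_cfcₙ_le fun t _ => ?_
      rw [Real.norm_of_nonneg (mul_self_nonneg _), sq]
      have : min |t| η ≤ ε := (min_le_right _ _).trans hηε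
      have : 0 ≤ min |t| η := le_min (abs_nonneg _) hη.le
      gcongr
    have hle : cfcₙ (fun t : ℝ => (t - fn η t * t) * (t - fn η t * t)) c ≤ M ^ 2 • D + R := by
      rw [hD, hR, ← cfcₙ_smul (M ^ 2) (fun t => fn (η / 2) t - fn η t) c hDc.continuousOn hD0,
        ← cfcₙ_add (a := c) (fun t => M ^ 2 • (fn (η / 2) t - fn η t)) _
          hDm.continuousOn (by simp [hD0]) hm.continuousOn hm0]
      refine cfcₙ_mono (fun t ht => ?_) (hc1.mul hc1).continuousOn
        (hDm.add hm).continuousOn (by simp) (by simp [hF0, hp0, hη.le])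
      have b1 := quasispectrum_nonneg' hc ht
      have b2 := quasispectrum_le_norm hcs ht
      rw [abs_of_nonneg b1] at b2 ⊢
      have b3 := b2.trans hM
      have a1 := fn_nonneg η t
      have a2 := fn_le_one η t
      simp only [smul_eq_mul]
      rcases le_total t η with h | h
      · rw [fn_eq_zero hη h, min_eq_left h]
        have := fn_nonneg (η / 2) t
        have : 0 ≤ M ^ 2 * (fn (η / 2) t - 0) := by rw [sub_zero]; positivity
        nlinarith
      · rw [fn_eq_one (half_pos hη) (by linarith), min_eq_right h]
        have c1 : t ^ 2 ≤ M ^ 2 := by nlinarith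
        have c2 : (1 - fn η t) ^ 2 ≤ 1 - fn η t := by nlinarith
        have c3 : t ^ 2 * (1 - fn η t) ^ 2 ≤ M ^ 2 * (1 - fn η t) :=
          mul_le_mul c1 c2 (sq_nonneg _) (sq_nonneg _)
        nlinarith
    rw [h1, star_e11, ← e11_mul, (IsSelfAdjoint.cfcₙ (a := c)).star_eq,
      ← cfcₙ_mul _ _ c hc1.continuousOn (by simp) hc1.continuousOn (by simp),
      ← ENNReal.ofReal_pow (Real.sqrt_nonneg _), Real.sq_sqrt (by positivity)]
    have hle' : e11 (cfcₙ (fun t : ℝ => (t - fn η t * t) * (t - fn η t * t)) c)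
        ≤ M ^ 2 • e11 D + e11 R := by
      rw [← e11_real_smul, ← e11_add]
      exact e11_mono hle
    calc _ ≤ τ.val (M ^ 2 • e11 D + e11 R) :=
          τ.val_mono (e11_nonneg (cfcₙ_nonneg fun t _ => mul_self_nonneg _)) hle'
      _ ≤ 2 * (τ.val (M ^ 2 • e11 D) + τ.val (e11 R)) :=
          τ.val_add_le (smul_nonneg (sq_nonneg M) (e11_nonneg hDpos)) (e11_nonneg hRpos)
      _ ≤ 2 * (ENNReal.ofReal (M ^ 2) * ENNReal.ofReal ε + ENNReal.ofReal (ε ^ 2)) := by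
          gcongr
          · exact (τ.val_smul_le (e11_nonneg hDpos) (sq_nonneg M)).trans
              (mul_le_mul_right (hDval τ hτ) _)
          · exact (val_e11_le hτ hRpos).trans (ENNReal.ofReal_le_ofReal hRn)
      _ = ENNReal.ofReal (2 * (M ^ 2 * ε + ε ^ 2)) := by
          rw [ENNReal.ofReal_mul zero_le_two, ENNReal.ofReal_add (by positivity) (by positivity),
            ENNReal.ofReal_mul (sq_nonneg M), ENNReal.ofReal_ofNat]

end AlmostProjection

/-! ### Real rank zero of the sequence algebra -/

section RealRankZero

variable {A : Type u} [NonUnitalCStarAlgebra A]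

open Stabilization ClosedStarIdeal

theorem mkHom_eq_zero_of_tendsto {x : LInfty A}
    (h : Tendsto (fun n => norm2 (e11 (x n))) atTop (𝓝 0)) :
    Quotient.mkHom (ClosedStarIdeal.span (JSet A)) x = 0 :=
  (Quotient.mkHom_eq_zero _).2 fun _ hI => hI h

theorem cut_norm_le {x : A} (hx : IsSelfAdjoint x) {t : ℝ} (ht : 0 ≤ t) : ‖cut t x‖ ≤ ‖x‖ := by
  refine norm_cfcₙ_le fun r hr => ?_
  have := (le_abs_self r).trans (quasispectrum_le_norm hx hr)
  rw [Real.norm_of_nonneg (le_max_right _ _)]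
  exact max_le (by linarith) (norm_nonneg _)

/-- Approximate range projections for `(x - t)₊`, in the trace norm. -/
theorem exists_approx_range_projection [PartialOrder A] [StarOrderedRing A]
    (h : ∀ a : A, a ∈ Ped A → IsPos a → HasTAOZ (e11 a)) {x : A} (hx : IsSelfAdjoint x) {t : ℝ}
    (ht : 0 ≤ t) {M : ℝ} (hM : ‖x‖ ≤ M) {ε : ℝ} (hε : 0 < ε) :
    ∃ c p : A, norm2 (e11 (cut t x - c)) ≤ ENNReal.ofReal (4 * ε) ∧
      IsSelfAdjoint p ∧ ‖p‖ ≤ 1 ∧ p * x - (t : ℂ) • p = p * cut t x ∧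
      norm2 (e11 (p * p - p)) ≤ ENNReal.ofReal √ε ∧
      norm2 (e11 (c - p * c)) ≤ ENNReal.ofReal √(2 * (M ^ 2 * ε + ε ^ 2)) := by
  have htε : 0 ≤ t + ε := by linarith
  set a : A := cut (t + ε) x with ha
  obtain ⟨c, hc, hcpos, hca, hcn, hω⟩ := h a (cut_mem_ped (by linarith) _)
    (CStarAlgebra.nonneg_iff_eq_star_mul_self.1 (cut_nonneg _ _)) ε hε
  have hcomm : ∀ f : ℝ → ℝ, Continuous f → f 0 = 0 →
      a * cfcₙ f x = cfcₙ (fun r => max (r - (t + ε)) 0 * f r) x := fun f hf hf0 =>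
    (cfcₙ_mul _ f x continuous_max_sub.continuousOn (max_sub_zero htε) hf.continuousOn
      hf0).symm
  have hrel : a * x - (t : ℂ) • a = a * cut t x := by
    have h1 := hcomm (fun r => r) continuous_id rfl
    rw [cfcₙ_id' ℝ x] at h1
    rw [cut, hcomm _ continuous_max_sub (max_sub_zero ht), h1, Complex.coe_smul, ha, cut,
      ← cfcₙ_smul t _ x continuous_max_sub.continuousOn (max_sub_zero htε),
      ← cfcₙ_sub (fun r => max (r - (t + ε)) 0 * r) (fun r => t • max (r - (t + ε)) 0) x
        (by fun_prop) (by simp) (by fun_prop) (by rw [max_sub_zero htε, smul_zero])]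
    congr 1
    funext r
    rcases le_total r (t + ε) with h | h
    · simp [max_eq_right (sub_nonpos.2 h)]
    · rw [max_eq_left (a := r - t) (by linarith), smul_eq_mul]; ring
  obtain ⟨c', rfl, hc'⟩ := exists_e11_eq_of_mem_her hrel hc
  have hc0 : 0 ≤ c' := nonneg_of_map_nonneg (diagHom 0) (matUnit_injective 0 0)
    (isPos_iff_nonneg.1 hcpos)
  have hc'n : ‖c'‖ ≤ M := by
    rw [norm_e11, norm_e11] at hcn
    exact hcn.trans ((cut_norm_le hx htε).trans (hM))
  obtain ⟨η, hη, hp1, hp2⟩ := exists_fn_almost_projection hc0 hc'n hε hω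
  -- a left multiple of `c'`, so that it satisfies the same relation
  have hpc : cfcₙ (fn η) c' = cfcₙ (fun r => fn η r / max r η) c' * c' := by
    have hcont : Continuous fun r => fn η r / max r η :=
      continuous_fn.div (by fun_prop) fun r => (lt_max_of_lt_right hη).ne'
    conv_rhs => rw [← cfcₙ_id' ℝ c', cfcₙ_id' ℝ c']
    have h2 := cfcₙ_mul (fun r => fn η r / max r η) (fun r => r) c' hcont.continuousOn
      (by simp [fn_zero hη]) continuous_id.continuousOn rfl
    rw [cfcₙ_id' ℝ c'] at h2
    rw [← h2]
    congr 1
    funext r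
    rcases le_total r η with h | h
    · simp [fn_eq_zero hη h]
    · rw [max_eq_left h, div_mul_cancel₀ _ (by linarith)]
  refine ⟨c', cfcₙ (fn η) c', ?_, cfcₙ_predicate _ _, ?_, ?_, hp1, hp2⟩
  · have h1 : cut t x - c' = (cut t x - a) + (a - c') := by abel
    have h2 : ‖cut t x - a‖ ≤ ε := by
      rw [ha, cut, cut, ← cfcₙ_sub _ _ x continuous_max_sub.continuousOn
        (max_sub_zero ht) continuous_max_sub.continuousOn (max_sub_zero htε)]
      refine norm_cfcₙ_le fun r _ => ?_
      rw [Real.norm_eq_abs, abs_le]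
      rcases le_total r t with h | h
      · rw [max_eq_right (by linarith), max_eq_right (by linarith)]
        constructor <;> linarith
      · rw [max_eq_left (a := r - t) (by linarith)]
        rcases le_total r (t + ε) with h' | h'
        · rw [max_eq_right (by linarith)]; constructor <;> linarith
        · rw [max_eq_left (by linarith)]; constructor <;> linarith
    rw [h1, e11_add, e11_sub a]
    calc _ ≤ 2 * (ENNReal.ofReal ε + ENNReal.ofReal ε) := by
          refine (norm2_add_le _ _).trans ?_
          gcongr
          exact (norm2_e11_le _).trans (ENNReal.ofReal_le_ofReal h2)
      _ = ENNReal.ofReal (4 * ε) := by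
          rw [← ENNReal.ofReal_add hε.le hε.le, ← ENNReal.ofReal_ofNat 2,
            ← ENNReal.ofReal_mul zero_le_two]
          congr 1; ring
  · refine norm_cfcₙ_le fun r _ => ?_
    rw [Real.norm_of_nonneg (fn_nonneg _ _)]
    exact fn_le_one _ _
  · rw [hpc, mul_assoc, ← mul_smul_comm, ← mul_sub, hc', mul_assoc]

/-- The element `(x - t)₊` of `l^∞(A)/J_A` has a projection onto its range, the image of a sequence
of spectral ramps of elements with small oscillation. -/
theorem realRankZero_of_hasTAOZ
    (h : ∀ a : A, a ∈ Ped A → IsPos a → HasTAOZ (e11 a)) : RealRankZero (LInftyModJ A) := by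
  let _ : PartialOrder A := CStarAlgebra.spectralOrder A
  have _ : StarOrderedRing A := CStarAlgebra.spectralOrderedRing A
  refine realRankZero_of_projections fun q hq t ht => ?_
  obtain ⟨X, hX, rfl⟩ := exists_isSelfAdjoint_lift
    (Quotient.mkHom (ClosedStarIdeal.span (JSet A))) (Quotient.mkHom_surjective _) hq
  set π := Quotient.mkHom (ClosedStarIdeal.span (JSet A))
  obtain ⟨V, -, hV⟩ := exists_map_eq_cfcₙ (continuous_max_sub (ε := t)) (max_sub_zero ht) hX
  have hVn : ∀ n, V n = cut t (X n) := fun n => hV A (LInfty.eval n)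
  have hVπ : π V = cut t (π X) := hV _ π
  have hε : ∀ n : ℕ, (0 : ℝ) < 1 / (n + 1) := fun n => by positivity
  choose c p hVc hps hpn hprel hpp hcp using fun n : ℕ =>
    exists_approx_range_projection h (LInfty.isSelfAdjoint_apply hX n) ht
      (LInfty.norm_apply_le X n) (hε n)
  simp only [← hVn] at hVc hprel
  let P : LInfty A := LInfty.ofBounded p 1 hpn
  have hPs : IsSelfAdjoint P := lp.ext (funext fun n => hps n)
  have hlim : Tendsto (fun n : ℕ => (1 : ℝ) / (n + 1)) atTop (𝓝 0) :=
    tendsto_one_div_add_atTop_nhds_zero_nat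
  have hPP : π (P * P) = π P := by
    rw [← sub_eq_zero, ← map_sub]
    refine mkHom_eq_zero_of_tendsto (tendsto_of_tendsto_of_tendsto_of_le_of_le
      tendsto_const_nhds ?_ (fun n => zero_le) hpp)
    have hc : Continuous fun r : ℝ => ENNReal.ofReal √r :=
      ENNReal.continuous_ofReal.comp Real.continuous_sqrt
    have h1 := (hc.tendsto 0).comp hlim
    rwa [Real.sqrt_zero, ENNReal.ofReal_zero] at h1
  have hPV : π (P * V) = π V := by
    rw [← sub_eq_zero, ← map_sub]
    have hle : ∀ n : ℕ, norm2 (e11 ((P * V - V) n)) ≤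
        2 * (ENNReal.ofReal √(2 * (‖X‖ ^ 2 * (1 / (n + 1)) + (1 / (n + 1)) ^ 2)) +
          4 * ENNReal.ofReal (4 * (1 / (n + 1)))) := by
      intro n
      have h1 : (P * V - V) n = -(c n - p n * c n) + (p n * (V n - c n) - (V n - c n)) := by
        change p n * V n - V n = _
        rw [mul_sub]; abel
      rw [h1, e11_add]
      refine (norm2_add_le _ _).trans ?_
      gcongr
      · rw [show e11 (-(c n - p n * c n)) = -e11 (c n - p n * c n) from map_neg (matUnit 0 0) _,
          norm2_neg]
        exact hcp n
      · rw [e11_sub, e11_mul]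
        calc _ ≤ 2 * (ENNReal.ofReal ‖e11 (p n)‖ * norm2 (e11 (V n - c n))
                + norm2 (e11 (V n - c n))) := by
              refine (norm2_sub_le _ _).trans ?_
              gcongr
              exact norm2_mul_le_left _ _
          _ ≤ 2 * (1 * ENNReal.ofReal (4 * (1 / (n + 1)))
                + ENNReal.ofReal (4 * (1 / (n + 1)))) := by
              have : ENNReal.ofReal ‖e11 (p n)‖ ≤ 1 := by
                rw [norm_e11, ENNReal.ofReal_le_one]; exact hpn n
              gcongr <;> exact hVc n
          _ = _ := by ring
    refine mkHom_eq_zero_of_tendsto (tendsto_of_tendsto_of_tendsto_of_le_of_le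
      tendsto_const_nhds ?_ (fun n => zero_le) hle)
    have h1 : Continuous fun r : ℝ => ENNReal.ofReal √(2 * (‖X‖ ^ 2 * r + r ^ 2)) :=
      ENNReal.continuous_ofReal.comp (by fun_prop)
    have h2 : Continuous fun r : ℝ => ENNReal.ofReal (4 * r) :=
      ENNReal.continuous_ofReal.comp (by fun_prop)
    have h3 := ENNReal.Tendsto.const_mul (a := 2) (((h1.tendsto 0).comp hlim).add
      (ENNReal.Tendsto.const_mul (a := 4) ((h2.tendsto 0).comp hlim) (Or.inr (by simp))))
      (Or.inr (by simp))
    simpa only [Function.comp_def, mul_zero, add_zero, ne_eq, OfNat.ofNat_ne_zero,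
      not_false_eq_true, zero_pow, Real.sqrt_zero, ENNReal.ofReal_zero] using h3
  refine ⟨π P, hPs.map π, ?_, ?_⟩
  · rw [← map_mul, hPP]
  · rw [← hVπ, ← hPV, ← map_mul, ← map_smul, ← map_sub]
    congr 1
    exact lp.ext (funext fun n => hprel n)

end RealRankZero

/-! ### Diagonal perturbations of matrices -/

section MatrixPerturbation

open Matrix

/-- Over any ring, a block matrix is invertible if its first block and the Schur complement of this
block are. -/
theorem isUnit_fromBlocks_of_schur {R m n : Type*} [Ring R] [Fintype m] [Fintype n]
    [DecidableEq m] [DecidableEq n] {A A' : Matrix m m R} {B : Matrix m n R} {C : Matrix n m R}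
    {D : Matrix n n R} (h : A * A' = 1) (h' : A' * A = 1) (hS : IsUnit (D - C * A' * B)) :
    IsUnit (fromBlocks A B C D) := by
  obtain ⟨S, hS⟩ := hS
  have hL : IsUnit (fromBlocks 1 0 (C * A') 1 : Matrix (m ⊕ n) (m ⊕ n) R) :=
    isUnit_iff_exists.2 ⟨fromBlocks 1 0 (-(C * A')) 1, by simp [fromBlocks_multiply],
      by simp [fromBlocks_multiply]⟩
  have hU : IsUnit (fromBlocks 1 (A' * B) 0 1 : Matrix (m ⊕ n) (m ⊕ n) R) :=
    isUnit_iff_exists.2 ⟨fromBlocks 1 (-(A' * B)) 0 1, by simp [fromBlocks_multiply],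
      by simp [fromBlocks_multiply]⟩
  have hD : IsUnit (fromBlocks A 0 0 (S : Matrix n n R)) :=
    isUnit_iff_exists.2 ⟨fromBlocks A' 0 0 ((S⁻¹ : (Matrix n n R)ˣ) : Matrix n n R), by
      simp [fromBlocks_multiply, h], by simp [fromBlocks_multiply, h']⟩
  have : fromBlocks A B C D = fromBlocks 1 0 (C * A') 1 * fromBlocks A 0 0 (S : Matrix n n R) *
      fromBlocks 1 (A' * B) 0 1 := by
    rw [hS, fromBlocks_multiply, fromBlocks_multiply]
    simp only [Matrix.one_mul, Matrix.mul_one, Matrix.zero_mul, Matrix.mul_zero, add_zero, zero_add]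
    rw [Matrix.mul_assoc C A' A, h', Matrix.mul_one, ← Matrix.mul_assoc A, h, Matrix.one_mul,
      ← Matrix.mul_assoc C, add_sub_cancel]
  rw [this]
  exact (hL.mul hD).mul hU

/-- If small self-adjoint perturbations make self-adjoint elements of `R` invertible, then small
diagonal perturbations do the same for matrices over `R`. -/
theorem exists_diagonal_isUnit {R : Type*} [CStarAlgebra R] {ε : ℝ}
    (h : ∀ x : R, IsSelfAdjoint x → ∃ d, IsSelfAdjoint d ∧ ‖d‖ ≤ ε ∧ IsUnit (x + d)) :
    ∀ (n : ℕ) (X : Matrix (Fin n) (Fin n) R), Xᴴ = X →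
      ∃ d : Fin n → R, (∀ i, IsSelfAdjoint (d i) ∧ ‖d i‖ ≤ ε) ∧ IsUnit (X + diagonal d)
  | 0, X, _ => ⟨fun i => i.elim0, fun i => i.elim0, ⟨1, Subsingleton.elim _ _⟩⟩
  | n + 1, X, hX => by
    have hXe : ∀ i j, star (X j i) = X i j := fun i j => congrFun (congrFun hX i) j
    obtain ⟨d₀, hd₀, hd₀n, u, hu⟩ := h (X 0 0) (hXe 0 0)
    set a' : R := ((u⁻¹ : Rˣ) : R) with ha'
    have hus : star (u : R) = u := by rw [hu, star_add, hXe, hd₀.star_eq]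
    have h1 : (u : R) * a' = 1 := u.mul_inv
    have h2 : a' * (u : R) = 1 := u.inv_mul
    have ha's : star a' = a' := by
      have h3 : star a' * (u : R) = 1 := by
        have := congrArg star h1
        rwa [star_mul, hus, star_one] at this
      calc star a' = star a' * ((u : R) * a') := by rw [h1, mul_one]
        _ = a' := by rw [← mul_assoc, h3, one_mul]
    let D : Matrix (Fin n) (Fin n) R := of fun i j => X i.succ j.succ
    let Y : Matrix (Fin n) (Fin n) R := of fun i j =>
      X i.succ j.succ - X i.succ 0 * a' * X 0 j.succ
    obtain ⟨d, hd, hdu⟩ := exists_diagonal_isUnit h n Y (by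
      ext i j
      change star (X j.succ i.succ - X j.succ 0 * a' * X 0 i.succ) = _
      rw [star_sub, star_mul, star_mul, hXe, hXe, hXe, ha's, ← mul_assoc]
      rfl)
    refine ⟨Fin.cons d₀ d, Fin.cases ⟨hd₀, hd₀n⟩ hd, ?_⟩
    let e : Fin (n + 1) ≃ Fin 1 ⊕ Fin n :=
      (finCongr (Nat.add_comm n 1)).trans finSumFinEquiv.symm
    let A : Matrix (Fin 1) (Fin 1) R := of fun _ _ => (u : R)
    let A' : Matrix (Fin 1) (Fin 1) R := of fun _ _ => a'
    let B : Matrix (Fin 1) (Fin n) R := of fun _ j => X 0 j.succ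
    let C : Matrix (Fin n) (Fin 1) R := of fun i _ => X i.succ 0
    have hblock : IsUnit (fromBlocks A B C (D + diagonal d)) := by
      refine isUnit_fromBlocks_of_schur (A' := A') ?_ ?_ ?_
      · ext i j
        obtain rfl := Subsingleton.elim i j
        simp [A, A', Matrix.mul_apply, h1]
      · ext i j
        obtain rfl := Subsingleton.elim i j
        simp [A, A', Matrix.mul_apply, h2]
      · have : D + diagonal d - C * A' * B = Y + diagonal d := by
          ext i j
          simp [D, C, A', B, Y, Matrix.mul_apply]
          abel
        rwa [this]
    have he : ∀ i, e.symm i = Sum.elim (fun _ => 0) Fin.succ i := by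
      rintro (i | i)
      · apply Fin.ext
        simp [e]
      · apply Fin.ext
        simp [e]
    have hre : reindexRingEquiv R e (X + diagonal (Fin.cons d₀ d : Fin (n + 1) → R))
        = fromBlocks A B C (D + diagonal d) := by
      ext i j
      change (X + diagonal (Fin.cons d₀ d : Fin (n + 1) → R)) (e.symm i) (e.symm j) = _
      rw [he, he]
      rcases i with i | i <;> rcases j with j | j
      · simp [A, hu]
      · simp [B, Matrix.diagonal_apply_ne _ (Fin.succ_ne_zero j).symm]
      · simp [C]
      · simp [D, Matrix.diagonal_apply]
    rw [← MulEquiv.isUnit_map (reindexRingEquiv R e), hre]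
    exact hblock

end MatrixPerturbation

/-! ### Spectral projections of invertible elements -/

section SpectralProjection

variable {U : Type*} [CStarAlgebra U] [PartialOrder U] [StarOrderedRing U]

theorem IsPos.map {A B : Type*} [NonUnitalCStarAlgebra A] [NonUnitalCStarAlgebra B]
    (φ : A →⋆ₙₐ[ℂ] B) {a : A} (h : IsPos a) : IsPos (φ a) := by
  obtain ⟨b, rfl⟩ := h
  exact ⟨φ b, by rw [map_mul, map_star]⟩

/-- An invertible self-adjoint element has a positive spectral projection, which is a continuous
function of it because the spectrum has a gap at `0`. -/
theorem exists_positive_projection {y : U} (hy : IsSelfAdjoint y) (hu : IsUnit y) :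
    ∃ h : ℝ → ℝ, Continuous h ∧ (∀ t ≤ 0, h t = 0) ∧ cfc h y * cfc h y = cfc h y ∧
      0 ≤ cfc h y * y * cfc h y ∧ (1 - cfc h y) * y * (1 - cfc h y) ≤ 0 := by
  have h0 : (0 : ℝ) ∈ (spectrum ℝ y)ᶜ := spectrum.zero_notMem ℝ hu
  obtain ⟨γ, hγ, hball⟩ := Metric.isOpen_iff.1 (spectrum.isClosed (𝕜 := ℝ) y).isOpen_compl 0 h0
  have hgap : ∀ t ∈ spectrum ℝ y, t ≤ 0 ∨ γ ≤ t := by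
    intro t ht
    by_contra hcon
    push Not at hcon
    refine hball (a := t) ?_ ht
    rw [Metric.mem_ball, Real.dist_eq, sub_zero, abs_of_pos hcon.1]
    exact hcon.2
  let h : ℝ → ℝ := fun t => max 0 (min 1 (t / γ))
  have hc : Continuous h := by fun_prop
  have hneg : ∀ t ≤ 0, h t = 0 := fun t ht =>
    max_eq_left ((min_le_right _ _).trans (div_nonpos_of_nonpos_of_nonneg ht hγ.le))
  have hpos : ∀ t, γ ≤ t → h t = 1 := fun t ht => by
    have : 1 ≤ t / γ := (one_le_div hγ).2 ht
    simp [h, min_eq_left this]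
  refine ⟨h, hc, hneg, ?_, ?_, ?_⟩
  · rw [← cfc_mul h h y]
    refine cfc_congr fun t ht => ?_
    rcases hgap t ht with h1 | h1
    · simp [hneg t h1]
    · simp [hpos t h1]
  · have : cfc h y * y * cfc h y = cfc (fun t => h t * t * h t) y := by
      rw [cfc_mul (fun t => h t * t) h y, cfc_mul h (fun t => t) y, cfc_id' ℝ y]
    rw [this]
    refine cfc_nonneg fun t ht => ?_
    rcases hgap t ht with h1 | h1
    · simp [hneg t h1]
    · rw [hpos t h1]; linarith
  · have : (1 - cfc h y) * y * (1 - cfc h y) = cfc (fun t => (1 - h t) * t * (1 - h t)) y := by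
      rw [cfc_mul (fun t => (1 - h t) * t) (fun t => 1 - h t) y,
        cfc_mul (fun t => 1 - h t) (fun t => t) y, cfc_id' ℝ y, cfc_sub (fun _ => 1) h y,
        cfc_const_one ℝ y]
    rw [this]
    refine cfc_nonpos _ _ fun t ht => ?_
    rcases hgap t ht with h1 | h1
    · simpa [hneg t h1] using h1
    · simp [hpos t h1]

end SpectralProjection

/-! ### Projections in an ideal -/

section CompressingProjection

/-- Let `E` be an ideal in `U`, given as the kernel of `φ`, and let `a ∈ E₊`. A self-adjoint
perturbation `D` that makes `a - δ + D` invertible gives a projection in `E` on which `a` is bounded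
below, and away from which `a` is small. The projection lies in `E` because `a - δ + D` is
negative modulo `E`. -/
theorem exists_projection_of_isUnit {E F U : Type*} [NonUnitalCStarAlgebra E]
    [NonUnitalCStarAlgebra F] [CStarAlgebra U] [PartialOrder U] [StarOrderedRing U]
    (ι : E →⋆ₙₐ[ℂ] U) (hι : Function.Injective ι) (φ : U →⋆ₙₐ[ℂ] F)
    (hφ : ∀ u, φ u = 0 → ∃ e, ι e = u) (hφι : ∀ e, φ (ι e) = 0) {a : E} (ha : IsPos a) {D : U}
    {δ : ℝ} (hδ : 0 < δ) (hD : IsSelfAdjoint D) (h1 : -(((δ / 2 : ℝ) : ℂ) • (1 : U)) ≤ D)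
    (h2 : D ≤ ((δ / 2 : ℝ) : ℂ) • (1 : U)) (hu : IsUnit (ι a - (δ : ℂ) • (1 : U) + D)) :
    ∃ p : E, IsSelfAdjoint p ∧ p * p = p ∧ IsPos (p * a * p - ((δ / 2 : ℝ) : ℂ) • p) ∧
      ‖a - p * a - a * p + p * a * p‖ ≤ 2 * δ := by
  let _ : PartialOrder E := CStarAlgebra.spectralOrder _
  have _ : StarOrderedRing E := CStarAlgebra.spectralOrderedRing _
  let _ : PartialOrder F := CStarAlgebra.spectralOrder _
  have _ : StarOrderedRing F := CStarAlgebra.spectralOrderedRing _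
  rw [Complex.coe_smul] at h1 h2 hu
  have hιa : 0 ≤ ι a := isPos_iff_nonneg.1 (ha.map ι)
  have hs1 : IsSelfAdjoint (δ • (1 : U)) := .smul (.all δ) (.one U)
  set y : U := ι a - δ • (1 : U) + D with hy
  have hys : IsSelfAdjoint y := ((IsSelfAdjoint.of_nonneg hιa).sub hs1).add hD
  have h0 : (0 : U) ≤ (δ / 2) • (1 : U) := smul_nonneg (by positivity) zero_le_one
  have hdbl : δ • (1 : U) = (δ / 2) • (1 : U) + (δ / 2) • (1 : U) := by
    rw [← add_smul, add_halves]
  obtain ⟨h, hc, hneg, hpp, hpos, hnonpos⟩ := exists_positive_projection hys hu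
  set P : U := cfc h y with hP
  have hPs : IsSelfAdjoint P := cfc_predicate h y
  have hP0 : 0 ≤ P := by
    rw [← hpp]; nth_rewrite 1 [← hPs.star_eq]; exact star_mul_self_nonneg P
  have hφP : φ P = 0 := by
    have hw : 0 ≤ φ (δ • (1 : U) - D) := by
      obtain ⟨b, hb⟩ := CStarAlgebra.nonneg_iff_eq_star_mul_self.1
        (sub_nonneg.2 (h2.trans (hdbl ▸ le_add_of_nonneg_left h0)))
      rw [hb, map_mul, map_star]
      exact star_mul_self_nonneg _
    have hφy : φ y = -φ (δ • (1 : U) - D) := by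
      rw [← map_neg, ← sub_eq_zero, ← map_sub, ← hφι a]
      congr 1
      rw [hy]; abel
    rw [hP, ← cfcₙ_eq_cfc hc.continuousOn (hneg 0 le_rfl),
      NonUnitalStarAlgHom.map_cfcₙ (S := ℂ) φ h y hc.continuousOn (hneg 0 le_rfl)
        (AddMonoidHomClass.continuous_of_bound φ 1 fun x => by
          rw [one_mul]; exact NonUnitalStarAlgHom.norm_apply_le φ x) hys (hys.map φ), hφy,
      ← cfcₙ_comp_neg h _ hc.continuousOn (hneg 0 le_rfl), ← cfcₙ_zero ℝ (φ (δ • (1 : U) - D))]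
    refine cfcₙ_congr fun t ht => ?_
    exact hneg _ (by have := quasispectrum_nonneg' hw ht; linarith)
  obtain ⟨p, hp⟩ := hφ P hφP
  have hps : IsSelfAdjoint p := hι (by rw [map_star, hp, hPs.star_eq])
  have hpp' : p * p = p := hι (by rw [map_mul, hp, hpp])
  have hay : ι a = y + (δ • (1 : U) - D) := by rw [hy]; abel
  refine ⟨p, hps, hpp', isPos_iff_nonneg.2 (nonneg_of_map_nonneg ι hι ?_), ?_⟩
  · have h3 : ι (p * a * p - ((δ / 2 : ℝ) : ℂ) • p)
        = P * y * P + star P * ((δ / 2) • (1 : U) - D) * P := by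
      rw [map_sub, map_mul, map_mul, map_smul, hp, hay, hPs.star_eq, hdbl, Complex.coe_smul]
      simp only [mul_add, add_mul, mul_sub, sub_mul, mul_smul_comm, smul_mul_assoc, mul_one, hpp]
      abel
    rw [h3]
    exact add_nonneg hpos (star_left_conjugate_nonneg (sub_nonneg.2 h2) P)
  · have hW : IsSelfAdjoint (1 - P) := (IsSelfAdjoint.one U).sub hPs
    have h3 : ι (a - p * a - a * p + p * a * p) = star (1 - P) * ι a * (1 - P) := by
      simp only [map_add, map_sub, map_mul, hp]
      rw [hW.star_eq]
      noncomm_ring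
    have hWW : star (1 - P) * (1 - P) ≤ 1 := by
      have : star (1 - P) * (1 - P) = 1 - P := by
        rw [hW.star_eq]
        simp only [mul_sub, sub_mul, mul_one, one_mul, hpp]
        abel
      rw [this]
      exact sub_le_self _ hP0
    have h4 : star (1 - P) * ι a * (1 - P) ≤ (2 * δ) • (1 : U) := by
      have h5 : δ • (1 : U) - D ≤ (2 * δ) • (1 : U) := by
        have h6 : δ • (1 : U) - D ≤ δ • (1 : U) + (δ / 2) • (1 : U) := by
          rw [sub_eq_add_neg]
          exact add_le_add_right (neg_le.1 h1) _
        refine h6.trans ?_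
        rw [← add_smul]
        exact smul_le_smul_of_nonneg_right (by linarith) zero_le_one
      have h7 : star (1 - P) * (δ • (1 : U) - D) * (1 - P)
          ≤ star (1 - P) * ((2 * δ) • (1 : U)) * (1 - P) :=
        star_left_conjugate_le_conjugate h5 _
      have h8 : star (1 - P) * ((2 * δ) • (1 : U)) * (1 - P) ≤ (2 * δ) • (1 : U) := by
        rw [mul_smul_comm, mul_one, smul_mul_assoc]
        exact smul_le_smul_of_nonneg_left hWW (by positivity)
      rw [hay, mul_add, add_mul]
      nth_rewrite 1 [hW.star_eq]
      calc _ ≤ 0 + (2 * δ) • (1 : U) := add_le_add hnonpos (h7.trans h8)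
        _ = _ := zero_add _
    rw [← NonUnitalStarAlgHom.norm_map ι hι, h3]
    rw [CStarAlgebra.norm_le_iff_le_algebraMap _ (by positivity)
      (star_left_conjugate_nonneg hιa _), Algebra.algebraMap_eq_smul_one]
    exact h4

end CompressingProjection

/-! ### Projections in matrices over algebras of real rank zero -/

section MatrixProjection

/-- The scalar part, as a *-homomorphism. -/
noncomputable def unitizationFst (Q : Type*) [NonUnitalCStarAlgebra Q] :
    Unitization ℂ Q →⋆ₙₐ[ℂ] ℂ where
  toFun x := x.fst
  map_smul' _ _ := rfl
  map_zero' := rfl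
  map_add' _ _ := rfl
  map_mul' _ _ := rfl
  map_star' _ := rfl

theorem diagonal_nonneg {U : Type*} [CStarAlgebra U] [PartialOrder U] [StarOrderedRing U] {n : ℕ}
    {d : Fin n → U} (hd : ∀ i, 0 ≤ d i) :
    0 ≤ (CStarMatrix.ofMatrix (Matrix.diagonal d) : CStarMatrix (Fin n) (Fin n) U) := by
  choose b hb using fun i => CStarAlgebra.nonneg_iff_eq_star_mul_self.1 (hd i)
  have : (CStarMatrix.ofMatrix (Matrix.diagonal d) : CStarMatrix (Fin n) (Fin n) U) =
      star (CStarMatrix.ofMatrix (Matrix.diagonal b)) *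
        CStarMatrix.ofMatrix (Matrix.diagonal b) := by
    change Matrix.diagonal d = (Matrix.diagonal b).conjTranspose * Matrix.diagonal b
    rw [Matrix.diagonal_conjTranspose, Matrix.diagonal_mul_diagonal]
    exact congrArg Matrix.diagonal (funext hb)
  rw [this]
  exact star_mul_self_nonneg _

/-- In the matrices over an algebra of real rank zero, every positive element `a` and every `δ > 0`
admit a projection on which `a` is at least `δ / 2`, and away from which `a` is at most `2 δ`. -/
theorem RealRankZero.exists_matrix_projection {Q : Type u} [NonUnitalCStarAlgebra Q]
    [PartialOrder Q] [StarOrderedRing Q] (hQ : RealRankZero Q) {n : ℕ}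
    {a : CStarMatrix (Fin n) (Fin n) Q} (ha : IsPos a) {δ : ℝ} (hδ : 0 < δ) :
    ∃ p : CStarMatrix (Fin n) (Fin n) Q, IsSelfAdjoint p ∧ p * p = p ∧
      IsPos (p * a * p - ((δ / 2 : ℝ) : ℂ) • p) ∧ ‖a - p * a - a * p + p * a * p‖ ≤ 2 * δ := by
  let _ : PartialOrder (Unitization ℂ Q) := CStarAlgebra.spectralOrder _
  have _ : StarOrderedRing (Unitization ℂ Q) := CStarAlgebra.spectralOrderedRing _
  have hpert : ∀ x : Unitization ℂ Q, IsSelfAdjoint x →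
      ∃ d, IsSelfAdjoint d ∧ ‖d‖ ≤ δ / 2 ∧ IsUnit (x + d) := by
    intro x hx
    obtain ⟨z, ⟨hz, hzu⟩, hxz⟩ := Metric.mem_closure_iff.1 (hQ x hx) (δ / 2) (half_pos hδ)
    refine ⟨z - x, hz.sub hx, ?_, by rwa [add_sub_cancel]⟩
    rw [← dist_eq_norm, dist_comm]
    exact hxz.le
  set ι : CStarMatrix (Fin n) (Fin n) Q →⋆ₙₐ[ℂ] CStarMatrix (Fin n) (Fin n) (Unitization ℂ Q) :=
    CStarMatrix.mapₙₐ (Unitization.inrNonUnitalStarAlgHom ℂ Q)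
  have hιa : IsSelfAdjoint (ι a) := by
    obtain ⟨b, rfl⟩ := ha
    exact (IsSelfAdjoint.star_mul_self b).map ι
  have hs1 : IsSelfAdjoint ((δ : ℂ) • (1 : CStarMatrix (Fin n) (Fin n) (Unitization ℂ Q))) :=
    .smul (Complex.conj_ofReal δ) (.one _)
  obtain ⟨d, hd, hdu⟩ := exists_diagonal_isUnit hpert n
    (ι a - (δ : ℂ) • (1 : CStarMatrix (Fin n) (Fin n) (Unitization ℂ Q))) (hιa.sub hs1)
  have hone : ∀ r : ℝ, (r : ℂ) • (1 : CStarMatrix (Fin n) (Fin n) (Unitization ℂ Q)) =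
      CStarMatrix.ofMatrix (Matrix.diagonal fun _ => algebraMap ℝ (Unitization ℂ Q) r) := by
    intro r
    refine CStarMatrix.ext fun i j => ?_
    change (r : ℂ) • (1 : Matrix (Fin n) (Fin n) (Unitization ℂ Q)) i j = Matrix.diagonal _ i j
    by_cases hij : i = j
    · subst hij
      rw [Matrix.one_apply_eq, Matrix.diagonal_apply_eq, Algebra.algebraMap_eq_smul_one,
        Complex.coe_smul]
    · rw [Matrix.one_apply_ne hij, Matrix.diagonal_apply_ne _ hij, smul_zero]
  have hbd : ∀ i, d i ≤ algebraMap ℝ (Unitization ℂ Q) (δ / 2) ∧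
      -algebraMap ℝ (Unitization ℂ Q) (δ / 2) ≤ d i := fun i =>
    ⟨(hd i).1.le_algebraMap_norm_self.trans (algebraMap_mono _ (hd i).2),
      (neg_le_neg (algebraMap_mono _ (hd i).2)).trans (hd i).1.neg_algebraMap_norm_le_self⟩
  refine exists_projection_of_isUnit ι ?_ (CStarMatrix.mapₙₐ (unitizationFst Q)) ?_ ?_ ha
    (D := CStarMatrix.ofMatrix (Matrix.diagonal d)) hδ ?_ ?_ ?_ hdu
  · intro x y hxy
    refine CStarMatrix.ext fun i j => ?_
    exact Unitization.inr_injective (congrFun (congrFun hxy i) j)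
  · intro u hu
    refine ⟨CStarMatrix.ofMatrix fun i j => (u i j).snd, ?_⟩
    refine CStarMatrix.ext fun i j => ?_
    have h1 : (u i j).fst = 0 := congrFun (congrFun hu i) j
    change (((u i j).snd : Q) : Unitization ℂ Q) = u i j
    ext
    · simpa using h1.symm
    · simp
  · intro e
    ext i j
    rfl
  · change (Matrix.diagonal d).conjTranspose = Matrix.diagonal d
    rw [Matrix.diagonal_conjTranspose]
    exact congrArg Matrix.diagonal (funext fun i => (hd i).1)
  · rw [neg_le_iff_add_nonneg, hone]
    have := diagonal_nonneg fun i => neg_le_iff_add_nonneg.1 (hbd i).2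
    convert this using 1
    exact congrArg CStarMatrix.ofMatrix (Matrix.diagonal_add _ _)
  · rw [← sub_nonneg, hone]
    have := diagonal_nonneg fun i => sub_nonneg.2 (hbd i).1
    convert this using 1
    exact congrArg CStarMatrix.ofMatrix (Matrix.diagonal_sub _ _)

end MatrixProjection

/-! ### Null sequences in `A ⊗ 𝕂` -/

section NullSequences

variable {A : Type u} [NonUnitalCStarAlgebra A]

open Stabilization

theorem tendsto_norm2_add {x y : ℕ → Stabilization A}
    (hx : Tendsto (fun k => norm2 (x k)) atTop (𝓝 0))
    (hy : Tendsto (fun k => norm2 (y k)) atTop (𝓝 0)) :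
    Tendsto (fun k => norm2 (x k + y k)) atTop (𝓝 0) := by
  refine tendsto_of_tendsto_of_tendsto_of_le_of_le tendsto_const_nhds ?_ (fun _ => zero_le)
    (fun k => norm2_add_le (x k) (y k))
  simpa using ENNReal.Tendsto.const_mul (a := 2) (hx.add hy) (Or.inr (by simp))

theorem tendsto_norm2_of_le_mul {x y : ℕ → Stabilization A} {C : ℝ}
    (hx : Tendsto (fun k => norm2 (x k)) atTop (𝓝 0))
    (h : ∀ k, norm2 (y k) ≤ ENNReal.ofReal C * norm2 (x k)) :
    Tendsto (fun k => norm2 (y k)) atTop (𝓝 0) := by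
  refine tendsto_of_tendsto_of_tendsto_of_le_of_le tendsto_const_nhds ?_ (fun _ => zero_le) h
  simpa using ENNReal.Tendsto.const_mul (a := ENNReal.ofReal C) hx (Or.inr (by simp))

theorem norm2_mul_le_of_norm_le {b x : Stabilization A} {C : ℝ} (h : ‖b‖ ≤ C) :
    norm2 (b * x) ≤ ENNReal.ofReal C * norm2 x :=
  (norm2_mul_le_left b x).trans (by gcongr)

/-- A condition on a bounded sequence `x` in `A ⊗ 𝕂`: the trace norms of `x_k y_k b` vanish in the
limit. -/
def IsNullLeft (x : ℕ → Stabilization A) : Prop :=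
  ∀ y : LInfty (Stabilization A), ∀ b ∈ Ped (Stabilization A),
    Tendsto (fun k => norm2 (x k * y k * b)) atTop (𝓝 0)

theorem isNullLeft_of_tendsto {x : ℕ → Stabilization A}
    (h : Tendsto (fun k => norm2 (x k)) atTop (𝓝 0)) : IsNullLeft x := fun y b _ =>
  tendsto_norm2_of_le_mul (C := ‖b‖ * ‖y‖) h fun k => by
    refine (norm2_mul_le_right _ _).trans ?_
    rw [ENNReal.ofReal_mul (norm_nonneg _), mul_assoc]
    gcongr
    exact (norm2_mul_le_right _ _).trans (by gcongr; exact LInfty.norm_apply_le y k)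

theorem IsNullLeft.mul_left {x : ℕ → Stabilization A} (h : IsNullLeft x)
    (a : LInfty (Stabilization A)) : IsNullLeft fun k => a k * x k := fun y b hb =>
  tendsto_norm2_of_le_mul (C := ‖a‖) (h y b hb) fun k => by
    rw [mul_assoc, mul_assoc, ← mul_assoc (x k)]
    exact norm2_mul_le_of_norm_le (LInfty.norm_apply_le a k)

theorem IsNullLeft.mul_right {x : ℕ → Stabilization A} (h : IsNullLeft x)
    (a : LInfty (Stabilization A)) : IsNullLeft fun k => x k * a k := fun y b hb => by
  simpa only [LInfty.mul_apply, ← mul_assoc] using h (a * y) b hb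

theorem IsNullLeft.of_approx {x : ℕ → Stabilization A}
    (h : ∀ ε : ℝ, 0 < ε → ∃ z : ℕ → Stabilization A, IsNullLeft z ∧ ∀ k, ‖x k - z k‖ ≤ ε) :
    IsNullLeft x := fun y b hb => by
  have hfin := (norm2_lt_top hb).ne
  rw [ENNReal.tendsto_nhds_zero]
  intro ε hε
  -- the uniform error contributes at most `2 η ‖y‖ ‖b‖₂`
  have hlim : Tendsto (fun η : ℝ => 2 * (ENNReal.ofReal (η * ‖y‖) * norm2 b)) (𝓝[>] 0) (𝓝 0) := by
    have hc : Continuous fun η : ℝ => ENNReal.ofReal (η * ‖y‖) :=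
      ENNReal.continuous_ofReal.comp (by fun_prop)
    have h1 := ENNReal.Tendsto.const_mul (a := 2) (ENNReal.Tendsto.mul_const (b := norm2 b)
      ((hc.tendsto 0).mono_left (nhdsWithin_le_nhds (s := Set.Ioi 0))) (Or.inr hfin))
      (Or.inr (by simp))
    simpa using h1
  have hε2 : 0 < ε / 2 := ENNReal.half_pos hε.ne'
  obtain ⟨η, hη1, hη⟩ := ((ENNReal.tendsto_nhds_zero.1 hlim (ε / 2) hε2).and
    self_mem_nhdsWithin).exists
  obtain ⟨z, hz, hxz⟩ := h η hη
  have h2 := ENNReal.Tendsto.const_mul (a := 2) (hz y b hb) (Or.inr (by simp))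
  rw [mul_zero] at h2
  filter_upwards [ENNReal.tendsto_nhds_zero.1 h2 (ε / 2) hε2] with k hk
  have h3 : x k * y k * b = z k * y k * b + (x k - z k) * y k * b := by noncomm_ring
  rw [h3]
  refine (norm2_add_le _ _).trans ?_
  rw [mul_add, ← ENNReal.add_halves ε]
  refine add_le_add hk (le_trans ?_ hη1)
  gcongr
  refine norm2_mul_le_of_norm_le ((norm_mul_le _ _).trans ?_)
  exact mul_le_mul (hxz k) (LInfty.norm_apply_le y k) (norm_nonneg _) hη.le

variable (A) in
/-- The closed ideal of the bounded sequences `x` in `A ⊗ 𝕂` such that `x_k y_k b` and `x_k* y_k b`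
vanish in the trace norm in the limit, for all bounded `y` and all `b` in the Pedersen ideal. -/
def nullIdeal : ClosedStarIdeal (LInfty (Stabilization A)) where
  carrier := {x | IsNullLeft (fun k => x k) ∧ IsNullLeft fun k => star (x k)}
  add_mem' := by
    rintro x y ⟨h1, h2⟩ ⟨h3, h4⟩
    refine ⟨fun z b hb => ?_, fun z b hb => ?_⟩
    · simp only [LInfty.add_apply, add_mul]
      exact tendsto_norm2_add (h1 z b hb) (h3 z b hb)
    · simp only [LInfty.add_apply, star_add, add_mul]
      exact tendsto_norm2_add (h2 z b hb) (h4 z b hb)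
  zero_mem' := by
    have h0 : IsNullLeft fun _ : ℕ => (0 : Stabilization A) :=
      isNullLeft_of_tendsto (by simp)
    refine ⟨h0, ?_⟩
    simpa using h0
  mul_mem' := by
    rintro x y ⟨h1, h2⟩ ⟨h3, h4⟩
    refine ⟨h3.mul_left x, ?_⟩
    change IsNullLeft fun k => star (x k * y k)
    simp only [star_mul]
    exact h2.mul_left (star y)
  smul_mem' := by
    rintro c x ⟨h1, h2⟩
    refine ⟨fun z b hb => ?_, fun z b hb => ?_⟩
    · refine tendsto_norm2_of_le_mul (C := ‖c‖) (h1 z b hb) fun k => ?_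
      change norm2 (c • x k * z k * b) ≤ _
      rw [smul_mul_assoc, smul_mul_assoc]
      exact norm2_smul_le _ _
    · refine tendsto_norm2_of_le_mul (C := ‖star c‖) (h2 z b hb) fun k => ?_
      change norm2 (star (c • x k) * z k * b) ≤ _
      rw [star_smul, smul_mul_assoc, smul_mul_assoc]
      exact norm2_smul_le _ _
  star_mem' := by
    rintro x ⟨h1, h2⟩
    refine ⟨h2, ?_⟩
    simpa only [LInfty.star_apply, star_star] using h1
  mul_mem_left := by
    rintro a x ⟨h1, h2⟩
    refine ⟨h1.mul_left a, ?_⟩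
    change IsNullLeft fun k => star (a k * x k)
    simp only [star_mul]
    exact h2.mul_right (star a)
  mul_mem_right := by
    rintro a x ⟨h1, h2⟩
    refine ⟨h1.mul_right a, ?_⟩
    change IsNullLeft fun k => star (x k * a k)
    simp only [star_mul]
    exact h2.mul_left (star a)
  isClosed := by
    refine isClosed_of_closure_subset fun x hx => ?_
    rw [Metric.mem_closure_iff] at hx
    refine ⟨.of_approx fun ε hε => ?_, .of_approx fun ε hε => ?_⟩ <;>
      obtain ⟨z, ⟨h1, h2⟩, hz⟩ := hx ε hε <;> rw [dist_eq_norm] at hz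
    · exact ⟨_, h1, fun k => (LInfty.norm_apply_le (x - z) k).trans hz.le⟩
    · refine ⟨_, h2, fun k => ?_⟩
      rw [← star_sub, norm_star]
      exact (LInfty.norm_apply_le (x - z) k).trans hz.le

end NullSequences

/-! ### Matrices over the sequence algebra -/

section SequenceMatrixUnits

variable {A : Type u} [NonUnitalCStarAlgebra A]

open Stabilization ClosedStarIdeal

variable (A) in
/-- The sequencewise embedding `x ↦ x ⊗ eᵢⱼ`. -/
noncomputable def seqMatUnit (i j : ℕ) : LInfty A →ₗ[ℂ] LInfty (Stabilization A) where
  toFun x := LInfty.ofBounded (fun k => matUnit i j (x k)) ‖x‖ fun k => by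
    rw [norm_matUnit]; exact LInfty.norm_apply_le x k
  map_add' x y := lp.ext (funext fun k => map_add (matUnit i j) (x k) (y k))
  map_smul' c x := lp.ext (funext fun k => map_smul (matUnit i j) c (x k))

theorem seqMatUnit_apply (i j : ℕ) (x : LInfty A) (k : ℕ) :
    seqMatUnit A i j x k = matUnit i j (x k) := rfl

theorem seqMatUnit_mul (i j l : ℕ) (x y : LInfty A) :
    seqMatUnit A i j x * seqMatUnit A j l y = seqMatUnit A i l (x * y) :=
  lp.ext (funext fun k => matUnit_mul i j l (x k) (y k))

theorem seqMatUnit_mul_of_ne (i : ℕ) {j k : ℕ} (hjk : j ≠ k) (l : ℕ) (x y : LInfty A) :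
    seqMatUnit A i j x * seqMatUnit A k l y = 0 :=
  lp.ext (funext fun m => matUnit_mul_of_ne i hjk l (x m) (y m))

theorem star_seqMatUnit (i j : ℕ) (x : LInfty A) :
    star (seqMatUnit A i j x) = seqMatUnit A j i (star x) :=
  lp.ext (funext fun k => star_matUnit i j (x k))

theorem continuous_seqMatUnit (i j : ℕ) : Continuous (seqMatUnit A i j) :=
  AddMonoidHomClass.continuous_of_bound (seqMatUnit A i j) 1 fun x => by
    rw [one_mul]
    exact lp.norm_le_of_forall_le (norm_nonneg _) fun k => by
      rw [seqMatUnit_apply, norm_matUnit]; exact LInfty.norm_apply_le x k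

variable (A) in
/-- The sequences in `A` all of whose amplifications are null sequences in `A ⊗ 𝕂`. -/
noncomputable def nullIdealCorner : ClosedStarIdeal (LInfty A) where
  carrier := {x | ∀ i j, seqMatUnit A i j x ∈ (nullIdeal A).carrier}
  add_mem' hx hy i j := by rw [map_add]; exact (nullIdeal A).add_mem' (hx i j) (hy i j)
  zero_mem' i j := by rw [map_zero]; exact (nullIdeal A).zero_mem'
  mul_mem' {x y} hx hy i j := by
    rw [← seqMatUnit_mul i i j]; exact (nullIdeal A).mul_mem' (hx i i) (hy i j)
  smul_mem' c x hx i j := by rw [map_smul]; exact (nullIdeal A).smul_mem' c (hx i j)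
  star_mem' hx i j := by rw [← star_seqMatUnit]; exact (nullIdeal A).star_mem' (hx j i)
  mul_mem_left a x hx i j := by
    rw [← seqMatUnit_mul i i j]; exact (nullIdeal A).mul_mem_left _ _ (hx i j)
  mul_mem_right a x hx i j := by
    rw [← seqMatUnit_mul i j j]; exact (nullIdeal A).mul_mem_right _ _ (hx i j)
  isClosed := by
    simp only [Set.ofPred_forall]
    exact isClosed_iInter fun i => isClosed_iInter fun j =>
      (nullIdeal A).isClosed.preimage (continuous_seqMatUnit i j)

theorem seqMatUnit_mem_nullIdeal (i j : ℕ) {x : LInfty A}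
    (hx : x ∈ (ClosedStarIdeal.span (JSet A)).carrier) :
    seqMatUnit A i j x ∈ (nullIdeal A).carrier := by
  refine hx (nullIdealCorner A) (fun z hz i j => ?_) i j
  have h : Tendsto (fun k => norm2 (seqMatUnit A i j z k)) atTop (𝓝 0) := by
    simp only [seqMatUnit_apply, norm2_matUnit]
    exact hz
  exact ⟨isNullLeft_of_tendsto h, isNullLeft_of_tendsto (by simpa only [norm2_star] using h)⟩

variable (A) in
/-- The maps `q ↦ q ⊗ eᵢⱼ` from `l^∞(A)/J_A` to the sequences in `A ⊗ 𝕂` modulo null sequences. -/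
noncomputable def quotMatUnit (i j : ℕ) : LInftyModJ A →ₗ[ℂ] (nullIdeal A).Quotient :=
  (ClosedStarIdeal.span (JSet A)).toSubmodule.liftQ
    ((ClosedStarIdeal.Quotient.mk (nullIdeal A)).comp (seqMatUnit A i j)) fun _ hx =>
      (Quotient.mk_eq_zero (nullIdeal A)).2 (seqMatUnit_mem_nullIdeal i j hx)

theorem quotMatUnit_mk (i j : ℕ) (x : LInfty A) :
    quotMatUnit A i j (Quotient.mkHom (ClosedStarIdeal.span (JSet A)) x)
      = Quotient.mkHom (nullIdeal A) (seqMatUnit A i j x) := rfl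

theorem quotMatUnit_mul (i j l : ℕ) (p q : LInftyModJ A) :
    quotMatUnit A i j p * quotMatUnit A j l q = quotMatUnit A i l (p * q) := by
  obtain ⟨x, rfl⟩ := Quotient.mkHom_surjective _ p
  obtain ⟨y, rfl⟩ := Quotient.mkHom_surjective _ q
  rw [← map_mul, quotMatUnit_mk, quotMatUnit_mk, quotMatUnit_mk, ← map_mul, seqMatUnit_mul]

theorem quotMatUnit_mul_of_ne (i : ℕ) {j k : ℕ} (hjk : j ≠ k) (l : ℕ) (p q : LInftyModJ A) :
    quotMatUnit A i j p * quotMatUnit A k l q = 0 := by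
  obtain ⟨x, rfl⟩ := Quotient.mkHom_surjective _ p
  obtain ⟨y, rfl⟩ := Quotient.mkHom_surjective _ q
  rw [quotMatUnit_mk, quotMatUnit_mk, ← map_mul, seqMatUnit_mul_of_ne i hjk, map_zero]

theorem star_quotMatUnit (i j : ℕ) (p : LInftyModJ A) :
    star (quotMatUnit A i j p) = quotMatUnit A j i (star p) := by
  obtain ⟨x, rfl⟩ := Quotient.mkHom_surjective _ p
  rw [quotMatUnit_mk, ← map_star (Quotient.mkHom (nullIdeal A)), star_seqMatUnit,
    ← map_star (Quotient.mkHom (ClosedStarIdeal.span (JSet A))), quotMatUnit_mk]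

/-- The *-homomorphism from the matrices over `l^∞(A)/J_A` to the bounded sequences in `A ⊗ 𝕂`
modulo null sequences. -/
noncomputable def quotMatrixHom (n : ℕ) :
    CStarMatrix (Fin n) (Fin n) (LInftyModJ A) →⋆ₙₐ[ℂ] (nullIdeal A).Quotient where
  toFun M := ∑ i : Fin n, ∑ j : Fin n, quotMatUnit A i j (M i j)
  map_smul' c M := by
    simp only [CStarMatrix.smul_apply, map_smul, Finset.smul_sum, MonoidHom.id_apply]
  map_zero' := by simp
  map_add' M N := by simp only [CStarMatrix.add_apply, map_add, Finset.sum_add_distrib]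
  map_mul' M N := by
    simp only [CStarMatrix.mul_apply, map_sum, Finset.sum_mul]
    refine Finset.sum_congr rfl fun i _ => ?_
    rw [Finset.sum_comm]
    refine Finset.sum_congr rfl fun k _ => ?_
    rw [Finset.mul_sum]
    symm
    rw [Finset.sum_eq_single k]
    · rw [Finset.mul_sum]
      exact Finset.sum_congr rfl fun l _ => quotMatUnit_mul _ _ _ _ _
    · intro m _ hm
      rw [Finset.mul_sum]
      exact Finset.sum_eq_zero fun l _ =>
        quotMatUnit_mul_of_ne _ (fun h => hm (Fin.ext h.symm)) _ _ _
    · simp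
  map_star' M := by
    simp only [star_sum, star_quotMatUnit, CStarMatrix.star_apply]
    exact Finset.sum_comm

theorem quotMatrixHom_apply (n : ℕ) (M : CStarMatrix (Fin n) (Fin n) (LInftyModJ A)) :
    quotMatrixHom n M = ∑ i : Fin n, ∑ j : Fin n, quotMatUnit A i j (M i j) := rfl

end SequenceMatrixUnits

/-! ### Compressions by projections -/

section ProjectionCompression

variable {C : Type u} [NonUnitalCStarAlgebra C]

theorem norm_le_one_of_projection {p : C} (hp : IsSelfAdjoint p) (hpp : p * p = p) : ‖p‖ ≤ 1 := by
  have h : ‖p‖ * ‖p‖ = ‖p‖ := by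
    rw [← CStarRing.norm_star_mul_self, hp.star_eq, hpp]
  nlinarith [norm_nonneg p]

theorem nonneg_of_projection [PartialOrder C] [StarOrderedRing C] {p : C} (hp : IsSelfAdjoint p)
    (hpp : p * p = p) : 0 ≤ p := by
  have h := star_mul_self_nonneg p
  rwa [hp.star_eq, hpp] at h

/-- A lower bound on a projection, and an upper bound off it, persist under perturbation. -/
theorem projection_bounds_of_norm_sub_le {p a a' : C} {δ : ℝ} (hp : IsSelfAdjoint p)
    (hpp : p * p = p) (ha : IsSelfAdjoint a) (ha' : IsSelfAdjoint a')
    (h1 : IsPos (p * a' * p - ((δ / 2 : ℝ) : ℂ) • p))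
    (h2 : ‖a' - p * a' - a' * p + p * a' * p‖ ≤ 2 * δ) (haa : ‖a - a'‖ ≤ δ / 4) :
    IsPos (p * a * p - ((δ / 4 : ℝ) : ℂ) • p) ∧ ‖a - p * a - a * p + p * a * p‖ ≤ 3 * δ := by
  let _ : PartialOrder C := CStarAlgebra.spectralOrder _
  have _ : StarOrderedRing C := CStarAlgebra.spectralOrderedRing _
  have hp1 := norm_le_one_of_projection hp hpp
  constructor
  · rw [isPos_iff_nonneg] at h1 ⊢
    have h3 : star p * (a' - a) * p ≤ (δ / 4) • p := by
      refine (CStarAlgebra.star_left_conjugate_le_norm_smul (ha'.sub ha)).trans ?_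
      rw [hp.star_eq, hpp]
      refine smul_le_smul_of_nonneg_right ?_ (nonneg_of_projection hp hpp)
      rwa [norm_sub_rev]
    have h4 : p * a * p - ((δ / 4 : ℝ) : ℂ) • p =
        (p * a' * p - ((δ / 2 : ℝ) : ℂ) • p) + ((δ / 4) • p - star p * (a' - a) * p) := by
      rw [hp.star_eq, Complex.coe_smul, Complex.coe_smul, mul_sub, sub_mul]
      module
    rw [h4]
    exact add_nonneg h1 (sub_nonneg.2 h3)
  · set d := a - a'
    have h3 : a - p * a - a * p + p * a * p = (a' - p * a' - a' * p + p * a' * p)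
        + (d - p * d - d * p + p * d * p) := by
      simp only [d]; noncomm_ring
    have h4 : ‖p * d‖ ≤ ‖d‖ :=
      (norm_mul_le _ _).trans (mul_le_of_le_one_left (norm_nonneg _) hp1)
    have h5 : ‖d * p‖ ≤ ‖d‖ :=
      (norm_mul_le _ _).trans (mul_le_of_le_one_right (norm_nonneg _) hp1)
    have h6 : ‖p * d * p‖ ≤ ‖d‖ :=
      (norm_mul_le _ _).trans ((mul_le_of_le_one_right (norm_nonneg _) hp1).trans h4)
    rw [h3]
    have h7 := norm_add_le (a' - p * a' - a' * p + p * a' * p) (d - p * d - d * p + p * d * p)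
    have h8 := norm_add_le (d - p * d - d * p) (p * d * p)
    have h9 := norm_sub_le (d - p * d) (d * p)
    have h10 := norm_sub_le d (p * d)
    linarith

/-- Projections with the two bounds may be constructed before a *-homomorphism and for an
approximation of the given element. -/
theorem exists_projection_of_map {E F : Type*} [NonUnitalCStarAlgebra E] [NonUnitalCStarAlgebra F]
    (φ : E →⋆ₙₐ[ℂ] F) {m : E} {a : F} {δ : ℝ} (hm : IsSelfAdjoint m) (ha : IsSelfAdjoint a)
    (h : ∃ p : E, IsSelfAdjoint p ∧ p * p = p ∧ IsPos (p * m * p - ((δ / 2 : ℝ) : ℂ) • p) ∧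
      ‖m - p * m - m * p + p * m * p‖ ≤ 2 * δ) (haa : ‖a - φ m‖ ≤ δ / 4) :
    ∃ p : F, IsSelfAdjoint p ∧ p * p = p ∧ IsPos (p * a * p - ((δ / 4 : ℝ) : ℂ) • p) ∧
      ‖a - p * a - a * p + p * a * p‖ ≤ 3 * δ := by
  obtain ⟨p, hp, hpp, h1, h2⟩ := h
  have hpp' : φ p * φ p = φ p := by rw [← map_mul, hpp]
  have h3 := h1.map φ
  have h4 := (NonUnitalStarAlgHom.norm_apply_le φ _).trans h2
  simp only [map_add, map_sub, map_mul, map_smul] at h3 h4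
  exact ⟨φ p, hp.map φ, hpp',
    projection_bounds_of_norm_sub_le (hp.map φ) hpp' ha (hm.map φ) h3 h4 haa⟩

/-- If `e` is bounded below by `κ` on the projection `p`, then the spectrum of `e p e` has a gap
between `0` and `κ²`. -/
theorem eq_zero_or_le_of_mem_quasispectrum {p e : C} {κ : ℝ} (hκ : 0 < κ) (hp : IsSelfAdjoint p)
    (hpp : p * p = p) (he : IsSelfAdjoint e) (h : IsPos (p * e * p - (κ : ℂ) • p)) {t : ℝ}
    (ht : t ∈ quasispectrum ℝ (e * p * e)) : t = 0 ∨ κ ^ 2 ≤ t := by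
  let _ : PartialOrder C := CStarAlgebra.spectralOrder _
  have _ : StarOrderedRing C := CStarAlgebra.spectralOrderedRing _
  rw [isPos_iff_nonneg, Complex.coe_smul] at h
  set s := p * e * p - κ • p with hs
  set w := e * p - p * e * p with hw
  have hpx : ∀ x : C, p * (p * x) = p * x := fun x => by rw [← mul_assoc, hpp]
  have hz : e * p * e = star (p * e) * (p * e) := by
    simp only [star_mul, hp.star_eq, he.star_eq, mul_assoc, hpx]
  have hz0 : 0 ≤ e * p * e := hz ▸ star_mul_self_nonneg _
  have hss : 0 ≤ s * s := by
    have := star_mul_self_nonneg s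
    rwa [(IsSelfAdjoint.of_nonneg h).star_eq] at this
  have hsum : 0 ≤ star w * w + s * s + (2 * κ) • s :=
    add_nonneg (add_nonneg (star_mul_self_nonneg w) hss) (smul_nonneg (by positivity) h)
  have hid : star w * w + s * s + (2 * κ) • s = p * e * e * p - (κ ^ 2) • p := by
    have h1 : star w = p * e - p * e * p := by
      simp only [hw, star_sub, star_mul, hp.star_eq, he.star_eq, mul_assoc]
    have h2 : star w * w = p * e * e * p - p * e * p * e * p := by
      rw [h1, hw]
      simp only [sub_mul, mul_sub, mul_assoc, hpx]
      abel
    have h3 : s * s = p * e * p * e * p - (2 * κ) • (p * e * p) + (κ ^ 2) • p := by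
      rw [hs]
      simp only [sub_mul, mul_sub, mul_assoc, hpx, hpp, smul_mul_assoc, mul_smul_comm]
      module
    rw [h2, h3, hs]
    module
  have hpos : 0 ≤ (e * p * e) * (e * p * e) - (κ ^ 2) • (e * p * e) := by
    have h1 := star_left_conjugate_nonneg hsum e
    rw [hid, he.star_eq] at h1
    refine h1.trans_eq ?_
    simp only [mul_sub, sub_mul, mul_assoc, smul_mul_assoc, mul_smul_comm]
  have hc : cfcₙ (fun r : ℝ => r * r - κ ^ 2 * r) (e * p * e)
      = (e * p * e) * (e * p * e) - (κ ^ 2) • (e * p * e) := by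
    rw [cfcₙ_sub (fun r : ℝ => r * r) (fun r => κ ^ 2 * r) _ (by fun_prop) (by simp)
        (by fun_prop) (by simp), cfcₙ_mul (fun r : ℝ => r) (fun r => r) _ (by fun_prop) rfl
        (by fun_prop) rfl, cfcₙ_const_mul _ (fun r : ℝ => r) _ (by fun_prop) rfl,
      cfcₙ_id' ℝ (e * p * e) (.of_nonneg hz0)]
  rw [← hc, cfcₙ_nonneg_iff _ _ (by fun_prop) (by simp) (.of_nonneg hz0)] at hpos
  have h1 := hpos t ht
  have h2 := quasispectrum_nonneg' hz0 ht
  rcases h2.eq_or_lt with h3 | h3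
  · exact Or.inl h3.symm
  · right
    by_contra hlt
    nlinarith [not_le.1 hlt]

/-- Both sides are norms of `w* w` and `w w*`, for `w = (1 - p) b`. -/
theorem norm_mul_sub_mul_projection_mul {p b : C} (hp : IsSelfAdjoint p) (hpp : p * p = p)
    (hb : IsSelfAdjoint b) :
    ‖b * b - b * p * b‖ = ‖b * b - p * (b * b) - b * b * p + p * (b * b) * p‖ := by
  have hps : star (p : Unitization ℂ C) = p := by rw [← Unitization.inr_star, hp.star_eq]
  have hbs : star (b : Unitization ℂ C) = b := by rw [← Unitization.inr_star, hb.star_eq]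
  have hPP : (p : Unitization ℂ C) * p = p := by rw [← Unitization.inr_mul, hpp]
  have hPx : ∀ x : Unitization ℂ C, (p : Unitization ℂ C) * (p * x) = p * x := fun x => by
    rw [← mul_assoc, hPP]
  set w : Unitization ℂ C := (1 - (p : Unitization ℂ C)) * b with hw
  have hsw : star w = (b : Unitization ℂ C) * (1 - (p : Unitization ℂ C)) := by
    rw [hw, star_mul, star_sub, star_one, hps, hbs]
  rw [← Unitization.norm_inr (𝕜 := ℂ) (b * b - b * p * b),
    ← Unitization.norm_inr (𝕜 := ℂ) (b * b - p * (b * b) - b * b * p + p * (b * b) * p)]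
  have h1 : ((b * b - b * p * b : C) : Unitization ℂ C) = star w * w := by
    rw [hsw, hw]
    simp only [Unitization.inr_sub, Unitization.inr_mul, mul_sub, sub_mul, mul_one, one_mul,
      mul_assoc, hPx]
    abel
  have h2 : ((b * b - p * (b * b) - b * b * p + p * (b * b) * p : C) : Unitization ℂ C)
      = w * star w := by
    rw [hsw, hw]
    simp only [Unitization.inr_sub, Unitization.inr_add, Unitization.inr_mul, mul_sub, sub_mul,
      mul_one, one_mul, mul_assoc]
    abel
  rw [h1, h2, CStarRing.norm_star_mul_self, CStarRing.norm_self_mul_star]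

/-- Clamping to `[0, 1]` does not change a projection. -/
theorem cfcₙ_clamp_of_projection {p : C} (hp : IsSelfAdjoint p) (hpp : p * p = p) :
    cfcₙ (fun t : ℝ => max 0 (min 1 t)) p = p := by
  let _ : PartialOrder C := CStarAlgebra.spectralOrder _
  have _ : StarOrderedRing C := CStarAlgebra.spectralOrderedRing _
  conv_rhs => rw [← cfcₙ_id' ℝ p hp]
  refine cfcₙ_congr fun t ht => ?_
  have h1 := quasispectrum_nonneg' (nonneg_of_projection hp hpp) ht
  have h2 := (le_abs_self t).trans
    ((quasispectrum_le_norm hp ht).trans (norm_le_one_of_projection hp hpp))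
  change max 0 (min 1 t) = t
  rw [min_eq_right h2, max_eq_right h1]

end ProjectionCompression

/-! ### Projections adapted to constant sequences -/

section ConstantSequences

variable {A : Type u} [NonUnitalCStarAlgebra A]

open Stabilization ClosedStarIdeal

/-- The constant sequences. -/
noncomputable def LInfty.const : A →⋆ₙₐ[ℂ] LInfty A where
  toFun a := ofBounded (fun _ => a) ‖a‖ fun _ => le_rfl
  map_smul' _ _ := rfl
  map_zero' := rfl
  map_add' _ _ := rfl
  map_mul' _ _ := rfl
  map_star' _ := rfl

theorem LInfty.const_apply (a : A) (n : ℕ) : LInfty.const a n = a := rfl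

/-- A finite matrix over `A`, taken as a matrix of constant sequences, is mapped to the constant
sequence of the matrix. -/
theorem quotMatrixHom_map_corner {n : ℕ} {f : FinMat A} (hf : f.Supp n) :
    quotMatrixHom n (CStarMatrix.mapₙₐ
        ((Quotient.mkHom (ClosedStarIdeal.span (JSet A))).comp LInfty.const) (FinMat.corner n f))
      = Quotient.mkHom (nullIdeal A) (LInfty.const (incl f)) := by
  rw [quotMatrixHom_apply]
  conv_rhs => rw [FinMat.eq_sum_unit hf]
  simp only [map_sum]
  rfl

/-- If `l^∞(A)/J_A` has real rank zero, then every positive `a` in `A ⊗ 𝕂` admits a projection of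
bounded sequences modulo null sequences, on which `a` is at least `δ / 4` and off which it is at
most `3 δ`: approximate `a` by a finite matrix. -/
theorem exists_projection_of_realRankZero (h : RealRankZero (LInftyModJ A)) {a : Stabilization A}
    (ha : 0 ≤ a) {δ : ℝ} (hδ : 0 < δ) :
    ∃ p : (nullIdeal A).Quotient, IsSelfAdjoint p ∧ p * p = p ∧
      IsPos (p * Quotient.mkHom (nullIdeal A) (LInfty.const a) * p - ((δ / 4 : ℝ) : ℂ) • p) ∧
      ‖Quotient.mkHom (nullIdeal A) (LInfty.const a)
          - p * Quotient.mkHom (nullIdeal A) (LInfty.const a)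
          - Quotient.mkHom (nullIdeal A) (LInfty.const a) * p
          + p * Quotient.mkHom (nullIdeal A) (LInfty.const a) * p‖ ≤ 3 * δ := by
  let _ : PartialOrder (LInftyModJ A) := CStarAlgebra.spectralOrder _
  have _ : StarOrderedRing (LInftyModJ A) := CStarAlgebra.spectralOrderedRing _
  obtain ⟨s, rfl⟩ := CStarAlgebra.nonneg_iff_eq_star_mul_self.1 ha
  obtain ⟨f, hf⟩ : ∃ f : FinMat A, ‖star s * s - star (incl f) * incl f‖ < δ / 4 := by
    have ho : IsOpen {x : Stabilization A | ‖star s * s - star x * x‖ < δ / 4} :=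
      isOpen_lt (by fun_prop) continuous_const
    obtain ⟨f, hf⟩ := denseRange_incl.exists_mem_open ho ⟨s, by simpa using hδ⟩
    exact ⟨f, hf⟩
  obtain ⟨n, hn⟩ := f.eventually_supp.exists
  set N := CStarMatrix.mapₙₐ
    ((Quotient.mkHom (ClosedStarIdeal.span (JSet A))).comp LInfty.const) (FinMat.corner n f)
  have hN : quotMatrixHom n (star N * N) =
      Quotient.mkHom (nullIdeal A) (LInfty.const (star (incl f) * incl f)) := by
    rw [map_mul, map_star, quotMatrixHom_map_corner hn, ← map_star (Quotient.mkHom (nullIdeal A)),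
      ← map_star LInfty.const, ← map_mul, ← map_mul]
  refine exists_projection_of_map (quotMatrixHom n) (IsSelfAdjoint.star_mul_self N)
    (((IsSelfAdjoint.star_mul_self s).map LInfty.const).map _)
    (h.exists_matrix_projection (a := star N * N) ⟨N, rfl⟩ hδ) ?_
  rw [hN, ← map_sub, ← map_sub]
  exact (NonUnitalStarAlgHom.norm_apply_le _ _).trans
    ((NonUnitalStarAlgHom.norm_apply_le _ _).trans hf.le)

end ConstantSequences

/-! ### Elements of hereditary subalgebras -/

section HereditaryMembership

variable {B : Type u} [NonUnitalCStarAlgebra B]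

theorem cfcₙ_mul_id' {g : ℝ → ℝ} (hg : Continuous g) (hg0 : g 0 = 0) {a : B}
    (ha : IsSelfAdjoint a) : cfcₙ (fun t => g t * t) a = cfcₙ g a * a := by
  rw [cfcₙ_mul g (fun t => t) a hg.continuousOn hg0 continuous_id.continuousOn rfl,
    cfcₙ_id' ℝ a ha]

/-- `(z - s)₊` is of the form `z l(z) z`. -/
theorem cut_eq_mul_mul {z : B} (hz : IsSelfAdjoint z) {s : ℝ} (hs : 0 < s) :
    ∃ l : B, cut s z = z * l * z := by
  have hc : Continuous fun t : ℝ => max (t - s) 0 / max t s ^ 2 :=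
    continuous_max_sub.div (by fun_prop) fun t =>
      pow_ne_zero 2 (hs.trans_le (le_max_right _ _)).ne'
  have hc0 : max ((0 : ℝ) - s) 0 / max 0 s ^ 2 = 0 := by rw [max_sub_zero hs.le, zero_div]
  refine ⟨cfcₙ (fun t : ℝ => max (t - s) 0 / max t s ^ 2) z, ?_⟩
  have h1 : z * cfcₙ (fun t : ℝ => max (t - s) 0 / max t s ^ 2) z
      = cfcₙ (fun t : ℝ => t * (max (t - s) 0 / max t s ^ 2)) z := by
    rw [cfcₙ_mul (fun t => t) _ z continuous_id.continuousOn rfl hc.continuousOn hc0,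
      cfcₙ_id' ℝ z hz]
  rw [h1, ← cfcₙ_mul_id' (g := fun t => t * (max (t - s) 0 / max t s ^ 2)) (continuous_id.mul hc) (by simp) hz, cut]
  congr 1
  funext t
  rcases le_total t s with h | h
  · simp [max_eq_right (sub_nonpos.2 h)]
  · rw [max_eq_left h]
    have : t ≠ 0 := (hs.trans_le h).ne'
    field_simp

variable [PartialOrder B] [StarOrderedRing B]

theorem star_sqrt (a : B) : star (CFC.sqrt a) = CFC.sqrt a :=
  (IsSelfAdjoint.of_nonneg (CFC.sqrt_nonneg a)).star_eq

theorem sqrt_mul_mul_sqrt_mem_her {a : B} (ha : 0 ≤ a) (y : B) :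
    CFC.sqrt a * y * CFC.sqrt a ∈ Her a := by
  have hs := star_sqrt a
  have hss := CFC.sqrt_mul_sqrt_self a ha
  have hE : Tendsto (fun ε : ℝ => CFC.sqrt a * cfcₙ (fn ε) a) (𝓝[>] 0) (𝓝 (CFC.sqrt a)) := by
    rw [tendsto_iff_norm_sub_tendsto_zero]
    have hlim : Tendsto (fun ε : ℝ => √(2 * ε)) (𝓝[>] 0) (𝓝 0) := by
      have hc : Continuous fun ε : ℝ => √(2 * ε) := by fun_prop
      have := (hc.tendsto 0).mono_left (nhdsWithin_le_nhds (s := Set.Ioi 0))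
      simpa using this
    refine squeeze_zero' (Eventually.of_forall fun _ => norm_nonneg _) ?_ hlim
    filter_upwards [self_mem_nhdsWithin] with ε hε
    exact norm_mul_fn_sub_le ha (by rw [hs, hss]) hε
  have hlim : Tendsto (fun ε : ℝ => star (CFC.sqrt a * cfcₙ (fn ε) a) * y *
      (CFC.sqrt a * cfcₙ (fn ε) a)) (𝓝[>] 0) (𝓝 (CFC.sqrt a * y * CFC.sqrt a)) := by
    have := ((hE.star).mul_const y).mul hE
    rwa [hs] at this
  refine mem_closure_of_tendsto hlim ?_
  filter_upwards [self_mem_nhdsWithin] with ε hε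
  have hε : 0 < ε := hε
  -- `f_ε(a) = g(a) a` for a continuous function `g`
  have hgc : Continuous fun t : ℝ => fn ε t / max t ε :=
    continuous_fn.div (by fun_prop) fun t => (hε.trans_le (le_max_right _ _)).ne'
  have hg : cfcₙ (fn ε) a = cfcₙ (fun t : ℝ => fn ε t / max t ε) a * a := by
    rw [← cfcₙ_mul_id' hgc (by simp [fn_zero hε]) (.of_nonneg ha)]
    congr 1
    funext t
    rcases le_total t ε with h | h
    · simp [fn_eq_zero hε h]
    · rw [max_eq_left h, div_mul_cancel₀ _ (hε.trans_le h).ne']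
  refine ⟨star (CFC.sqrt a * cfcₙ (fun t : ℝ => fn ε t / max t ε) a) * y *
    (CFC.sqrt a * cfcₙ (fun t : ℝ => fn ε t / max t ε) a), ?_⟩
  change a * _ * a = _
  rw [hg, ← mul_assoc (CFC.sqrt a), star_mul _ a, (IsSelfAdjoint.of_nonneg ha).star_eq]
  simp only [mul_assoc]

end HereditaryMembership

/-! ### Oscillation and spectral bands -/

section SpectralGap

variable {A : Type u} [NonUnitalCStarAlgebra A]

open Stabilization

/-- A bump function: `1` on `[s, 2 s]` and `0` off `[s / 2, 4 s]`. -/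
noncomputable def bump (s t : ℝ) : ℝ := fn (s / 2) t * (1 - fn (2 * s) t)

theorem continuous_bump {s : ℝ} : Continuous (bump s) :=
  continuous_fn.mul (continuous_const.sub continuous_fn)

theorem bump_eq_zero {s t : ℝ} (hs : 0 < s) (h : t ≤ s / 2) : bump s t = 0 := by
  rw [bump, fn_eq_zero (half_pos hs) h, zero_mul]

theorem bump_eq_zero' {s t : ℝ} (hs : 0 < s) (h : 4 * s ≤ t) : bump s t = 0 := by
  rw [bump, fn_eq_one (mul_pos two_pos hs) (by linarith), sub_self, mul_zero]

theorem bump_eq_one {s t : ℝ} (hs : 0 < s) (h : s ≤ t) (h' : t ≤ 2 * s) : bump s t = 1 := by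
  rw [bump, fn_eq_one (half_pos hs) (by linarith), fn_eq_zero (mul_pos two_pos hs) h']
  ring

/-- The oscillation of `(z - s)₊` is at most the trace of `z` on the spectral band `[s / 2, 4 s]`. -/
theorem tracialOsc_cut_le {z : Stabilization A} (hz : 0 ≤ z) {s : ℝ} (hs : 0 < s) :
    tracialOsc (cut s z) ≤ norm2 (cfcₙ (bump s) z) ^ 2 := by
  have hzs : IsSelfAdjoint z := .of_nonneg hz
  have hb0 : bump s 0 = 0 := bump_eq_zero hs (half_pos hs).le
  have hbs : IsSelfAdjoint (cfcₙ (bump s) z) := cfcₙ_predicate _ _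
  obtain ⟨m, hm⟩ := exists_nat_one_div_lt (half_pos hs)
  have hm0 : (0 : ℝ) < 1 / (m + 1) := by positivity
  refine iInf_le_of_le m (iSup₂_le fun τ hτ => ?_)
  rw [tsub_le_iff_left]
  refine iSup_le fun n => ?_
  have hn0 : (0 : ℝ) < 1 / (n + 1) := by positivity
  have hcomp : ∀ ε : ℝ, 0 < ε →
      cfcₙ (fn ε) (cut s z) = cfcₙ (fun t : ℝ => fn ε (max (t - s) 0)) z := fun ε hε => by
    rw [cut, ← cfcₙ_comp' (fn ε) (fun t : ℝ => max (t - s) 0) z continuous_fn.continuousOn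
      (fn_zero hε) continuous_max_sub.continuousOn (max_sub_zero hs.le) hzs]
  have hcont : ∀ ε : ℝ, Continuous fun t : ℝ => fn ε (max (t - s) 0) := fun ε =>
    continuous_fn.comp continuous_max_sub
  have hzero : ∀ ε : ℝ, 0 < ε → fn ε (max (0 - s) 0) = 0 := fun ε hε => by
    rw [max_sub_zero hs.le, fn_zero hε]
  have hbb : cfcₙ (fun t => bump s t * bump s t) z = star (cfcₙ (bump s) z) * cfcₙ (bump s) z := by
    rw [hbs.star_eq, cfcₙ_mul _ _ z continuous_bump.continuousOn hb0 continuous_bump.continuousOn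
      hb0]
  have hbbc : Continuous fun t => bump s t * bump s t := continuous_bump.mul continuous_bump
  have h1 : cfcₙ (fn (1 / (n + 1))) (cut s z) ≤
      cfcₙ (fn (1 / (m + 1))) (cut s z) + star (cfcₙ (bump s) z) * cfcₙ (bump s) z := by
    rw [hcomp _ hn0, hcomp _ hm0, ← hbb, ← cfcₙ_add _ _ z (hcont _).continuousOn (hzero _ hm0)
      hbbc.continuousOn (by simp [hb0])]
    refine cfcₙ_mono (fun t _ => ?_) (hcont _).continuousOn ((hcont _).add hbbc).continuousOn
      (hf0 := hzero _ hn0) (hg0 := by simp only [hzero _ hm0, hb0]; simp)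
    have h2 : 0 ≤ bump s t * bump s t := mul_self_nonneg _
    rcases le_total t s with h | h
    · rw [max_eq_right (sub_nonpos.2 h), fn_zero hn0, fn_zero hm0]
      simpa using h2
    rcases le_total t (2 * s) with h' | h'
    · rw [bump_eq_one hs h h']
      have := fn_le_one (1 / ((n : ℝ) + 1)) (max (t - s) 0)
      have := fn_nonneg (1 / ((m : ℝ) + 1)) (max (t - s) 0)
      linarith
    · rw [fn_eq_one hm0 (t := max (t - s) 0) ((by linarith : _ ≤ t - s).trans (le_max_left _ _))]
      have := fn_le_one (1 / ((n : ℝ) + 1)) (max (t - s) 0)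
      linarith
  have hcomm : Commute (cfcₙ (fn (1 / (m + 1))) (cut s z))
      (star (cfcₙ (bump s) z) * cfcₙ (bump s) z) := by
    rw [hcomp _ hm0, ← hbb]
    exact cfcₙ_commute_cfcₙ _ _ _
  have hfn : ∀ ε : ℝ, 0 ≤ cfcₙ (fn ε) (cut s z) := fun ε => cfcₙ_nonneg fun t _ => fn_nonneg _ t
  calc τ.val (cfcₙ (fn (1 / (n + 1))) (cut s z))
      ≤ τ.val (cfcₙ (fn (1 / (m + 1))) (cut s z) + star (cfcₙ (bump s) z) * cfcₙ (bump s) z) :=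
        τ.val_mono (hfn _) h1
    _ ≤ τ.val (cfcₙ (fn (1 / (m + 1))) (cut s z))
          + τ.val (star (cfcₙ (bump s) z) * cfcₙ (bump s) z) :=
        τ.2.1.extVal_add_le_of_commute (hfn _) (star_mul_self_nonneg _) hcomm
    _ ≤ _ := by gcongr; exact val_le_norm2_sq hτ _

/-- Cutting at the level `s` costs at most `√s ‖√a‖₂` in the trace norm. -/
theorem norm2_sub_cut_le {a z : Stabilization A} (hz : 0 ≤ z) (hza : z ≤ a) {s : ℝ} (hs : 0 ≤ s) :
    norm2 (z - cut s z) ≤ ENNReal.ofReal √s * norm2 (CFC.sqrt a) := by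
  have hzs : IsSelfAdjoint z := .of_nonneg hz
  have hc : Continuous fun t : ℝ => t - max (t - s) 0 := by fun_prop
  have hc0 : (0 : ℝ) - max (0 - s) 0 = 0 := by rw [max_sub_zero hs, sub_zero]
  have h1 : z - cut s z = cfcₙ (fun t : ℝ => t - max (t - s) 0) z := by
    rw [cfcₙ_sub (fun t : ℝ => t) _ z continuous_id.continuousOn rfl
      continuous_max_sub.continuousOn (max_sub_zero hs), cfcₙ_id' ℝ z hzs, cut]
  have h2 : star (z - cut s z) * (z - cut s z) ≤ s • z := by
    have h3 : IsSelfAdjoint (cfcₙ (fun t : ℝ => t - max (t - s) 0) z) := cfcₙ_predicate _ _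
    have h4 : s • z = cfcₙ (fun t : ℝ => s * t) z := (cfcₙ_const_mul_id s z hzs).symm
    rw [h1, h3.star_eq, h4, ← cfcₙ_mul _ _ z hc.continuousOn hc0 hc.continuousOn hc0]
    refine cfcₙ_mono (fun t ht => ?_) (hc.mul hc).continuousOn (by fun_prop)
      (hf0 := by rw [hc0, mul_zero]) (hg0 := by simp)
    have ht0 := quasispectrum_nonneg' hz ht
    rcases le_total t s with h | h
    · rw [max_eq_right (sub_nonpos.2 h), sub_zero]
      exact mul_le_mul_of_nonneg_right h ht0
    · rw [max_eq_left (sub_nonneg.2 h), sub_sub_cancel]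
      exact mul_le_mul_of_nonneg_left h hs
  refine norm2_le fun τ hτ => ?_
  calc τ.val (star (z - cut s z) * (z - cut s z)) ≤ τ.val (s • z) :=
        τ.val_mono (star_mul_self_nonneg _) h2
    _ ≤ ENNReal.ofReal s * τ.val z := τ.val_smul_le hz hs
    _ ≤ ENNReal.ofReal s * τ.val (star (CFC.sqrt a) * CFC.sqrt a) := by
        rw [star_sqrt, CFC.sqrt_mul_sqrt_self a (hz.trans hza)]
        gcongr
        exact τ.val_mono hz hza
    _ ≤ ENNReal.ofReal s * norm2 (CFC.sqrt a) ^ 2 := by gcongr; exact val_le_norm2_sq hτ _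
    _ = (ENNReal.ofReal √s * norm2 (CFC.sqrt a)) ^ 2 := by
        rw [mul_pow, ← ENNReal.ofReal_pow (Real.sqrt_nonneg s), Real.sq_sqrt hs]

end SpectralGap

/-! ### Approximation by elements of small oscillation -/

section Compression

variable {A : Type u} [NonUnitalCStarAlgebra A]

open Stabilization ClosedStarIdeal

/-- A projection of bounded sequences modulo null sequences lifts to a sequence of positive
contractions. -/
theorem exists_lift_of_projection {p : (nullIdeal A).Quotient} (hp : IsSelfAdjoint p)
    (hpp : p * p = p) :
    ∃ x : LInfty (Stabilization A), Quotient.mkHom (nullIdeal A) x = p ∧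
      ∀ k, 0 ≤ x k ∧ ‖x k‖ ≤ 1 := by
  obtain ⟨x, hx, hxp⟩ := exists_isSelfAdjoint_lift _ (Quotient.mkHom_surjective (nullIdeal A)) hp
  obtain ⟨y, -, hy⟩ := exists_map_eq_cfcₙ (f := fun t : ℝ => max 0 (min 1 t)) (by fun_prop)
    (by simp) hx
  refine ⟨y, ?_, fun k => ?_⟩
  · rw [hy _ (Quotient.mkHom (nullIdeal A)), hxp, cfcₙ_clamp_of_projection hp hpp]
  · have h1 : y k = cfcₙ (fun t : ℝ => max 0 (min 1 t)) (x k) := hy _ (LInfty.eval k)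
    rw [h1]
    refine ⟨cfcₙ_nonneg fun t _ => le_max_left _ _, norm_cfcₙ_le fun t _ => ?_⟩
    rw [Real.norm_of_nonneg (le_max_left _ _)]
    exact max_le zero_le_one (min_le_left _ _)

/-- A spectral gap of `π(z)` makes the corresponding spectral band of the `z_k` vanish in the
limit. -/
theorem cfcₙ_mem_nullIdeal {z : LInfty (Stabilization A)} (hz : IsSelfAdjoint z) {f : ℝ → ℝ}
    (hf : Continuous f) (hf0 : f 0 = 0)
    (h : ∀ t ∈ quasispectrum ℝ (Quotient.mkHom (nullIdeal A) z), f t = 0) :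
    ∃ y ∈ (nullIdeal A).carrier, ∀ k, y k = cfcₙ f (z k) := by
  obtain ⟨y, -, hy⟩ := exists_map_eq_cfcₙ hf hf0 hz
  refine ⟨y, ?_, fun k => hy _ (LInfty.eval k)⟩
  rw [← Quotient.mkHom_eq_zero, hy _ (Quotient.mkHom (nullIdeal A)), ← cfcₙ_zero ℝ]
  exact cfcₙ_congr h

/-- If `l^∞(A)/J_A` has real rank zero, then a positive element `a` of the Pedersen ideal is close
in the trace norm to a compression `z = √a x √a` that has almost no mass in a spectral band near
zero. The level `κ` controls both the distance and the location of the band. -/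
theorem exists_compression (h : RealRankZero (LInftyModJ A)) {a : Stabilization A} (ha : 0 ≤ a)
    (haP : a ∈ Ped (Stabilization A)) {κ : ℝ} (hκ : 0 < κ) {η : ℝ≥0∞} (hη : 0 < η) :
    ∃ x : Stabilization A, 0 ≤ x ∧ ‖x‖ ≤ 1 ∧
      norm2 (a - CFC.sqrt a * x * CFC.sqrt a) ≤
        2 * (ENNReal.ofReal (‖CFC.sqrt (CFC.sqrt a)‖ * (16 * κ)) *
          norm2 (CFC.sqrt (CFC.sqrt a)) + η) ∧
      norm2 (cfcₙ (bump ((κ / 2) ^ 2)) (CFC.sqrt a * x * CFC.sqrt a)) ≤ η := by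
  set e := CFC.sqrt a with he
  have he0 : 0 ≤ e := CFC.sqrt_nonneg a
  have hes : IsSelfAdjoint e := .of_nonneg he0
  have hee : e * e = a := CFC.sqrt_mul_sqrt_self a ha
  have heP : e ∈ Ped (Stabilization A) := sqrt_mem_ped ha haP
  set b := CFC.sqrt e with hb
  have hb0 : 0 ≤ b := CFC.sqrt_nonneg e
  have hbs : IsSelfAdjoint b := .of_nonneg hb0
  have hbb : b * b = e := CFC.sqrt_mul_sqrt_self e he0
  have hbP : b ∈ Ped (Stabilization A) := sqrt_mem_ped he0 heP
  have hgP : CFC.sqrt b ∈ Ped (Stabilization A) := sqrt_mem_ped hb0 hbP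
  have hgg : CFC.sqrt b * CFC.sqrt b = b := CFC.sqrt_mul_sqrt_self b hb0
  set π := Quotient.mkHom (nullIdeal A) with hπ
  obtain ⟨p, hp, hpp, hp1, hp2⟩ := exists_projection_of_realRankZero h he0
    (δ := 4 * κ) (by positivity)
  rw [mul_div_cancel_left₀ κ four_ne_zero] at hp1
  obtain ⟨x, hxp, hx⟩ := exists_lift_of_projection hp hpp
  have hes' : IsSelfAdjoint (π (LInfty.const e)) := (hes.map LInfty.const).map π
  have hbs' : IsSelfAdjoint (π (LInfty.const b)) := (hbs.map LInfty.const).map π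
  have hbb' : π (LInfty.const b) * π (LInfty.const b) = π (LInfty.const e) := by
    rw [← map_mul, ← map_mul, hbb]
  have hκs : 0 < (κ / 2) ^ 2 := by positivity
  -- the distance
  have hdist : ∀ᶠ k in atTop, norm2 (a - e * x k * e) ≤
      2 * (ENNReal.ofReal (‖b‖ * (16 * κ)) * norm2 b + η) := by
    set r : LInfty (Stabilization A) :=
      LInfty.const e - LInfty.const b * x * LInfty.const b with hr
    have hrn : ‖π r‖ ≤ 3 * (4 * κ) := by
      have h1 : π r = π (LInfty.const b) * π (LInfty.const b)
          - π (LInfty.const b) * p * π (LInfty.const b) := by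
        rw [hbb', hr, map_sub, map_mul, map_mul, hxp]
      rw [h1, norm_mul_sub_mul_projection_mul hp hpp hbs', hbb']
      exact hp2
    obtain ⟨r', hr', hrn'⟩ :=
      ClosedStarIdeal.Quotient.exists_rep (nullIdeal A) (π r) (ε := 4 * κ) (by positivity)
    have hj : r - r' ∈ (nullIdeal A).carrier := (Quotient.mk_eq_mk (nullIdeal A)).1 hr'.symm
    have hlim := hj.1 (LInfty.const (CFC.sqrt b)) (CFC.sqrt b) hgP
    have hlim2 := tendsto_norm2_of_le_mul (y := fun k => b * (r - r') k * b) (C := ‖b‖) hlim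
      fun k => by
        rw [LInfty.const_apply, mul_assoc, mul_assoc _ (CFC.sqrt b), hgg]
        exact norm2_mul_le_left _ _
    filter_upwards [ENNReal.tendsto_nhds_zero.1 hlim2 η hη] with k hk
    have h1 : a - e * x k * e = b * r' k * b + b * (r - r') k * b := by
      have h2 : (r - r') k = e - b * x k * b - r' k := rfl
      rw [h2, ← hee, ← hbb]
      noncomm_ring
    rw [h1]
    refine (norm2_add_le _ _).trans ?_
    gcongr
    refine norm2_mul_le_of_norm_le ((norm_mul_le _ _).trans ?_)
    gcongr
    have := LInfty.norm_apply_le r' k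
    linarith
  -- the spectral band
  have hband : ∀ᶠ k in atTop, norm2 (cfcₙ (bump ((κ / 2) ^ 2)) (e * x k * e)) ≤ η := by
    set s := (κ / 2) ^ 2 with hs
    set z : LInfty (Stabilization A) := LInfty.const e * x * LInfty.const e with hz
    have hxs : IsSelfAdjoint x := lp.ext (funext fun k => (IsSelfAdjoint.of_nonneg (hx k).1))
    have hzs : IsSelfAdjoint z := by
      have := hxs.conjugate (LInfty.const e)
      rwa [← map_star, hes.star_eq] at this
    have hπz : π z = π (LInfty.const e) * p * π (LInfty.const e) := by
      rw [hz, map_mul, map_mul, hxp]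
    have hfc : Continuous fun t : ℝ => bump s t / max t (s / 2) :=
      continuous_bump.div (by fun_prop) fun t =>
        ((half_pos hκs).trans_le (le_max_right _ _)).ne'
    have hf0 : bump s 0 / max 0 (s / 2) = 0 := by
      rw [bump_eq_zero hκs (half_pos hκs).le, zero_div]
    obtain ⟨y, hy, hyk⟩ := cfcₙ_mem_nullIdeal hzs hfc hf0 fun t ht => by
      rw [← hπ, hπz] at ht
      rcases eq_zero_or_le_of_mem_quasispectrum hκ hp hpp hes' hp1 ht with rfl | h1
      · exact hf0
      · rw [bump_eq_zero' hκs (by rw [hs]; linarith), zero_div]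
    filter_upwards [ENNReal.tendsto_nhds_zero.1 (hy.1 (LInfty.const e * x) e heP) η hη] with k hk
    have h1 : cfcₙ (bump s) (e * x k * e) = y k * (e * x k) * e := by
      have h2 : IsSelfAdjoint (e * x k * e) := LInfty.isSelfAdjoint_apply hzs k
      have h3 : y k = cfcₙ (fun t : ℝ => bump s t / max t (s / 2)) (e * x k * e) := hyk k
      rw [mul_assoc (y k), h3, ← cfcₙ_mul_id' hfc hf0 h2]
      congr 1
      funext t
      rcases le_total t (s / 2) with h | h
      · simp [bump_eq_zero hκs h]
      · rw [max_eq_left h, div_mul_cancel₀ _ ((half_pos hκs).trans_le h).ne']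
    rw [h1]
    exact hk
  obtain ⟨k, h1, h2⟩ := (hdist.and hband).exists
  exact ⟨x k, (hx k).1, (hx k).2, h1, h2⟩

/-- Real rank zero of `l^∞(A)/J_A` gives approximations with small oscillation: cut the compression
of `exists_compression` inside the band in which it has almost no mass. -/
theorem hasTAOZ_of_realRankZero (h : RealRankZero (LInftyModJ A)) {a : Stabilization A}
    (haP : a ∈ Ped (Stabilization A)) (ha : 0 ≤ a) : HasTAOZ a := by
  intro ε hε
  have he0 : 0 ≤ CFC.sqrt a := CFC.sqrt_nonneg a
  have heP : CFC.sqrt a ∈ Ped (Stabilization A) := sqrt_mem_ped ha haP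
  have hbP : CFC.sqrt (CFC.sqrt a) ∈ Ped (Stabilization A) := sqrt_mem_ped he0 heP
  set b := CFC.sqrt (CFC.sqrt a)
  -- the part of the error that is controlled by the level `κ`
  have hlim : Tendsto (fun κ : ℝ => 2 * (2 * (ENNReal.ofReal (‖b‖ * (16 * κ)) * norm2 b) +
      ENNReal.ofReal √((κ / 2) ^ 2) * norm2 (CFC.sqrt a))) (𝓝[>] 0) (𝓝 0) := by
    have hc1 : Continuous fun κ : ℝ => ENNReal.ofReal (‖b‖ * (16 * κ)) :=
      ENNReal.continuous_ofReal.comp (by fun_prop)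
    have hc2 : Continuous fun κ : ℝ => ENNReal.ofReal √((κ / 2) ^ 2) :=
      ENNReal.continuous_ofReal.comp (by fun_prop)
    have h1 := ENNReal.Tendsto.mul_const (b := norm2 b)
      ((hc1.tendsto 0).mono_left (nhdsWithin_le_nhds (s := Set.Ioi 0)))
      (Or.inr (norm2_lt_top hbP).ne)
    have h2 := ENNReal.Tendsto.mul_const (b := norm2 (CFC.sqrt a))
      ((hc2.tendsto 0).mono_left (nhdsWithin_le_nhds (s := Set.Ioi 0)))
      (Or.inr (norm2_lt_top heP).ne)
    have h3 := ENNReal.Tendsto.const_mul (a := 2)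
      ((ENNReal.Tendsto.const_mul (a := 2) h1 (Or.inr (by simp))).add h2) (Or.inr (by simp))
    simpa using h3
  have hε2 : 0 < ENNReal.ofReal (ε / 2) := ENNReal.ofReal_pos.2 (half_pos hε)
  obtain ⟨κ, hκ1, hκ⟩ := ((ENNReal.tendsto_nhds_zero.1 hlim _ hε2).and self_mem_nhdsWithin).exists
  have hκ : 0 < κ := hκ
  set η : ℝ := min (ε / 16) 1
  have hη : 0 < η := lt_min (by positivity) one_pos
  obtain ⟨x, hx0, hx1, h1, h2⟩ := exists_compression h ha haP hκ (ENNReal.ofReal_pos.2 hη)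
  set z := CFC.sqrt a * x * CFC.sqrt a with hz
  set s := (κ / 2) ^ 2
  have hs : 0 < s := by positivity
  have hz0 : 0 ≤ z := by
    have := star_left_conjugate_nonneg hx0 (CFC.sqrt a)
    rwa [star_sqrt] at this
  have hza : z ≤ a := by
    have h3 := CStarAlgebra.star_left_conjugate_le_norm_smul (a := CFC.sqrt a) (b := x)
      (.of_nonneg hx0)
    rw [star_sqrt, CFC.sqrt_mul_sqrt_self a ha] at h3
    refine h3.trans ?_
    conv_rhs => rw [← one_smul ℝ a]
    exact smul_le_smul_of_nonneg_right hx1 ha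
  refine ⟨cut s z, ?_, isPos_iff_nonneg.2 (cut_nonneg s z), ?_, ?_, ?_⟩
  · obtain ⟨l, hl⟩ := cut_eq_mul_mul (.of_nonneg hz0) hs
    have h3 : cut s z = CFC.sqrt a * (x * CFC.sqrt a * l * (CFC.sqrt a * x)) * CFC.sqrt a := by
      rw [hl, hz]
      simp only [mul_assoc]
    rw [h3]
    exact sqrt_mul_mul_sqrt_mem_her ha _
  · have h3 : a - cut s z = (a - z) + (z - cut s z) := by abel
    rw [h3]
    have h4 : 4 * ENNReal.ofReal η < ENNReal.ofReal (ε / 2) := by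
      rw [← ENNReal.ofReal_ofNat 4, ← ENNReal.ofReal_mul (by norm_num)]
      refine (ENNReal.ofReal_lt_ofReal_iff (half_pos hε)).2 ?_
      have := min_le_left (ε / 16) 1
      change 4 * η < ε / 2
      linarith
    calc norm2 ((a - z) + (z - cut s z)) ≤ 2 * (norm2 (a - z) + norm2 (z - cut s z)) :=
          norm2_add_le _ _
      _ ≤ 2 * (2 * (ENNReal.ofReal (‖b‖ * (16 * κ)) * norm2 b + ENNReal.ofReal η) +
            ENNReal.ofReal √s * norm2 (CFC.sqrt a)) := by
          gcongr
          exact norm2_sub_cut_le hz0 hza hs.le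
      _ = 2 * (2 * (ENNReal.ofReal (‖b‖ * (16 * κ)) * norm2 b) +
            ENNReal.ofReal √s * norm2 (CFC.sqrt a)) + 4 * ENNReal.ofReal η := by ring
      _ < ENNReal.ofReal (ε / 2) + ENNReal.ofReal (ε / 2) :=
          ENNReal.add_lt_add_of_le_of_lt (hκ1.trans_lt ENNReal.ofReal_lt_top).ne hκ1 h4
      _ = ENNReal.ofReal ε := by
          rw [← ENNReal.ofReal_add (half_pos hε).le (half_pos hε).le, add_halves]
  · exact (cut_norm_le (.of_nonneg hz0) hs.le).trans
      (CStarAlgebra.norm_le_norm_of_nonneg_of_le hz0 hza)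
  · refine (tracialOsc_cut_le hz0 hs).trans_lt ?_
    calc norm2 (cfcₙ (bump s) z) ^ 2 ≤ ENNReal.ofReal η ^ 2 := by gcongr
      _ = ENNReal.ofReal (η ^ 2) := (ENNReal.ofReal_pow hη.le 2).symm
      _ < ENNReal.ofReal ε := by
          refine (ENNReal.ofReal_lt_ofReal_iff hε).2 ?_
          have h3 : η ≤ ε / 16 := min_le_left _ _
          have h4 : η ≤ 1 := min_le_right _ _
          nlinarith

end Compression

theorem mainTheorem4 (A : Type*) [NonUnitalCStarAlgebra A] [TopologicalSpace.SeparableSpace A]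
    (hA : IsSimpleCStar A) (hQT : (QT A).Nonempty) :
    List.TFAE [
      (∀ a : Stabilization A, a ∈ Ped (Stabilization A) → IsPos a → HasTAOZ a),
      (∀ a : A, a ∈ Ped A → IsPos a → HasTAOZ (Stabilization.e11 a)),
      RealRankZero (LInftyModJ A)] := by
  tfae_have 1 → 2 := fun h a ha ⟨b, hb⟩ =>
    h _ (e11_mem_ped ha) ⟨Stabilization.e11 b, by rw [hb, e11_mul, star_e11]⟩
  tfae_have 2 → 3 := realRankZero_of_hasTAOZ
  tfae_have 3 → 1 := fun h a ha hpos => hasTAOZ_of_realRankZero h ha (isPos_iff_nonneg.1 hpos)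
  tfae_finish
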